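/- \textbf{Setting.} A \emph{2-complex} is a graph (loops and parallel edges allowed) together with faces, each attached along a closed walk of the graph; its geometric realisation is the cell complex obtained by gluing a closed disc along each of these walks. \emph{Contracting} a set $S$ of edges (loops allowed) means identifying the two endvertices of each edge of $S$ and deleting the edges of $S$ from the graph and from all boundary walks of faces; the result is written $C/S$, and $C/e$ if $S=\{e\}$. A 2-complex \emph{embeds in 3-space} if its geometric realisation admits a topological embedding into $\mathbb{R}^3$. Let $n\ge 20$ and let $C$ be the cuboid complex of size $(2n+1)\times n\times n$: its vertices are the integer points of $[0,2n+1]\times[0,n]\times[0,n]$, its edges join the vertices at distance $1$, and a face is attached to each 4-cycle. Let $C'$ be a 2-complex obtained from $C$ by subdividing some of the (square) faces into two triangles by a diagonal; the added edges are called \emph{diagonal edges}. Let $T'$ be a spanning tree of the 1-skeleton of $C'$ such that (i) $T'$ contains all diagonal edges, and (ii) every fundamental cycle of $T'$ in the 1-skeleton of $C'$ contains three consecutive diagonal edges in the same direction (i.e. collinear in $\mathbb{R}^3$) that are not all contained in the boundary surface of the cuboid $[0,2n+1]\times[0,n]\times[0,n]$. Let $C''=C'/T'$, a 2-complex with exactly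 one vertex. \textbf{Lemma.} For every edge $e''$ of $C''$, the 2-complex $C''/e''$ does not embed in 3-space. -/

import Mathlib

/-- `IsWalk src tgt u l v`: the list `l` of oriented edges (`true` means traversed from `src` to
`tgt`, `false` means traversed backwards) is a walk from `u` to `v`. -/
def IsWalk {V E : Type} (src tgt : E → V) : V → List (E × Bool) → V → Prop
  | u, [], v => u = v
  | u, (e, true) :: l, v => src e = u ∧ IsWalk src tgt (tgt e) l v
  | u, (e, false) :: l, v => tgt e = u ∧ IsWalk src tgt (src e) l v

/-- A 2-complex: a graph (loops and parallel edges allowed; each edge carries a reference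
orientation), together with faces, each of which is attached along a closed walk `bdry f`
starting and ending at the vertex `base f`. The walk may be empty. -/
structure TwoComplex where
  Vertex : Type
  Edge : Type
  Face : Type
  src : Edge → Vertex
  tgt : Edge → Vertex
  base : Face → Vertex
  bdry : Face → List (Edge × Bool)
  closed : ∀ f, IsWalk src tgt (base f) (bdry f) (base f)

namespace TwoComplex

/-! ### Contraction of edges -/

open scoped Classical in
/-- Delete from a walk all the edges that lie in `S`. -/
noncomputable def dropEdges {E : Type} (S : Set E) (l : List (E × Bool)) :
    List ({e : E // e ∉ S} × Bool) :=
  l.filterMap fun d => if h : d.1 ∉ S then some (⟨d.1, h⟩, d.2) else none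

/-- The vertices after contraction of `S`: the two endvertices of each edge of `S` are
identified. -/
def ContractVertex (C : TwoComplex) (S : Set C.Edge) : Type :=
  Quot fun u v : C.Vertex => ∃ e ∈ S, C.src e = u ∧ C.tgt e = v

theorem isWalk_dropEdges (C : TwoComplex) (S : Set C.Edge) (l : List (C.Edge × Bool))
    (u v : C.Vertex) (h : IsWalk C.src C.tgt u l v) :
    IsWalk (V := C.ContractVertex S) (fun e : {e : C.Edge // e ∉ S} => Quot.mk _ (C.src e.1))
      (fun e => Quot.mk _ (C.tgt e.1)) (Quot.mk _ u) (dropEdges S l) (Quot.mk _ v) := by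
  induction l generalizing u with
  | nil =>
    simp only [IsWalk] at h
    subst h
    exact rfl
  | cons d l ih =>
    obtain ⟨e, b⟩ := d
    by_cases he : e ∈ S
    · have hd : dropEdges S ((e, b) :: l) = dropEdges S l := by simp [dropEdges, he]
      have hs : (Quot.mk _ (C.src e) : C.ContractVertex S) = Quot.mk _ (C.tgt e) :=
        Quot.sound ⟨e, he, rfl, rfl⟩
      rw [hd]
      cases b with
      | true =>
        obtain ⟨rfl, h2⟩ := h
        rw [hs]
        exact ih _ h2
      | false =>
        obtain ⟨rfl, h2⟩ := h
        rw [← hs]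
        exact ih _ h2
    · have hd : dropEdges S ((e, b) :: l) = (⟨e, he⟩, b) :: dropEdges S l := by
        simp [dropEdges, he]
      rw [hd]
      cases b with
      | true =>
        obtain ⟨rfl, h2⟩ := h
        exact ⟨rfl, ih _ h2⟩
      | false =>
        obtain ⟨rfl, h2⟩ := h
        exact ⟨rfl, ih _ h2⟩

/-- The 2-complex `C / S` obtained from `C` by contracting all the edges in `S`. Contracting a
single edge `e` (possibly a loop) is `C.contract {e}`. -/
noncomputable def contract (C : TwoComplex) (S : Set C.Edge) : TwoComplex where
  Vertex := C.ContractVertex S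
  Edge := {e : C.Edge // e ∉ S}
  Face := C.Face
  src e := Quot.mk _ (C.src e.1)
  tgt e := Quot.mk _ (C.tgt e.1)
  base f := Quot.mk _ (C.base f)
  bdry f := dropEdges S (C.bdry f)
  closed f := C.isWalk_dropEdges S _ _ _ (C.closed f)

/-! ### Geometric realisation and embeddings in 3-space -/

/-- The disjoint union of one point for each vertex, one unit interval for each edge and one
closed unit disc for each face. -/
abbrev Cells (C : TwoComplex) : Type :=
  (Σ _ : C.Vertex, Unit) ⊕ (Σ _ : C.Edge, unitInterval) ⊕
    (Σ _ : C.Face, Metric.closedBall (0 : ℂ) 1)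

/-- The gluing: the ends of an edge are glued to its endvertices, and the boundary circle of a
face with boundary walk of length `k ≥ 1` is divided into `k` arcs of equal length which are
glued, one after the other, along the edges of the walk. If the walk is empty, the whole boundary
circle is glued to the base vertex. -/
inductive Glue (C : TwoComplex) : C.Cells → C.Cells → Prop
  | src (e : C.Edge) : Glue C (.inr (.inl ⟨e, 0⟩)) (.inl ⟨C.src e, ()⟩)
  | tgt (e : C.Edge) : Glue C (.inr (.inl ⟨e, 1⟩)) (.inl ⟨C.tgt e, ()⟩)
  | arc (f : C.Face) (k : Fin (C.bdry f).length) (t : unitInterval)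
      (z : Metric.closedBall (0 : ℂ) 1)
      (hz : (z : ℂ) = Complex.exp
        (2 * Real.pi * Complex.I * ((k : ℕ) + (t : ℝ)) / (C.bdry f).length)) :
      Glue C (.inr (.inr ⟨f, z⟩))
        (.inr (.inl ⟨((C.bdry f).get k).1,
          if ((C.bdry f).get k).2 then t else unitInterval.symm t⟩))
  | empty (f : C.Face) (hf : C.bdry f = []) (z : Metric.closedBall (0 : ℂ) 1)
      (hz : ‖(z : ℂ)‖ = 1) :
      Glue C (.inr (.inr ⟨f, z⟩)) (.inl ⟨C.base f, ()⟩)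

/-- The geometric realisation of a 2-complex, with the quotient topology. -/
def Realization (C : TwoComplex) : Type := Quot C.Glue

instance (C : TwoComplex) : TopologicalSpace C.Realization :=
  inferInstanceAs (TopologicalSpace (Quot C.Glue))

/-- `C` embeds in 3-space: there is a topological embedding of its geometric realisation
into `ℝ³`. -/
def EmbedsIn3Space (C : TwoComplex) : Prop :=
  ∃ f : C.Realization → EuclideanSpace ℝ (Fin 3), Topology.IsEmbedding f

/-! ### Spanning trees of the 1-skeleton -/

/-- The graph on all the vertices of `C` whose adjacencies come from the edges in `S`. -/
def graph (C : TwoComplex) (S : Set C.Edge) : SimpleGraph C.Vertex where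
  Adj u v := u ≠ v ∧ ∃ e ∈ S, s(C.src e, C.tgt e) = s(u, v)
  symm := ⟨fun u v h => ⟨h.1.symm, by
    obtain ⟨e, he, h2⟩ := h.2
    exact ⟨e, he, h2.trans Sym2.eq_swap⟩⟩⟩
  loopless := ⟨fun _ h => h.1 rfl⟩

/-- `T` is (the edge set of) a spanning tree of the 1-skeleton of `C`: it has no loops, no
parallel edges, and the graph that it forms on the vertex set of `C` is a tree. -/
def IsSpanningTree (C : TwoComplex) (T : Set C.Edge) : Prop :=
  (∀ e ∈ T, C.src e ≠ C.tgt e) ∧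
  (∀ e ∈ T, ∀ e' ∈ T, s(C.src e, C.tgt e) = s(C.src e', C.tgt e') → e = e') ∧
  (C.graph T).IsTree

end TwoComplex

/-! ### Cuboid complexes and their subdivisions

Throughout, `N : Fin 3 → ℕ` holds the three side lengths of a cuboid. -/

namespace Cuboid

/-- The unit step along the axis `i`. -/
def step (i : Fin 3) : Fin 3 → ℕ := Pi.single i 1

/-- The vertices: the integer points `p` with `0 ≤ p i ≤ N i` for all `i`. -/
abbrev Vertex (N : Fin 3 → ℕ) : Type := {p : Fin 3 → ℕ // p ≤ N}

/-- The edges of the cuboid complex: the pair `(p, i)` stands for the edge between the vertices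
`p` and `p + step i`, which are at distance 1. -/
abbrev GridEdge (N : Fin 3 → ℕ) : Type :=
  {x : (Fin 3 → ℕ) × Fin 3 // x.1 + step x.2 ≤ N}

/-- The faces of the cuboid complex, one for each 4-cycle of its 1-skeleton: the triple
`(p, i, j)` with `i < j` stands for the unit square with the vertices `p`, `p + step i`,
`p + step i + step j`, `p + step j`. -/
abbrev Square (N : Fin 3 → ℕ) : Type :=
  {x : (Fin 3 → ℕ) × Fin 3 × Fin 3 // x.2.1 < x.2.2 ∧ x.1 + step x.2.1 + step x.2.2 ≤ N}

variable {N : Fin 3 → ℕ}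

namespace GridEdge

def src (x : GridEdge N) : Vertex N := ⟨x.1.1, le_self_add.trans x.2⟩

def tgt (x : GridEdge N) : Vertex N := ⟨x.1.1 + step x.1.2, x.2⟩

end GridEdge

namespace Square

theorem add_right_comm (s : Square N) :
    s.1.1 + step s.1.2.2 + step s.1.2.1 = s.1.1 + step s.1.2.1 + step s.1.2.2 :=
  _root_.add_right_comm _ _ _

/-- The corner `p`. -/
def c00 (s : Square N) : Vertex N := ⟨s.1.1, (le_self_add.trans le_self_add).trans s.2.2⟩

/-- The corner `p + step i`. -/
def c10 (s : Square N) : Vertex N := ⟨s.1.1 + step s.1.2.1, le_self_add.trans s.2.2⟩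

/-- The corner `p + step j`. -/
def c01 (s : Square N) : Vertex N :=
  ⟨s.1.1 + step s.1.2.2, le_self_add.trans (s.add_right_comm.le.trans s.2.2)⟩

/-- The corner `p + step i + step j`. -/
def c11 (s : Square N) : Vertex N := ⟨s.1.1 + step s.1.2.1 + step s.1.2.2, s.2.2⟩

/-- The side from `p` to `p + step i`. -/
def bottom (s : Square N) : GridEdge N := ⟨(s.1.1, s.1.2.1), s.c10.2⟩

/-- The side from `p + step i` to `p + step i + step j`. -/
def right (s : Square N) : GridEdge N := ⟨(s.1.1 + step s.1.2.1, s.1.2.2), s.2.2⟩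

/-- The side from `p + step j` to `p + step i + step j`. -/
def top (s : Square N) : GridEdge N :=
  ⟨(s.1.1 + step s.1.2.2, s.1.2.1), s.add_right_comm.le.trans s.2.2⟩

/-- The side from `p` to `p + step j`. -/
def left (s : Square N) : GridEdge N := ⟨(s.1.1, s.1.2.2), s.c01.2⟩

theorem tgt_top (s : Square N) : s.top.tgt = s.c11 := Subtype.ext s.add_right_comm

end Square

/-- A choice of the faces to be subdivided, with the diagonal that is used: `none` means that
the square is not subdivided, `some true` that it is subdivided by the diagonal from `p` to
`p + step i + step j`, and `some false` that it is subdivided by the diagonal from `p + step i`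
to `p + step j`. -/
abbrev Subdivision (N : Fin 3 → ℕ) : Type := Square N → Option Bool

/-- The diagonal edges. -/
abbrev DiagEdge (D : Subdivision N) : Type := {x : Square N × Bool // D x.1 = some x.2}

namespace DiagEdge

variable {D : Subdivision N}

def src (d : DiagEdge D) : Vertex N := if d.1.2 then d.1.1.c00 else d.1.1.c10

def tgt (d : DiagEdge D) : Vertex N := if d.1.2 then d.1.1.c11 else d.1.1.c01

end DiagEdge

/-- The 2-complex obtained from the cuboid complex with side lengths `N` by subdividing some of
its faces of size four into two triangles, as prescribed by `D`. Its edges are the edges of the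
cuboid complex and the diagonal edges; its faces are the squares that are not subdivided and two
triangles for each square that is subdivided. -/
def subdivided (N : Fin 3 → ℕ) (D : Subdivision N) : TwoComplex where
  Vertex := Vertex N
  Edge := GridEdge N ⊕ DiagEdge D
  Face := {s : Square N // D s = none} ⊕ (DiagEdge D × Bool)
  src := Sum.elim GridEdge.src DiagEdge.src
  tgt := Sum.elim GridEdge.tgt DiagEdge.tgt
  base
    | .inl s => s.1.c00
    | .inr (⟨(s, true), _⟩, _) => s.c00
    | .inr (⟨(s, false), _⟩, true) => s.c00
    | .inr (⟨(s, false), _⟩, false) => s.c10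
  bdry
    | .inl s => [(.inl s.1.bottom, true), (.inl s.1.right, true), (.inl s.1.top, false),
        (.inl s.1.left, false)]
    | .inr (⟨(s, true), h⟩, true) =>
        [(.inl s.bottom, true), (.inl s.right, true), (.inr ⟨(s, true), h⟩, false)]
    | .inr (⟨(s, true), h⟩, false) =>
        [(.inr ⟨(s, true), h⟩, true), (.inl s.top, false), (.inl s.left, false)]
    | .inr (⟨(s, false), h⟩, true) =>
        [(.inl s.bottom, true), (.inr ⟨(s, false), h⟩, true), (.inl s.left, false)]
    | .inr (⟨(s, false), h⟩, false) =>
        [(.inl s.right, true), (.inl s.top, false), (.inr ⟨(s, false), h⟩, false)]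
  closed f := by
    rcases f with s | ⟨⟨⟨s, b⟩, h⟩, b'⟩
    · exact ⟨rfl, rfl, s.1.tgt_top, rfl, rfl⟩
    · cases b <;> cases b'
      · exact ⟨rfl, s.tgt_top, rfl, rfl⟩
      · exact ⟨rfl, rfl, rfl, rfl⟩
      · exact ⟨rfl, s.tgt_top, rfl, rfl⟩
      · exact ⟨rfl, rfl, rfl, rfl⟩

/-- The vertices `u` and `v` are the endvertices of a diagonal edge. -/
def DiagAdj (D : Subdivision N) (u v : Vertex N) : Prop :=
  ∃ d : DiagEdge D, s(d.src, d.tgt) = s(u, v)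

/-- The vertex `v` does not lie on the boundary surface of the cuboid. -/
def IsInterior (v : Vertex N) : Prop := ∀ i, 0 < v.1 i ∧ v.1 i < N i

/-- `a, b, c, d` are the consecutive vertices of a path of three diagonal edges in the same
direction which is not contained in the boundary surface of the cuboid. (As `b` and `c` lie
strictly between `a` and `d` on a line, such a path is contained in the boundary surface as soon
as `b` or `c` lies on it.) -/
def IsStraightTriple (D : Subdivision N) (a b c d : Vertex N) : Prop :=
  DiagAdj D a b ∧ DiagAdj D b c ∧ DiagAdj D c d ∧
  (∀ i, (b.1 i : ℤ) - a.1 i = (c.1 i : ℤ) - b.1 i ∧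
    (c.1 i : ℤ) - b.1 i = (d.1 i : ℤ) - c.1 i) ∧
  IsInterior b ∧ IsInterior c

/-- Every fundamental cycle of `T` contains three consecutive diagonal edges in the same
direction, not all in the boundary surface of the cuboid. The fundamental cycle of an edge `e`
outside `T` consists of `e` and the path in `T` between the endvertices of `e`. This is meant for
`T` containing all the diagonal edges: then `e` is not a diagonal edge, so that three consecutive
diagonal edges of the cycle are consecutive on the path. -/
def FundamentalCyclesContainStraightTriple (D : Subdivision N)
    (T : Set (subdivided N D).Edge) : Prop :=
  ∀ e : (subdivided N D).Edge, e ∉ T →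
    ∃ p : ((subdivided N D).graph T).Walk ((subdivided N D).src e) ((subdivided N D).tgt e),
      p.IsPath ∧ ∃ a b c d : Vertex N, IsStraightTriple D a b c d ∧ [a, b, c, d] <:+: p.support

end Cuboid

/-! ### The Borsuk–Ulam theorem for odd maps from the 3-sphere to 3-space -/

/-! Write S for `T` together with `e`. The complex in question arises from the subdivided cuboid by
contracting S, so it has one vertex. Its link graph has the ends of the edges outside S as vertices
and the corners of faces as edges. The theorem follows from two facts: this link graph contains a
K₃,₃ minor, and a complex with one vertex and such a link does not embed in 3-space.

Topological part (`not_embedsIn3Space_of_linkConnected`). A K₃,₃ in the link yields a map of the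
cone over K₃,₃ into the realisation such that the cones over disjoint edges meet at most in the
vertex. The deleted join of a three-point set is a hexagon, so that of K₃,₃ is a join of two
circles, a 3-sphere. Given a map to 3-space, the difference of the images of the two points of a
pair is an odd map from this sphere, and Borsuk–Ulam (`exists_zero_of_odd`) provides a zero: two
points over disjoint edges, at least one of them away from the apex, with equal image. This
contradicts injectivity. Borsuk–Ulam itself is obtained from Tucker's lemma, proved with chains
modulo 2 on iterated barycentric subdivisions of the cross-polytope. The disjointness of cones is
controlled by `supp`, which assigns to each point of the realisation the darts near it.

Combinatorial part (`Branches.exists_linked`). Let a, b, c, d be consecutive collinear vertices on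
the fundamental cycle of `e`. Exchanging bc for `e` turns `T` into another spanning tree. Rooted at
b, the rest of the cycle descends in it from b via a to d and then c. At any vertex other than b,
the link stays connected when the parent is removed; at c, the vertex b is removed as well, which is
harmless because b, c, d are collinear. By induction from the leaves, each branch at b becomes a
connected piece of the contracted link (`Branches.joined`). Before contraction the link at the
interior vertex b is an octahedron, some of whose edges are subdivided by diagonals. The vertices a
and c subdivide two opposite edges of it, and they lie in the same branch, hence act as a single
vertex. If a subdivides the edge yu, c subdivides an edge at v, and p, q are the poles off the plane
of these edges, then {p, q, a = c} and {y, u, v} are the sides of a K₃,₃. -/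

namespace ChainMod2

variable {E : Type}

/-- Formal sums modulo 2 of ordered simplices, which are lists of vertices. -/
abbrev Chain (E : Type) : Type := List E →₀ ZMod 2

/-- The cone over a chain with apex `x`. -/
noncomputable def cone (x : E) : Chain E →ₗ[ZMod 2] Chain E :=
  Finsupp.lmapDomain (ZMod 2) (ZMod 2) (List.cons x)

/-- The boundary of a simplex. -/
noncomputable def bdSimplex : List E → Chain E
  | [] => 0
  | x :: l => Finsupp.single l 1 + cone x (bdSimplex l)

/-- The boundary of a chain. -/
noncomputable def bd : Chain E →ₗ[ZMod 2] Chain E :=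
  Finsupp.linearCombination (ZMod 2) bdSimplex

theorem bd_single (l : List E) : bd (Finsupp.single l 1) = bdSimplex l := by
  simp [bd]

theorem cone_single (x : E) (l : List E) :
    cone x (Finsupp.single l 1) = Finsupp.single (x :: l) (1 : ZMod 2) := by
  simp [cone]

theorem chain_add_self (c : Chain E) : c + c = 0 := by
  ext l
  exact CharTwo.add_self_eq_zero _

theorem hom_ext {M : Type} [AddCommMonoid M] [Module (ZMod 2) M] {f g : Chain E →ₗ[ZMod 2] M}
    (h : ∀ l, f (Finsupp.single l 1) = g (Finsupp.single l 1)) : f = g :=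
  Finsupp.lhom_ext' fun l => LinearMap.ext_ring (h l)

/-- The complex is augmented, a single vertex having the empty simplex as boundary, so the cone
formula has no exception in low degree. -/
theorem bd_cone (x : E) (c : Chain E) : bd (cone x c) = c + cone x (bd c) := by
  have : bd ∘ₗ cone x = LinearMap.id + cone x ∘ₗ bd := by
    refine hom_ext fun l => ?_
    simp [cone_single, bd_single, bdSimplex]
  exact LinearMap.congr_fun this c

theorem bd_bdSimplex (l : List E) : bd (bdSimplex l) = 0 := by
  induction l with
  | nil => simp [bdSimplex]
  | cons x l ih =>
    rw [bdSimplex, map_add, bd_single, bd_cone, ih, map_zero, add_zero, chain_add_self]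

/-- The chain map induced by a map of the vertices. -/
noncomputable def pushforward {E' : Type} (f : E → E') : Chain E →ₗ[ZMod 2] Chain E' :=
  Finsupp.lmapDomain (ZMod 2) (ZMod 2) (List.map f)

theorem pushforward_single {E' : Type} (f : E → E') (l : List E) :
    pushforward f (Finsupp.single l 1) = Finsupp.single (l.map f) (1 : ZMod 2) := by
  simp [pushforward]

theorem pushforward_cone {E' : Type} (f : E → E') (x : E) (c : Chain E) :
    pushforward f (cone x c) = cone (f x) (pushforward f c) := by
  have : pushforward f ∘ₗ cone x = cone (f x) ∘ₗ pushforward f := by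
    refine hom_ext fun l => ?_
    simp [cone_single, pushforward_single]
  exact LinearMap.congr_fun this c

theorem pushforward_bdSimplex {E' : Type} (f : E → E') (l : List E) :
    pushforward f (bdSimplex l) = bdSimplex (l.map f) := by
  induction l with
  | nil => simp [bdSimplex]
  | cons x l ih => simp [bdSimplex, pushforward_single, pushforward_cone, ih]

theorem pushforward_bd {E' : Type} (f : E → E') (c : Chain E) :
    pushforward f (bd c) = bd (pushforward f c) := by
  have : pushforward f ∘ₗ bd = bd ∘ₗ pushforward f := by
    refine hom_ext fun l => ?_
    simp [bd_single, pushforward_single, pushforward_bdSimplex]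
  exact LinearMap.congr_fun this c

/-- The chains all of whose simplices satisfy `P`. -/
abbrev On (P : List E → Prop) : Submodule (ZMod 2) (Chain E) :=
  Finsupp.supported (ZMod 2) (ZMod 2) {l | P l}

theorem map_mem {E' : Type} {P : List E → Prop} {f : Chain E →ₗ[ZMod 2] Chain E'}
    {M : Submodule (ZMod 2) (Chain E')}
    (h : ∀ l, P l → f (Finsupp.single l 1) ∈ M) {c : Chain E} (hc : c ∈ On P) : f c ∈ M := by
  have : On P ≤ M.comap f := by
    rw [On, Finsupp.supported_eq_span_single, Submodule.span_le]
    rintro _ ⟨l, hl, rfl⟩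
    exact h l hl
  exact this hc

/-- Identities that hold only for simplices of a given kind, such as those of a fixed length, extend
by linearity to the chains made of them. -/
theorem eq_of_on {M : Type} [AddCommMonoid M] [Module (ZMod 2) M] {P : List E → Prop}
    {f g : Chain E →ₗ[ZMod 2] M}
    (h : ∀ l, P l → f (Finsupp.single l 1) = g (Finsupp.single l 1)) {c : Chain E}
    (hc : c ∈ On P) : f c = g c := by
  have : On P ≤ LinearMap.eqLocus f g := by
    rw [On, Finsupp.supported_eq_span_single, Submodule.span_le]
    rintro _ ⟨l, hl, rfl⟩
    exact h l hl
  exact this hc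

theorem single_mem_on {P : List E → Prop} {l : List E} (h : P l) :
    Finsupp.single l 1 ∈ On P :=
  Finsupp.single_mem_supported _ _ h

theorem on_mono {P P' : List E → Prop} (h : ∀ l, P l → P' l) {c : Chain E} (hc : c ∈ On P) :
    c ∈ On P' :=
  Finsupp.supported_mono (fun l hl => h l hl) hc

theorem cone_mem_on {P P' : List E → Prop} {x : E} (h : ∀ l, P l → P' (x :: l)) {c : Chain E}
    (hc : c ∈ On P) : cone x c ∈ On P' :=
  map_mem (fun l hl => by rw [cone_single]; exact single_mem_on (h l hl)) hc

theorem bdSimplex_mem_on (l : List E) :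
    bdSimplex l ∈ On fun l' => l'.length + 1 = l.length ∧ l' ⊆ l := by
  induction l with
  | nil => exact Submodule.zero_mem _
  | cons x l ih =>
    refine Submodule.add_mem _ (single_mem_on ⟨rfl, by simp⟩) (cone_mem_on ?_ ih)
    rintro l' ⟨h1, h2⟩
    refine ⟨by simp [h1], ?_⟩
    exact List.cons_subset_cons x h2

variable [AddCommGroup E] [Module ℝ E]

/-- The barycentre of the vertices of a simplex. -/
noncomputable def bary (l : List E) : E := (l.length : ℝ)⁻¹ • l.sum

/-- Barycentric subdivision of simplices with `n` vertices. -/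
noncomputable def sdSimplex : ℕ → List E → Chain E
  | 0, l => Finsupp.single l 1
  | n + 1, l => cone (bary l) (Finsupp.linearCombination (ZMod 2) (sdSimplex n) (bdSimplex l))

/-- Barycentric subdivision of chains of simplices with `n` vertices. -/
noncomputable def sd (n : ℕ) : Chain E →ₗ[ZMod 2] Chain E :=
  Finsupp.linearCombination (ZMod 2) (sdSimplex n)

theorem sd_single (n : ℕ) (l : List E) : sd n (Finsupp.single l 1) = sdSimplex n l := by
  simp [sd]

theorem sdSimplex_succ (n : ℕ) (l : List E) :
    sdSimplex (n + 1) l = cone (bary l) (sd n (bdSimplex l)) := rfl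

/-- Applying the cone formula to the barycentre leaves the subdivided boundary plus the cone over
its boundary; the latter vanishes by induction and because the boundary squares to zero. The index
of `sd` counts vertices, so it drops by one under `bd`. -/
theorem bd_sd (n : ℕ) {c : Chain E} (hc : c ∈ On fun l => l.length = n + 1) :
    bd (sd (n + 1) c) = sd n (bd c) := by
  induction n generalizing c with
  | zero =>
    let f : Chain E →ₗ[ZMod 2] Chain E := bd ∘ₗ sd 1
    let g : Chain E →ₗ[ZMod 2] Chain E := sd 0 ∘ₗ bd
    suffices h : ∀ l : List E, l.length = 0 + 1 → f (Finsupp.single l 1) = g (Finsupp.single l 1) from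
      eq_of_on h hc
    intro l hl
    obtain ⟨x, rfl⟩ := List.length_eq_one_iff.1 hl
    simp [f, g, sd_single, bd_single, bdSimplex, sdSimplex, cone_single]
  | succ n ih =>
    let f : Chain E →ₗ[ZMod 2] Chain E := bd ∘ₗ sd (n + 2)
    let g : Chain E →ₗ[ZMod 2] Chain E := sd (n + 1) ∘ₗ bd
    suffices h : ∀ l : List E, l.length = n + 1 + 1 →
        f (Finsupp.single l 1) = g (Finsupp.single l 1) from eq_of_on h hc
    intro l hl
    have h1 : bdSimplex l ∈ On fun l' => l'.length = n + 1 :=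
      on_mono (fun l' h => by have := h.1; omega) (bdSimplex_mem_on l)
    simp only [f, g, LinearMap.comp_apply, sd_single, bd_single]
    rw [sdSimplex_succ, bd_cone, ih h1, bd_bdSimplex, map_zero, map_zero, add_zero]

theorem bary_map_neg (l : List E) : bary (l.map Neg.neg) = -bary l := by
  have : (l.map Neg.neg).sum = -l.sum := by
    induction l with
    | nil => simp
    | cons x l ih => simp [ih, add_comm]
  simp [bary, this]

theorem pushforward_neg_sd (n : ℕ) (c : Chain E) :
    pushforward Neg.neg (sd n c) = sd n (pushforward Neg.neg c) := by
  induction n generalizing c with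
  | zero =>
    let f : Chain E →ₗ[ZMod 2] Chain E := pushforward Neg.neg ∘ₗ sd 0
    let g : Chain E →ₗ[ZMod 2] Chain E := sd 0 ∘ₗ pushforward Neg.neg
    suffices h : f = g from LinearMap.congr_fun h c
    refine hom_ext fun l => ?_
    simp [f, g, sd_single, sdSimplex, pushforward_single]
  | succ n ih =>
    let f : Chain E →ₗ[ZMod 2] Chain E := pushforward Neg.neg ∘ₗ sd (n + 1)
    let g : Chain E →ₗ[ZMod 2] Chain E := sd (n + 1) ∘ₗ pushforward Neg.neg
    suffices h : f = g from LinearMap.congr_fun h c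
    refine hom_ext fun l => ?_
    simp only [f, g, LinearMap.comp_apply, sd_single, pushforward_single, sdSimplex_succ,
      pushforward_cone, ih, bary_map_neg, pushforward_bdSimplex]

end ChainMod2

/-! ### The mesh of barycentric subdivisions. -/

namespace ChainMod2

variable {E : Type} [NormedAddCommGroup E] [NormedSpace ℝ E]

theorem bary_mem_convexHull {l : List E} (hl : l ≠ []) : bary l ∈ convexHull ℝ {x | x ∈ l} := by
  have hpos : 0 < (l.length : ℝ) := by exact_mod_cast List.length_pos_iff.2 hl
  have h : bary l = ∑ i : Fin l.length, (l.length : ℝ)⁻¹ • l.get i := by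
    rw [bary, ← Finset.smul_sum]
    congr 1
    conv_lhs => rw [← List.ofFn_get l]
    rw [List.sum_ofFn]
  rw [h]
  refine (convex_convexHull ℝ _).sum_mem (fun _ _ => by positivity) ?_ fun i _ =>
    subset_convexHull ℝ _ (List.get_mem l i)
  simp [hpos.ne']

/-- Balls are convex, so only vertices `x` need to be considered. Averaging the differences of the
vertices from `x` gives the factor (k - 1)/k for k vertices, at most 3/4 when k ≤ 4. -/
theorem dist_bary_le {l : List E} {D : ℝ} (hl : l.length ≤ 4)
    (hD : ∀ x ∈ l, ∀ y ∈ l, dist x y ≤ D) {x : E} (hx : x ∈ convexHull ℝ {x | x ∈ l}) :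
    dist (bary l) x ≤ 3 / 4 * D := by
  suffices h : {x | x ∈ l} ⊆ Metric.closedBall (bary l) (3 / 4 * D) by
    have := convexHull_min h (convex_closedBall _ _) hx
    rwa [Metric.mem_closedBall, dist_comm] at this
  intro x hx
  rw [Metric.mem_closedBall, dist_comm, dist_eq_norm]
  have hD0 : 0 ≤ D := dist_nonneg.trans (hD x hx x hx)
  have hpos : 0 < (l.length : ℝ) := by exact_mod_cast List.length_pos_of_mem hx
  have key : ∀ l' : List E, (∀ y ∈ l', dist x y ≤ D) →
      ‖l'.sum - (l'.length : ℝ) • x‖ ≤ l'.length * D := by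
    intro l' h
    induction l' with
    | nil => simp
    | cons y l' ih =>
      have h1 := ih fun z hz => h z (List.mem_cons_of_mem _ hz)
      have h2 := h y List.mem_cons_self
      rw [dist_comm, dist_eq_norm] at h2
      have h3 : (y :: l').sum - ((y :: l').length : ℝ) • x
          = (y - x) + (l'.sum - (l'.length : ℝ) • x) := by
        simp only [List.sum_cons, List.length_cons, Nat.cast_add, Nat.cast_one, add_smul, one_smul]
        abel
      rw [h3]
      refine (norm_add_le _ _).trans ?_
      push_cast [List.length_cons]
      linarith
  -- One occurrence of `x` is split off; its difference from `x` is zero, which saves one of the k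
  -- summands.
  obtain ⟨l1, l2, rfl⟩ := List.append_of_mem hx
  set l := l1 ++ x :: l2 with hldef
  have h1 := key (l1 ++ l2) fun y hy => hD x hx y (by
    rcases List.mem_append.1 hy with h | h <;> simp [l, h])
  have hlen : (l.length : ℝ) = ((l1 ++ l2).length : ℝ) + 1 := by
    simp only [hldef, List.length_append, List.length_cons]; push_cast; ring
  have h2 : bary l - x
      = (l.length : ℝ)⁻¹ • ((l1 ++ l2).sum - ((l1 ++ l2).length : ℝ) • x) := by
    have : (l1 ++ l2).sum - ((l1 ++ l2).length : ℝ) • x = l.sum - (l.length : ℝ) • x := by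
      rw [hlen, add_smul, one_smul]
      simp only [hldef, List.sum_append, List.sum_cons]
      abel
    rw [this, smul_sub, smul_smul, inv_mul_cancel₀ hpos.ne', one_smul, bary]
  rw [h2, norm_smul, norm_inv, Real.norm_natCast, inv_mul_le_iff₀ hpos]
  refine h1.trans ?_
  have h4 : (l.length : ℝ) ≤ 4 := by exact_mod_cast hl
  nlinarith

/-- An edge of the subdivision either contains the barycentre, where `dist_bary_le` applies, or lies
in a subdivided proper face, where the induction does. The convex hull condition later keeps the
simplices inside one facet. -/
theorem sdSimplex_mem_on (n : ℕ) (hn : n ≤ 4) {l : List E} (hl : l.length = n) {D : ℝ}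
    (hD : ∀ x ∈ l, ∀ y ∈ l, dist x y ≤ D) (hD0 : 0 ≤ D) :
    sdSimplex n l ∈ On fun l' => l'.length = n ∧ (∀ x ∈ l', x ∈ convexHull ℝ {y | y ∈ l}) ∧
      ∀ x ∈ l', ∀ y ∈ l', dist x y ≤ 3 / 4 * D := by
  induction n generalizing l with
  | zero =>
    obtain rfl := List.length_eq_zero_iff.1 hl
    exact single_mem_on (by simp)
  | succ n ih =>
    have h1 : sd n (bdSimplex l) ∈ On fun l' : List E => l'.length = n ∧
        (∀ x ∈ l', x ∈ convexHull ℝ {y | y ∈ l}) ∧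
        ∀ x ∈ l', ∀ y ∈ l', dist x y ≤ 3 / 4 * D := by
      refine map_mem (fun l' hl' => ?_) (bdSimplex_mem_on l)
      rw [sd_single]
      refine on_mono ?_ (ih (by omega) (l := l') (by have := hl'.1; omega)
        fun x hx y hy => hD x (hl'.2 hx) y (hl'.2 hy))
      rintro l'' ⟨h1, h2, h3⟩
      exact ⟨h1, fun x hx => convexHull_mono (fun y hy => hl'.2 hy) (h2 x hx), h3⟩
    refine cone_mem_on ?_ h1
    rintro l' ⟨h1, h2, h3⟩
    have hne : l ≠ [] := by rintro rfl; simp at hl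
    refine ⟨by simp [h1], ?_, ?_⟩
    · intro x hx
      rcases List.mem_cons.1 hx with rfl | hx
      · exact bary_mem_convexHull hne
      · exact h2 x hx
    · intro x hx y hy
      rcases List.mem_cons.1 hx with rfl | hx <;> rcases List.mem_cons.1 hy with rfl | hy
      · simpa using hD0
      · exact dist_bary_le (by omega) hD (h2 y hy)
      · rw [dist_comm]
        exact dist_bary_le (by omega) hD (h2 x hx)
      · exact h3 x hx y hy

end ChainMod2

/-! ### Fine antipodal triangulations of the cross-polytope, Tucker's lemma and Borsuk–Ulam. -/

namespace BorsukUlam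

open ChainMod2

/-- A facet of the cross-polytope with vertices `±R eᵢ`. -/
def facet (R : ℝ) (ε : Fin 4 → ℝ) : Set (Fin 4 → ℝ) :=
  {v | (∀ i, 0 ≤ ε i * v i) ∧ ∑ i, ε i * v i = R}

theorem convex_facet (R : ℝ) (ε : Fin 4 → ℝ) : Convex ℝ (facet R ε) := by
  rintro x ⟨hx, hx'⟩ y ⟨hy, hy'⟩ s t hs ht hst
  refine ⟨fun i => ?_, ?_⟩
  · have : ε i * (s • x + t • y) i = s * (ε i * x i) + t * (ε i * y i) := by
      simp only [Pi.add_apply, Pi.smul_apply, smul_eq_mul]; ring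
    rw [this]
    exact add_nonneg (mul_nonneg hs (hx i)) (mul_nonneg ht (hy i))
  · have : ∑ i, ε i * (s • x + t • y) i = s * ∑ i, ε i * x i + t * ∑ i, ε i * y i := by
      rw [Finset.mul_sum, Finset.mul_sum, ← Finset.sum_add_distrib]
      refine Finset.sum_congr rfl fun i _ => ?_
      simp only [Pi.add_apply, Pi.smul_apply, smul_eq_mul]; ring
    rw [this, hx', hy', ← add_mul, hst, one_mul]

theorem sum_abs_of_mem_facet {R : ℝ} {ε v : Fin 4 → ℝ} (hε : ∀ i, ε i = 1 ∨ ε i = -1)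
    (hv : v ∈ facet R ε) : ∑ i, |v i| = R := by
  rw [← hv.2]
  refine Finset.sum_congr rfl fun i _ => ?_
  have h := hv.1 i
  rcases hε i with h1 | h1 <;> rw [h1] at h ⊢
  · rw [abs_of_nonneg (by linarith), one_mul]
  · rw [abs_of_nonpos (by linarith)]; ring

/-- A simplex with `n` vertices and diameter at most `D` inside a facet of the cross-polytope. -/
def Small (R : ℝ) (n : ℕ) (D : ℝ) (l : List (Fin 4 → ℝ)) : Prop :=
  l.length = n ∧ (∃ ε : Fin 4 → ℝ, (∀ i, ε i = 1 ∨ ε i = -1) ∧ ∀ x ∈ l, x ∈ facet R ε) ∧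
    ∀ x ∈ l, ∀ y ∈ l, dist x y ≤ D

/-- The hemispheres of the cross-polytope. -/
noncomputable def hemisphere (R : ℝ) : ℕ → Chain (Fin 4 → ℝ)
  | 0 => Finsupp.single [R • Pi.single 0 1] 1
  | k + 1 => cone (R • Pi.single (Fin.ofNat 4 (k + 1)) 1)
      (hemisphere R k + pushforward Neg.neg (hemisphere R k))

theorem pushforward_neg_neg (c : Chain (Fin 4 → ℝ)) :
    pushforward Neg.neg (pushforward Neg.neg c) = c := by
  refine LinearMap.congr_fun (f := pushforward Neg.neg ∘ₗ pushforward Neg.neg)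
    (g := LinearMap.id) (hom_ext fun l => ?_) c
  simp [pushforward_single]

/-- A hemisphere is the cone over the equatorial sphere, the sum of a lower hemisphere and its
antipode. That sphere is a cycle, as both halves have the same boundary and coefficients are modulo
2. -/
theorem bd_hemisphere (R : ℝ) (k : ℕ) :
    bd (hemisphere R (k + 1)) = hemisphere R k + pushforward Neg.neg (hemisphere R k) := by
  have h : bd (hemisphere R k + pushforward Neg.neg (hemisphere R k)) = 0 := by
    rw [map_add, ← pushforward_bd]
    cases k with
    | zero =>
      simp [hemisphere, bd_single, bdSimplex, pushforward_single, chain_add_self]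
    | succ k =>
      rw [bd_hemisphere R k, map_add, pushforward_neg_neg, add_comm (pushforward _ _),
        chain_add_self]
  rw [hemisphere, bd_cone, h, map_zero, add_zero]

theorem hemisphere_mem_on {R : ℝ} (hR : 0 ≤ R) {k : ℕ} (hk : k < 4) :
    hemisphere R k ∈ On (Small R (k + 1) (2 * R)) := by
  have key : hemisphere R k ∈ On fun l => l.length = k + 1 ∧ ∃ ε : Fin 4 → ℝ,
      (∀ i, ε i = 1 ∨ ε i = -1) ∧
      ∀ x ∈ l, ∃ i : Fin 4, (i : ℕ) ≤ k ∧ x = R • Pi.single i (ε i) := by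
    induction k with
    | zero =>
      refine single_mem_on ⟨rfl, fun _ => 1, by simp, fun x hx => ⟨0, by simp, by simpa using hx⟩⟩
    | succ k ih =>
      have ih := ih (by omega)
      refine cone_mem_on (P := fun l => l.length = k + 1 ∧ ∃ ε : Fin 4 → ℝ,
        (∀ i, ε i = 1 ∨ ε i = -1) ∧
        ∀ x ∈ l, ∃ i : Fin 4, (i : ℕ) ≤ k ∧ x = R • Pi.single i (ε i)) ?_
        (Submodule.add_mem _ ih (map_mem ?_ ih))
      · rintro l ⟨h1, ε, h2, h3⟩
        have hval : ((Fin.ofNat 4 (k + 1) : Fin 4) : ℕ) = k + 1 := by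
          simp [Fin.ofNat, Nat.mod_eq_of_lt hk]
        -- The simplex so far uses only axes up to `k`, so the sign on axis `k + 1` is free to be
        -- set to that of the apex.
        refine ⟨by simp [h1], Function.update ε (Fin.ofNat 4 (k + 1)) 1, fun i => ?_, ?_⟩
        · by_cases hi : i = Fin.ofNat 4 (k + 1)
          · subst hi; simp
          · rw [Function.update_of_ne hi]; exact h2 i
        · intro x hx
          rcases List.mem_cons.1 hx with rfl | hx
          · exact ⟨Fin.ofNat 4 (k + 1), hval.le, by simp⟩
          · obtain ⟨i, hi, rfl⟩ := h3 x hx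
            refine ⟨i, by omega, ?_⟩
            rw [Function.update_of_ne]
            rintro rfl
            omega
      · rintro l ⟨h1, ε, h2, h3⟩
        rw [pushforward_single]
        refine single_mem_on ⟨by simp [h1], -ε, fun i => ?_, ?_⟩
        · rcases h2 i with h | h <;> simp [h]
        · intro x hx
          obtain ⟨y, hy, rfl⟩ := List.mem_map.1 hx
          obtain ⟨i, hi, rfl⟩ := h3 y hy
          refine ⟨i, hi, ?_⟩
          rw [Pi.neg_apply, Pi.single_neg, smul_neg]
  refine on_mono ?_ key
  rintro l ⟨h1, ε, h2, h3⟩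
  refine ⟨h1, ⟨ε, h2, ?_⟩, ?_⟩
  · intro x hx
    obtain ⟨i, -, rfl⟩ := h3 x hx
    have hsq : ε i * ε i = 1 := by rcases h2 i with h | h <;> rw [h] <;> norm_num
    have hj : ∀ j, ε j * (R • Pi.single i (ε i) : Fin 4 → ℝ) j = if j = i then R else 0 := by
      intro j
      by_cases hji : j = i
      · subst hji
        simp only [Pi.smul_apply, Pi.single_eq_same, smul_eq_mul, if_true]
        linear_combination R * hsq
      · simp [hji]
    refine ⟨fun j => ?_, ?_⟩
    · rw [hj]; split_ifs <;> simp [hR]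
    · rw [Finset.sum_congr rfl fun j _ => hj j]; simp
  · have hb : ∀ x ∈ l, ‖x‖ ≤ R := by
      intro x hx
      obtain ⟨i, -, rfl⟩ := h3 x hx
      rw [pi_norm_le_iff_of_nonneg hR]
      intro j
      by_cases hji : j = i
      · subst hji
        have : |ε j| = 1 := by rcases h2 j with h | h <;> rw [h] <;> norm_num
        simp [this, abs_of_nonneg hR]
      · simp [hji, hR]
    intro x hx y hy
    have := dist_le_norm_add_norm x y
    linarith [hb x hx, hb y hy]

theorem sd_mem_on {R D : ℝ} (hD : 0 ≤ D) {n : ℕ} (hn : n ≤ 4) {c : Chain (Fin 4 → ℝ)}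
    (hc : c ∈ On (Small R n D)) : sd n c ∈ On (Small R n (3 / 4 * D)) := by
  refine map_mem ?_ hc
  rintro l ⟨h1, ⟨ε, h2, h3⟩, h4⟩
  rw [sd_single]
  refine on_mono ?_ (sdSimplex_mem_on n hn h1 h4 hD)
  rintro l' ⟨h1', h3', h4'⟩
  exact ⟨h1', ⟨ε, h2, fun x hx => convexHull_min h3 (convex_facet R ε) (h3' x hx)⟩, h4'⟩

/-- Subdivision commutes with the boundary and with the antipodal map, so it preserves the relations
between the hemispheres while the mesh shrinks geometrically. -/
theorem exists_fine_hemispheres {R : ℝ} (hR : 0 ≤ R) (m : ℕ) :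
    ∃ h : ℕ → Chain (Fin 4 → ℝ), h 0 = Finsupp.single [R • Pi.single 0 1] 1 ∧
      (∀ k, k < 3 → bd (h (k + 1)) = h k + pushforward Neg.neg (h k)) ∧
      ∀ k, k < 4 → h k ∈ On (Small R (k + 1) ((3 / 4) ^ m * (2 * R))) := by
  induction m with
  | zero =>
    exact ⟨hemisphere R, rfl, fun k _ => bd_hemisphere R k, fun k hk => by
      simpa using hemisphere_mem_on hR hk⟩
  | succ m ih =>
    obtain ⟨h, h0, h1, h2⟩ := ih
    refine ⟨fun k => sd (k + 1) (h k), ?_, fun k hk => ?_, fun k hk => ?_⟩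
    · simp only [h0, sd_single, sdSimplex_succ, bdSimplex, map_zero, add_zero]
      simp [sdSimplex, cone_single, bary]
    · rw [bd_sd (k + 1) (on_mono (fun l hl => hl.1) (h2 (k + 1) (by omega))), h1 k hk, map_add,
        pushforward_neg_sd]
    · have := sd_mem_on (by positivity) (by omega) (h2 k hk)
      rwa [← mul_assoc, ← pow_succ'] at this

/-- Labels `±0, ±1, ±2`. -/
abbrev Label : Type := Fin 3 × Bool

def Label.neg (a : Label) : Label := (a.1, !a.2)

/-- The indicator function of the simplices whose labels can be ordered so that the absolute
values increase strictly and the signs alternate, starting with `+`. -/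
def alternating : List Label → ZMod 2
  | [a] => if a.2 then 1 else 0
  | [a, b] => if (a.1 < b.1 ∧ a.2 ∧ !b.2) ∨ (b.1 < a.1 ∧ b.2 ∧ !a.2) then 1 else 0
  | [a, b, c] =>
    if a.1 ≠ b.1 ∧ a.1 ≠ c.1 ∧ b.1 ≠ c.1 ∧ (a.2 = (a.1 != 1)) ∧ (b.2 = (b.1 != 1)) ∧
      (c.2 = (c.1 != 1)) then 1 else 0
  | _ => 0

/-- In the absence of complementary labels, the coboundary of the alternating cochain in one
dimension is the symmetrised alternating cochain in the next. These finite checks replace the usual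
path-following argument for Tucker's lemma. -/
theorem alternating_cobd_two : ∀ a b : Label, a ≠ b.neg →
    alternating [b] + alternating [a]
      = alternating [a, b] + alternating [a.neg, b.neg] := by
  decide

theorem alternating_cobd_three : ∀ a b c : Label, a ≠ b.neg → a ≠ c.neg → b ≠ c.neg →
    alternating [b, c] + (alternating [a, c] + alternating [a, b])
      = alternating [a, b, c] + alternating [a.neg, b.neg, c.neg] := by
  decide

-- With three absolute values there is no alternating simplex on four vertices, so the coboundary of
-- the last cochain vanishes.
set_option maxRecDepth 100000 in
set_option maxHeartbeats 1000000 in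
theorem alternating_cobd_four : ∀ a b c d : Label,
    (a ≠ b.neg ∧ a ≠ c.neg ∧ a ≠ d.neg ∧ b ≠ c.neg ∧ b ≠ d.neg ∧ c ≠ d.neg) →
    alternating [b, c, d] + (alternating [a, c, d] + (alternating [a, b, d] +
      alternating [a, b, c])) = 0 := by
  decide

/-- The number of alternating simplices of a chain, for a labelling of the points. -/
noncomputable def count (lab : (Fin 4 → ℝ) → Label) : Chain (Fin 4 → ℝ) →ₗ[ZMod 2] ZMod 2 :=
  Finsupp.linearCombination (ZMod 2) fun l => alternating (l.map lab)

theorem count_single (lab : (Fin 4 → ℝ) → Label) (l : List (Fin 4 → ℝ)) :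
    count lab (Finsupp.single l 1) = alternating (l.map lab) := by
  simp [count]

/-- A combinatorial form of Tucker's lemma. -/
theorem exists_complementary {lab : (Fin 4 → ℝ) → Label} {R D : ℝ}
    (hlab : ∀ v, ∑ i, |v i| = R → lab (-v) = (lab v).neg)
    (hcomp : ∀ v w, ∑ i, |v i| = R → ∑ i, |w i| = R → dist v w ≤ D → lab v ≠ (lab w).neg)
    {h : ℕ → Chain (Fin 4 → ℝ)} (h0 : h 0 = Finsupp.single [R • Pi.single 0 1] 1)
    (hbd : ∀ k, k < 3 → bd (h (k + 1)) = h k + pushforward Neg.neg (h k))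
    (hsmall : ∀ k, k < 4 → h k ∈ On (Small R (k + 1) D)) : False := by
  let ν : Chain (Fin 4 → ℝ) →ₗ[ZMod 2] Chain (Fin 4 → ℝ) := pushforward Neg.neg
  have hsum : ∀ {k l}, Small R k D l → ∀ x ∈ l, ∑ i, |x i| = R := by
    rintro k l ⟨-, ⟨ε, h2, h3⟩, -⟩ x hx
    exact sum_abs_of_mem_facet h2 (h3 x hx)
  have hne : ∀ {k l}, Small R k D l → ∀ x ∈ l, ∀ y ∈ l, lab x ≠ (lab y).neg := fun hs x hx y hy =>
    hcomp x y (hsum hs x hx) (hsum hs y hy) (hs.2.2 x hx y hy)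
  -- The coboundary identities, summed over all simplices of a hemisphere.
  have step : ∀ k, k < 3 → count lab (h (k + 1)) + count lab (ν (h (k + 1)))
      = count lab (bd (h (k + 1))) := by
    intro k hk
    refine eq_of_on (f := count lab + count lab ∘ₗ ν) (g := count lab ∘ₗ bd) (fun l hl => ?_)
      (hsmall (k + 1) (by omega))
    have hs := hsum hl
    have hn := hne hl
    have hlen := hl.1
    simp only [LinearMap.add_apply, LinearMap.comp_apply, ν, pushforward_single, bd_single,
      count_single]
    interval_cases k
    · obtain ⟨a, b, rfl⟩ := List.length_eq_two.1 hlen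
      simp only [bdSimplex, map_add, map_zero, cone_single, count_single, add_zero, List.map_cons,
        List.map_nil, hlab a (hs a (by simp)), hlab b (hs b (by simp))]
      exact (alternating_cobd_two _ _ (hn a (by simp) b (by simp))).symm
    · obtain ⟨a, b, c, rfl⟩ := List.length_eq_three.1 hlen
      simp only [bdSimplex, map_add, map_zero, cone_single, count_single, add_zero, List.map_cons,
        List.map_nil, hlab a (hs a (by simp)), hlab b (hs b (by simp)), hlab c (hs c (by simp))]
      exact (alternating_cobd_three _ _ _ (hn a (by simp) b (by simp))
        (hn a (by simp) c (by simp)) (hn b (by simp) c (by simp))).symm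
    · obtain ⟨a, l, rfl⟩ := List.exists_cons_of_length_eq_add_one hlen
      obtain ⟨b, c, d, rfl⟩ := List.length_eq_three.1 (Nat.succ.inj hlen)
      simp only [bdSimplex, map_add, map_zero, cone_single, count_single, add_zero, List.map_cons,
        List.map_nil]
      rw [alternating_cobd_four _ _ _ _ ⟨hn a (by simp) b (by simp), hn a (by simp) c (by simp),
        hn a (by simp) d (by simp), hn b (by simp) c (by simp), hn b (by simp) d (by simp),
        hn c (by simp) d (by simp)⟩]
      simp [alternating]
  -- The parity on a hemisphere and its antipode passes to the next dimension because the two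
  -- together bound there. It starts at 1, as exactly one of two antipodal points has a positive
  -- label.
  have h1 : ∀ k, k < 4 → count lab (h k) + count lab (ν (h k)) = 1 := by
    intro k hk
    induction k with
    | zero =>
      simp only [h0, ν, pushforward_single, count_single, List.map_cons, List.map_nil]
      rw [hlab]
      · generalize lab _ = a
        revert a
        decide
      · have h0' := hsmall 0 (by omega)
        rw [h0] at h0'
        have h0'' : Small R 1 D [R • Pi.single 0 1] := by
          have := (Finsupp.mem_supported _ _).1 h0'
          refine this ?_
          simp [Finsupp.support_single]
        exact hsum h0'' _ (by simp)
    | succ k ih =>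
      rw [step k (by omega), hbd k (by omega), map_add]
      exact ih (by omega)
  -- Lists of four labels fall under the default value 0 of `alternating`.
  have h2 : count lab (h 3) + count lab (ν (h 3)) = 0 := by
    refine eq_of_on (f := count lab + count lab ∘ₗ ν) (g := 0) (fun l hl => ?_)
      (hsmall 3 (by omega))
    obtain ⟨a, l, rfl⟩ := List.exists_cons_of_length_eq_add_one hl.1
    obtain ⟨b, c, d, rfl⟩ := List.length_eq_three.1 (Nat.succ.inj hl.1)
    simp [ν, pushforward_single, count_single, alternating]
  rw [h1 3 (by omega)] at h2
  exact one_ne_zero h2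

/-- The Borsuk–Ulam theorem for the 3-sphere. -/
theorem exists_zero_of_odd {F : (Fin 4 → ℝ) → Fin 3 → ℝ} (hF : Continuous F)
    (hodd : ∀ v, F (-v) = -F v) {R : ℝ} (hR : 0 ≤ R) : ∃ v, ∑ i, |v i| = R ∧ F v = 0 := by
  by_contra! hne
  let K : Set (Fin 4 → ℝ) := {v | ∑ i, |v i| = R}
  have hKc : IsClosed K := isClosed_eq (by fun_prop) continuous_const
  have hK : IsCompact K := by
    refine Metric.isCompact_of_isClosed_isBounded hKc
      ((Metric.isBounded_iff_subset_closedBall 0).2 ⟨R, fun v hv => ?_⟩)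
    rw [mem_closedBall_zero_iff, pi_norm_le_iff_of_nonneg hR]
    intro i
    rw [Real.norm_eq_abs, ← show ∑ i, |v i| = R from hv]
    exact Finset.single_le_sum (f := fun i => |v i|) (fun _ _ => abs_nonneg _) (Finset.mem_univ i)
  obtain ⟨δ, hδ, hδK⟩ : ∃ δ > 0, ∀ v ∈ K, δ ≤ ‖F v‖ := by
    rcases K.eq_empty_or_nonempty with hK0 | hK0
    · exact ⟨1, one_pos, by simp [hK0]⟩
    · obtain ⟨v, hv, hmin⟩ := hK.exists_isMinOn hK0 hF.norm.continuousOn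
      exact ⟨‖F v‖, norm_pos_iff.2 (hne v hv), fun w hw => hmin hw⟩
  obtain ⟨η, hη, hFη⟩ := Metric.uniformContinuousOn_iff.1
    (hK.uniformContinuousOn_of_continuous hF.continuousOn) δ hδ
  have hex : ∀ v, ∃ i : Fin 3, v ∈ K → δ ≤ |F v i| := by
    intro v
    by_contra! h
    have hv := (h 0).1
    refine absurd (hδK v hv) (not_le.2 ?_)
    rw [pi_norm_lt_iff hδ]
    exact fun i => (h i).2
  -- The first coordinate of absolute value at least δ is chosen. The choice depends only on
  -- absolute values, so antipodal points receive the same index.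
  have hidx : ∃ idx : (Fin 4 → ℝ) → Fin 3, (∀ v ∈ K, δ ≤ |F v (idx v)|) ∧
      ∀ v, idx (-v) = idx v := by
    classical
    let P : (Fin 4 → ℝ) → Fin 3 → Prop := fun v i => δ ≤ |F v i|
    refine ⟨fun v => if P v 0 then 0 else if P v 1 then 1 else 2, fun v hv => ?_, fun v => ?_⟩
    · obtain ⟨i, hi⟩ := hex v
      have hi : P v i := hi hv
      change P v (if P v 0 then 0 else if P v 1 then 1 else 2)
      split_ifs with h0 h1
      · exact h0
      · exact h1
      · fin_cases i
        · exact absurd hi h0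
        · exact absurd hi h1
        · exact hi
    · simp only [P, hodd, Pi.neg_apply, abs_neg]
  obtain ⟨idx, hidx, hidx'⟩ := hidx
  let lab : (Fin 4 → ℝ) → Label := fun v => (idx v, decide (0 < F v (idx v)))
  obtain ⟨m, hm⟩ : ∃ m : ℕ, (3 / 4 : ℝ) ^ m * (2 * R) < η := by
    have : Filter.Tendsto (fun m : ℕ => (3 / 4 : ℝ) ^ m * (2 * R)) Filter.atTop
        (nhds (0 * (2 * R))) :=
      (tendsto_pow_atTop_nhds_zero_of_lt_one (by norm_num) (by norm_num)).mul_const _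
    rw [zero_mul] at this
    exact (this.eventually (gt_mem_nhds hη)).exists
  obtain ⟨h, h0, h1, h2⟩ := exists_fine_hemispheres hR m
  refine exists_complementary (lab := lab) (fun v hv => ?_) (fun v w hv hw hvw heq => ?_) h0 h1 h2
  · have hv' := hidx v hv
    have hne0 : F v (idx v) ≠ 0 := fun h => by rw [h, abs_zero] at hv'; linarith
    refine Prod.ext (hidx' v) ?_
    simp only [lab, Label.neg, hidx', hodd, Pi.neg_apply, Left.neg_pos_iff]
    rcases lt_or_gt_of_ne hne0 with h | h
    · simp [h, h.le]
    · simp [h, h.le]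
  -- Complementary labels mean that one coordinate has absolute value at least δ at both points with
  -- opposite signs, which uniform continuity excludes at this mesh.
  · have hi : idx v = idx w := congrArg Prod.fst heq
    have hs : decide (0 < F v (idx v)) = !decide (0 < F w (idx w)) := congrArg Prod.snd heq
    have hv' := hidx v hv
    have hw' := hidx w hw
    have hd : |F v (idx v) - F w (idx w)| < δ := by
      rw [← hi, ← Real.dist_eq]
      exact (dist_le_pi_dist (F v) (F w) _).trans_lt (hFη v hv w hw (hvw.trans_lt hm))
    rw [abs_lt] at hd
    by_cases h1 : 0 < F v (idx v)
    · have h2 : ¬ 0 < F w (idx w) := by simpa [h1] using hs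
      rw [abs_of_pos h1] at hv'
      linarith
    · have h2 : 0 < F w (idx w) := by simpa [h1] using hs
      rw [abs_of_pos h2] at hw'
      linarith

end BorsukUlam


/-! ### Link graphs, and cones over `K₃,₃` in 2-complexes -/

namespace TwoComplex

open unitInterval

/-- A dart: an edge together with one of its two ends, the one at which the dart starts. -/
abbrev Dart (Q : TwoComplex) : Type := Q.Edge × Bool

namespace Dart

variable {Q : TwoComplex}

def rev (d : Q.Dart) : Q.Dart := (d.1, !d.2)

@[simp] theorem rev_rev (d : Q.Dart) : d.rev.rev = d := by simp [rev]

def tail (d : Q.Dart) : Q.Vertex := if d.2 then Q.src d.1 else Q.tgt d.1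

def head (d : Q.Dart) : Q.Vertex := if d.2 then Q.tgt d.1 else Q.src d.1

@[simp] theorem tail_rev (d : Q.Dart) : d.rev.tail = d.head := by
  rcases d with ⟨e, _ | _⟩ <;> rfl

@[simp] theorem head_rev (d : Q.Dart) : d.rev.head = d.tail := by
  rcases d with ⟨e, _ | _⟩ <;> rfl

end Dart

variable {Q : TwoComplex}

/-- Adjacency in the link graph of all the vertices: some boundary walk enters a vertex through
the reverse of the dart `h` and leaves it through `h'`. -/
def LinkAdj (Q : TwoComplex) (h h' : Q.Dart) : Prop :=
  ∃ f l, l ~r Q.bdry f ∧ l.head? = some h' ∧ l.getLast? = some h.rev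

/-- `h` and `h'` are joined by a path in the subgraph of the link graph induced by `V`. -/
def LinkConnected (Q : TwoComplex) (V : Set Q.Dart) (h h' : Q.Dart) : Prop :=
  h ∈ V ∧ Relation.ReflTransGen
    (fun d d' => d ∈ V ∧ d' ∈ V ∧ (Q.LinkAdj d d' ∨ Q.LinkAdj d' d)) h h'

theorem LinkConnected.refl {V : Set Q.Dart} {h : Q.Dart} (hh : h ∈ V) : Q.LinkConnected V h h :=
  ⟨hh, .refl⟩

theorem LinkConnected.trans {V : Set Q.Dart} {h h' h'' : Q.Dart} (h1 : Q.LinkConnected V h h')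
    (h2 : Q.LinkConnected V h' h'') : Q.LinkConnected V h h'' :=
  ⟨h1.1, h1.2.trans h2.2⟩

theorem LinkConnected.of_adj {V : Set Q.Dart} {h h' : Q.Dart} (hh : h ∈ V) (hh' : h' ∈ V)
    (hadj : Q.LinkAdj h h' ∨ Q.LinkAdj h' h) : Q.LinkConnected V h h' :=
  ⟨hh, .single ⟨hh, hh', hadj⟩⟩

/-! #### Points of the realisation and their supports -/

def vertexPoint (v : Q.Vertex) : Q.Realization := Quot.mk _ (.inl ⟨v, ()⟩)

def edgePoint (e : Q.Edge) (t : I) : Q.Realization := Quot.mk _ (.inr (.inl ⟨e, t⟩))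

def facePoint (f : Q.Face) (z : Metric.closedBall (0 : ℂ) 1) : Q.Realization :=
  Quot.mk _ (.inr (.inr ⟨f, z⟩))

theorem continuous_edgePoint (e : Q.Edge) : Continuous (edgePoint e) :=
  continuous_quot_mk.comp (continuous_inr.comp (continuous_inl.comp continuous_sigmaMk))

theorem continuous_facePoint (f : Q.Face) : Continuous (facePoint f) :=
  continuous_quot_mk.comp (continuous_inr.comp (continuous_inr.comp continuous_sigmaMk))

/-- The point of the edge of `d` at distance `t` from the tail of `d`. -/
def dartPoint (d : Q.Dart) (t : I) : Q.Realization :=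
  edgePoint d.1 (if d.2 then t else σ t)

/-- The point with angle `x`, where a full circle has the angle `ℓ`. -/
noncomputable def circlePoint (ℓ : ℕ) (x : ℝ) : ℂ :=
  Complex.exp (2 * Real.pi * Complex.I * x / ℓ)

theorem norm_circlePoint (ℓ : ℕ) (x : ℝ) : ‖circlePoint ℓ x‖ = 1 := by
  have : (2 * Real.pi * Complex.I * x / ℓ : ℂ) = ((2 * Real.pi * x / ℓ : ℝ) : ℂ) * Complex.I := by
    push_cast; ring
  rw [circlePoint, this, Complex.norm_exp_ofReal_mul_I]

theorem circlePoint_eq_iff {ℓ : ℕ} (hℓ : 0 < ℓ) {x y : ℝ} :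
    circlePoint ℓ x = circlePoint ℓ y ↔ ∃ n : ℤ, x = y + n * ℓ := by
  have hℓ' : (ℓ : ℂ) ≠ 0 := by exact_mod_cast hℓ.ne'
  have hc : (2 * Real.pi * Complex.I : ℂ) ≠ 0 := Complex.two_pi_I_ne_zero
  rw [circlePoint, circlePoint, Complex.exp_eq_exp_iff_exists_int]
  refine exists_congr fun n => ?_
  constructor
  · intro h
    have h2 : (x : ℂ) = y + n * ℓ := by
      field_simp at h
      apply mul_left_cancel₀ hc
      linear_combination (2 * Real.pi * Complex.I) * h
    exact_mod_cast h2
  · rintro rfl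
    push_cast
    field_simp

theorem continuous_circlePoint (ℓ : ℕ) : Continuous (circlePoint ℓ) := by
  unfold circlePoint
  fun_prop

theorem facePoint_arc (f : Q.Face) (k : ℕ) (hk : k < (Q.bdry f).length) (t : I)
    (z : Metric.closedBall (0 : ℂ) 1)
    (hz : (z : ℂ) = circlePoint (Q.bdry f).length (k + t)) :
    facePoint f z = dartPoint (Q.bdry f)[k] t := by
  refine Quot.sound (Glue.arc f ⟨k, hk⟩ t z ?_)
  rw [hz, circlePoint]
  push_cast
  rfl

theorem dartPoint_zero (d : Q.Dart) : dartPoint d 0 = vertexPoint d.tail := by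
  rcases d with ⟨e, _ | _⟩
  · simp only [dartPoint, Dart.tail, Bool.false_eq_true, if_false, symm_zero]
    exact Quot.sound (Glue.tgt e)
  · exact Quot.sound (Glue.src e)

/-- The darts near which a point of an edge lies. -/
def edgeSupp (e : Q.Edge) (t : I) : Set Q.Dart :=
  {d | d.1 = e ∧ (0 : ℝ) < t ∧ (t : ℝ) < 1 ∧ if d.2 then (t : ℝ) ≤ 1 / 2 else 1 / 2 ≤ (t : ℝ)}

/-- The darts at the corner near which a point of a face lies. -/
def faceSupp (f : Q.Face) (z : ℂ) : Set Q.Dart :=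
  {d | (‖z‖ = 1 ∧ ∃ (k : Fin (Q.bdry f).length) (t : I),
      z = circlePoint (Q.bdry f).length ((k : ℕ) + t) ∧
      d ∈ edgeSupp ((Q.bdry f).get k).1 (if ((Q.bdry f).get k).2 then t else σ t)) ∨
    (‖z‖ < 1 ∧ ∃ (k : ℕ) (x ρ : ℝ), 0 < ρ ∧ |x - k| ≤ 1 / 3 ∧
      z = ρ * circlePoint (Q.bdry f).length x ∧
      ((Q.bdry f)[k % (Q.bdry f).length]? = some d ∨
        (Q.bdry f)[(k + (Q.bdry f).length - 1) % (Q.bdry f).length]? = some d.rev))}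

def cellSupp : Q.Cells → Set Q.Dart
  | .inl _ => ∅
  | .inr (.inl x) => edgeSupp x.1 x.2
  | .inr (.inr x) => faceSupp x.1 x.2

theorem edgeSupp_eq_empty {e : Q.Edge} {t : I} (ht : t = 0 ∨ t = 1) : edgeSupp e t = ∅ := by
  refine Set.eq_empty_of_forall_notMem fun d hd => ?_
  obtain ⟨-, h1, h2, -⟩ := hd
  rcases ht with rfl | rfl <;> simp at h1 h2

theorem pos_of_mem_edgeSupp {e : Q.Edge} {b : Bool} {t : I} {d : Q.Dart}
    (hd : d ∈ edgeSupp e (if b then t else σ t)) : (0 : ℝ) < t ∧ (t : ℝ) < 1 := by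
  obtain ⟨-, h1, h2, -⟩ := hd
  cases b
  · simp only [Bool.false_eq_true, if_false, coe_symm_eq] at h1 h2
    constructor <;> linarith
  · exact ⟨h1, h2⟩

/-- The support of a boundary point of a face is by definition that of the corresponding point of an
edge, so the only issue is that a point of the circle may have several arc parameters. They can
differ only at the ends of arcs, where supports are empty. -/
theorem cellSupp_eq_of_glue {x y : Q.Cells} (h : Q.Glue x y) : cellSupp x = cellSupp y := by
  cases h with
  | src e => exact edgeSupp_eq_empty (.inl rfl)
  | tgt e => exact edgeSupp_eq_empty (.inr rfl)
  | arc f k t z hz =>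
    have hℓ : 0 < (Q.bdry f).length := k.pos
    have hz' : (z : ℂ) = circlePoint (Q.bdry f).length ((k : ℕ) + t) := by
      rw [hz, circlePoint]; push_cast; rfl
    have hn : ‖(z : ℂ)‖ = 1 := by rw [hz', norm_circlePoint]
    refine Set.ext fun d => ⟨?_, fun hd => .inl ⟨hn, k, t, hz', hd⟩⟩
    rintro (⟨-, k', t', h1, h2⟩ | ⟨h1, -⟩)
    · rw [hz', circlePoint_eq_iff hℓ] at h1
      obtain ⟨n, hn⟩ := h1
      obtain ⟨h3, h4⟩ := pos_of_mem_edgeSupp h2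
      have h5 := t.2.1
      have h6 := t.2.2
      -- The parameter `t'` lies strictly between 0 and 1, so this integer has absolute value less
      -- than 1.
      have h7 : ((k : ℕ) : ℤ) - (k' : ℕ) - n * (Q.bdry f).length = 0 := by
        have h8 : (((k : ℕ) : ℤ) - (k' : ℕ) - n * (Q.bdry f).length : ℝ) = t' - t := by
          push_cast; linarith
        have h9 : (((k : ℕ) : ℤ) - (k' : ℕ) - n * (Q.bdry f).length : ℝ) < 1 := by linarith
        have h10 : (-1 : ℝ) < (((k : ℕ) : ℤ) - (k' : ℕ) - n * (Q.bdry f).length : ℝ) := by linarith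
        have h9' : ((k : ℕ) : ℤ) - (k' : ℕ) - n * (Q.bdry f).length < 1 := by exact_mod_cast h9
        have h10' : -1 < ((k : ℕ) : ℤ) - (k' : ℕ) - n * (Q.bdry f).length := by exact_mod_cast h10
        omega
      have hk := k.2
      have hk' := k'.2
      have hn0 : n = 0 := by
        by_contra hn0
        rcases lt_or_gt_of_ne hn0 with h | h
        · nlinarith
        · nlinarith
      subst hn0
      have hkk : k = k' := Fin.ext (by omega)
      subst hkk
      have htt : t = t' := Subtype.ext (by push_cast at hn; linarith)
      subst htt
      exact h2
    · exact absurd h1 (by simp [hn])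
  | empty f hf z hz =>
    refine Set.eq_empty_of_forall_notMem fun d hd => ?_
    rcases hd with ⟨-, k, -⟩ | ⟨h1, -⟩
    · exact absurd k.2 (by simp [hf])
    · exact absurd h1 (by simp [hz])

/-- The support of a point of the realisation: a set of darts near which the point lies. It is
empty for the vertices. -/
def supp : Q.Realization → Set Q.Dart := Quot.lift cellSupp fun _ _ => cellSupp_eq_of_glue

theorem supp_vertexPoint (v : Q.Vertex) : supp (vertexPoint v) = ∅ := rfl

/-- The angular windows of radius 1/3 about different corners are disjoint, so the corner is
determined by the point up to full turns. -/
theorem supp_facePoint_eq {f : Q.Face} (hf : 0 < (Q.bdry f).length)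
    {z : Metric.closedBall (0 : ℂ) 1} (hz : ‖(z : ℂ)‖ < 1)
    {k : ℕ} {x ρ : ℝ} (hρ : 0 < ρ) (hx : |x - k| ≤ 1 / 3)
    (hzx : (z : ℂ) = ρ * circlePoint (Q.bdry f).length x) :
    supp (facePoint f z) = {(Q.bdry f)[k % (Q.bdry f).length]'(Nat.mod_lt _ hf),
      Dart.rev ((Q.bdry f)[(k + (Q.bdry f).length - 1) % (Q.bdry f).length]'(Nat.mod_lt _ hf))} := by
  have key : ∀ d : Q.Dart, ((Q.bdry f)[k % (Q.bdry f).length]? = some d ∨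
        (Q.bdry f)[(k + (Q.bdry f).length - 1) % (Q.bdry f).length]? = some d.rev) ↔
      d ∈ ({(Q.bdry f)[k % (Q.bdry f).length]'(Nat.mod_lt _ hf),
        Dart.rev ((Q.bdry f)[(k + (Q.bdry f).length - 1) % (Q.bdry f).length]'
          (Nat.mod_lt _ hf))} : Set Q.Dart) := by
    intro d
    rw [List.getElem?_eq_getElem (Nat.mod_lt _ hf), List.getElem?_eq_getElem (Nat.mod_lt _ hf)]
    simp only [Option.some.injEq, Set.mem_insert_iff, Set.mem_singleton_iff]
    refine or_congr eq_comm ⟨fun h => ?_, fun h => ?_⟩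
    · rw [h, Dart.rev_rev]
    · rw [h, Dart.rev_rev]
  refine Set.ext fun d => ?_
  rw [← key]
  constructor
  · rintro (⟨h1, -⟩ | ⟨-, k', x', ρ', hρ', hx', hzx', hd⟩)
    · exact absurd h1 hz.ne
    · have hρρ : ρ' = ρ := by
        have := congrArg norm (hzx.symm.trans hzx')
        simpa [norm_circlePoint, abs_of_pos hρ, abs_of_pos hρ'] using this.symm
      subst hρρ
      rw [hzx'] at hzx
      have h1 := mul_left_cancel₀ (by exact_mod_cast hρ.ne') hzx
      obtain ⟨n, hn⟩ := (circlePoint_eq_iff hf).1 h1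
      rw [abs_le] at hx hx'
      have h7 : (k' : ℤ) = k + n * (Q.bdry f).length := by
        have h9 : ((k' : ℤ) - k - n * (Q.bdry f).length : ℝ) < 1 := by push_cast; linarith
        have h10 : (-1 : ℝ) < ((k' : ℤ) - k - n * (Q.bdry f).length : ℝ) := by
          push_cast; linarith
        have h9' : (k' : ℤ) - k - n * (Q.bdry f).length < 1 := by exact_mod_cast h9
        have h10' : -1 < (k' : ℤ) - k - n * (Q.bdry f).length := by exact_mod_cast h10
        omega
      have h8 : k' % (Q.bdry f).length = k % (Q.bdry f).length := by
        zify
        rw [h7, Int.add_mul_emod_self_right]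
      have h9 : (k' + (Q.bdry f).length - 1) % (Q.bdry f).length
          = (k + (Q.bdry f).length - 1) % (Q.bdry f).length := by
        rw [Nat.add_sub_assoc hf, Nat.add_sub_assoc hf, Nat.add_mod, h8, ← Nat.add_mod]
      rwa [h8, h9] at hd
  · intro hd
    exact .inr ⟨hz, k, x, ρ, hρ, hx, hzx, hd⟩

/-! #### Rays and sectors -/

/-- A third of an edge stays clear of the midpoint, so the rays of the two darts of an edge, even of
a loop, have different supports. -/
noncomputable def third (r : I) : I := ⟨r / 3, by have := r.2.1; positivity, by have := r.2.2; linarith⟩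

theorem continuous_third : Continuous third :=
  Continuous.subtype_mk (by fun_prop) _

/-- The ray which runs along the first third of a dart. -/
noncomputable def ray (d : Q.Dart) : C(I, Q.Realization) where
  toFun r := dartPoint d (third r)
  continuous_toFun := by
    refine (continuous_edgePoint d.1).comp ?_
    split_ifs
    · exact continuous_third
    · exact continuous_symm.comp continuous_third

theorem ray_apply (d : Q.Dart) (r : I) : ray d r = dartPoint d (third r) := rfl

theorem third_zero : third 0 = 0 := Subtype.ext (by simp [third])

theorem supp_ray {d : Q.Dart} {r : I} (hr : 0 < r) : supp (ray d r) = {d} := by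
  have h0 : (0 : ℝ) < r := hr
  have h1 := r.2.2
  refine Set.ext fun d' => ?_
  change d' ∈ edgeSupp _ _ ↔ _
  rcases d with ⟨e, _ | _⟩ <;> rcases d' with ⟨e', _ | _⟩ <;>
    simp only [edgeSupp, third, coe_symm_eq, Set.mem_ofPred_eq, Set.mem_singleton_iff,
      Prod.mk.injEq, if_true, Bool.false_eq_true, if_false, and_true, and_false, reduceCtorEq,
      iff_false, not_and, not_le]
  · exact ⟨fun h => h.1, fun h => ⟨h, by linarith, by linarith, by linarith⟩⟩
  · intros; linarith
  · intros; linarith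
  · exact ⟨fun h => h.1, fun h => ⟨h, by linarith, by linarith, by linarith⟩⟩

/-- The rays which start at the vertex of the 2-complex, run near the darts of `V` and leave the
vertex. -/
def rays (V : Set Q.Dart) : Set C(I, Q.Realization) :=
  {m | (∀ v, m 0 = vertexPoint v) ∧ (∀ r, supp (m r) ⊆ V) ∧ (supp (m 1)).Nonempty}

theorem ray_zero [Subsingleton Q.Vertex] (d : Q.Dart) (v : Q.Vertex) : ray d 0 = vertexPoint v := by
  rw [ray_apply, third_zero, dartPoint_zero, Subsingleton.elim d.tail v]

theorem ray_mem_rays [Subsingleton Q.Vertex] {V : Set Q.Dart} {d : Q.Dart} (hd : d ∈ V) :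
    ray d ∈ rays V := by
  refine ⟨ray_zero d, fun r => ?_, ?_⟩
  · rcases eq_or_lt_of_le (show (0 : I) ≤ r from r.2.1) with rfl | hr
    · rw [ray_zero d d.tail, supp_vertexPoint]
      exact Set.empty_subset _
    · rw [supp_ray hr]
      simpa using hd
  · rw [supp_ray one_pos]
    simp

/-- A point of the sector at the `k`th corner of a polygon with `ℓ` sides. -/
noncomputable def sectorPoint (ℓ k : ℕ) (p : I × I) : ℂ :=
  (1 - p.2 * (p.1 * (1 - p.1)) : ℝ) * circlePoint ℓ (k + (2 * p.1 - 1) * (p.2 / 3))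

theorem sector_radius (p : I × I) : 0 < (1 - p.2 * (p.1 * (1 - p.1)) : ℝ) ∧
    (1 - p.2 * (p.1 * (1 - p.1)) : ℝ) ≤ 1 := by
  obtain ⟨⟨s, hs0, hs1⟩, ⟨r, hr0, hr1⟩⟩ := p
  have h1 : 0 ≤ s * (1 - s) := mul_nonneg hs0 (by linarith)
  have h2 : s * (1 - s) ≤ 1 / 4 := by nlinarith [sq_nonneg (s - 1 / 2)]
  constructor
  · change 0 < 1 - r * (s * (1 - s))
    nlinarith
  · change 1 - r * (s * (1 - s)) ≤ 1
    nlinarith [mul_nonneg hr0 h1]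

theorem norm_sectorPoint (ℓ k : ℕ) (p : I × I) :
    ‖sectorPoint ℓ k p‖ = (1 - p.2 * (p.1 * (1 - p.1)) : ℝ) := by
  rw [sectorPoint, norm_mul, norm_circlePoint, mul_one, Complex.norm_real,
    Real.norm_of_nonneg (sector_radius p).1.le]

/-- The first coordinate sweeps across the corner and the second measures the distance from it. Both
extreme rays lie on the boundary circle; those in between bulge into the open disc. -/
noncomputable def sector (f : Q.Face) (k : ℕ) : C(I × I, Q.Realization) where
  toFun p := facePoint f ⟨sectorPoint (Q.bdry f).length k p, by
    rw [mem_closedBall_zero_iff, norm_sectorPoint]; exact (sector_radius p).2⟩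
  continuous_toFun := by
    refine (continuous_facePoint f).comp (Continuous.subtype_mk ?_ _)
    unfold sectorPoint
    have := continuous_circlePoint (Q.bdry f).length
    fun_prop

theorem sector_one (f : Q.Face) (k : ℕ) (hf : 0 < (Q.bdry f).length) (r : I) :
    sector f k (1, r) = ray ((Q.bdry f)[k % (Q.bdry f).length]'(Nat.mod_lt _ hf)) r := by
  refine facePoint_arc f _ (Nat.mod_lt _ hf) (third r) _ ?_
  simp only [sectorPoint, third, Set.Icc.coe_one, sub_self, mul_zero, sub_zero, Complex.ofReal_one,
    one_mul]
  rw [circlePoint_eq_iff hf]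
  refine ⟨k / (Q.bdry f).length, ?_⟩
  have : (k : ℝ) = (k % (Q.bdry f).length : ℕ) + (k / (Q.bdry f).length : ℕ) * (Q.bdry f).length := by
    exact_mod_cast (Nat.mod_add_div' k _).symm
  rw [show ((k / (Q.bdry f).length : ℤ) : ℝ) = ((k / (Q.bdry f).length : ℕ) : ℝ) by norm_cast]
  nth_rw 1 [this]
  ring

theorem sector_zero (f : Q.Face) (k : ℕ) (hf : 0 < (Q.bdry f).length) (r : I) :
    sector f k (0, r) = ray (Dart.rev ((Q.bdry f)[(k + (Q.bdry f).length - 1) % (Q.bdry f).length]'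
      (Nat.mod_lt _ hf))) r := by
  have h1 := facePoint_arc f _ (Nat.mod_lt (k + (Q.bdry f).length - 1) hf) (σ (third r))
    ⟨sectorPoint (Q.bdry f).length k (0, r), by
      rw [mem_closedBall_zero_iff, norm_sectorPoint]; exact (sector_radius _).2⟩ ?_
  · refine h1.trans ?_
    generalize ((Q.bdry f)[(k + (Q.bdry f).length - 1) % (Q.bdry f).length]'
      (Nat.mod_lt _ hf)) = d
    rcases d with ⟨e, _ | _⟩ <;> simp [ray_apply, dartPoint, Dart.rev]
  · simp only [sectorPoint, third, Set.Icc.coe_zero, coe_symm_eq, zero_mul, mul_zero, sub_zero,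
      Complex.ofReal_one, one_mul, zero_sub, neg_mul]
    rw [circlePoint_eq_iff hf]
    set m := k + (Q.bdry f).length - 1 with hm
    have hm' : (m : ℝ) = k + (Q.bdry f).length - 1 := by
      have : m + 1 = k + (Q.bdry f).length := by omega
      have : (m : ℝ) + 1 = k + (Q.bdry f).length := by exact_mod_cast this
      linarith
    have h2 : (m : ℝ) = (m % (Q.bdry f).length : ℕ) +
        (m / (Q.bdry f).length : ℕ) * (Q.bdry f).length := by
      exact_mod_cast (Nat.mod_add_div' m _).symm
    generalize m / (Q.bdry f).length = q at h2
    refine ⟨q - 1, ?_⟩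
    push_cast
    linarith

theorem sector_bot [Subsingleton Q.Vertex] (f : Q.Face) (k : ℕ) (hf : 0 < (Q.bdry f).length)
    (s : I) (v : Q.Vertex) : sector f k (s, 0) = vertexPoint v := by
  have h : sector f k (s, 0) = sector f k (1, 0) := by
    change facePoint f _ = facePoint f _
    congr 2
    simp [sectorPoint]
  rw [h, sector_one f k hf, ray_zero _ v]

theorem supp_sector {f : Q.Face} {k : ℕ} (hf : 0 < (Q.bdry f).length) {s r : I} (hr : 0 < r)
    (hs : 0 < s) (hs1 : s < 1) :
    supp (sector f k (s, r)) = {(Q.bdry f)[k % (Q.bdry f).length]'(Nat.mod_lt _ hf),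
      Dart.rev ((Q.bdry f)[(k + (Q.bdry f).length - 1) % (Q.bdry f).length]'(Nat.mod_lt _ hf))} := by
  have h0 : (0 : ℝ) < s := hs
  have h1 : (s : ℝ) < 1 := hs1
  have h2 : (0 : ℝ) < r := hr
  have h3 : (r : ℝ) ≤ 1 := r.2.2
  refine supp_facePoint_eq hf ?_ (sector_radius (s, r)).1 ?_ rfl
  · rw [norm_sectorPoint]
    have : 0 < (r : ℝ) * (s * (1 - s)) := mul_pos h2 (mul_pos h0 (by linarith))
    simp only
    linarith
  · rw [abs_le]
    constructor
    · simp only; nlinarith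
    · simp only; nlinarith

/-- The sector of the face at the corner that witnesses the adjacency, curried, is the required path
of rays. -/
theorem joinedIn_rays_of_linkAdj [Subsingleton Q.Vertex] {V : Set Q.Dart} {h h' : Q.Dart}
    (hh : h ∈ V) (hh' : h' ∈ V) (hadj : Q.LinkAdj h h') :
    JoinedIn (rays V) (ray h) (ray h') := by
  obtain ⟨f, l, hl, h1, h2⟩ := hadj
  obtain ⟨n, rfl⟩ := hl.symm
  have hf : 0 < (Q.bdry f).length := by
    by_contra h0
    have : Q.bdry f = [] := List.length_eq_zero_iff.1 (by omega)
    simp [this] at h1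
  have e1 : (Q.bdry f)[n % (Q.bdry f).length]'(Nat.mod_lt _ hf) = h' := by
    rw [List.head?_eq_getElem?, List.getElem?_eq_getElem (by simpa using hf)] at h1
    simpa [List.getElem_rotate] using h1
  have e2 : Dart.rev ((Q.bdry f)[(n + (Q.bdry f).length - 1) % (Q.bdry f).length]'
      (Nat.mod_lt _ hf)) = h := by
    rw [List.getLast?_eq_getElem?, List.getElem?_eq_getElem (by simpa using hf)] at h2
    simp only [List.getElem_rotate, List.length_rotate, Option.some.injEq] at h2
    have : (Q.bdry f).length - 1 + n = n + (Q.bdry f).length - 1 := by omega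
    simp only [this] at h2
    rw [h2, Dart.rev_rev]
  let γ : Path (ray h) (ray h') :=
    { toFun := (sector f n).curry
      continuous_toFun := (sector f n).curry.continuous
      source' := ContinuousMap.ext fun r => by
        rw [ContinuousMap.curry_apply, sector_zero f n hf, e2]
      target' := ContinuousMap.ext fun r => by
        rw [ContinuousMap.curry_apply, sector_one f n hf, e1] }
  refine ⟨γ, fun s => ?_⟩
  rcases eq_or_lt_of_le (show (0 : I) ≤ s from s.2.1) with rfl | hs
  · rw [γ.source]; exact ray_mem_rays hh
  rcases eq_or_lt_of_le (show s ≤ (1 : I) from s.2.2) with rfl | hs1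
  · rw [γ.target]; exact ray_mem_rays hh'
  have hγ : ∀ r, γ s r = sector f n (s, r) := fun r => rfl
  refine ⟨fun v => ?_, fun r => ?_, ?_⟩
  · rw [hγ, sector_bot f n hf s v]
  · rw [hγ]
    rcases eq_or_lt_of_le (show (0 : I) ≤ r from r.2.1) with rfl | hr
    · rw [sector_bot f n hf s h.tail, supp_vertexPoint]
      exact Set.empty_subset _
    · rw [supp_sector hf hr hs hs1, e1, e2]
      rintro d (rfl | rfl)
      · exact hh'
      · exact hh
  · rw [hγ, supp_sector hf one_pos hs hs1]
    exact Set.insert_nonempty _ _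

theorem LinkConnected.joinedIn_rays [Subsingleton Q.Vertex] {V : Set Q.Dart} {h h' : Q.Dart}
    (hc : Q.LinkConnected V h h') : JoinedIn (rays V) (ray h) (ray h') := by
  obtain ⟨h1, h2⟩ := hc
  induction h2 with
  | refl => exact JoinedIn.refl (ray_mem_rays h1)
  | tail _ hstep ih =>
    obtain ⟨h3, h4, h5 | h5⟩ := hstep
    · exact ih.trans (joinedIn_rays_of_linkAdj h3 h4 h5)
    · exact ih.trans (joinedIn_rays_of_linkAdj h4 h3 h5).symm

end TwoComplex


namespace TwoComplex

open unitInterval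

/-! #### The test map on the deleted product of a cone over `K₃,₃` -/

/-- By how much the coordinate `p i` exceeds the other coordinates. -/
noncomputable def excess (p : Fin 3 → ℝ) (i : Fin 3) : ℝ :=
  max 0 (min (p i - p (i + 1)) (p i - p (i + 2)))

theorem continuous_excess (i : Fin 3) : Continuous fun p => excess p i := by
  unfold excess
  fun_prop

theorem exists_excess (p : Fin 3 → ℝ) : ∃ i k, i ≠ k ∧ (∀ m, m ≠ i → excess p m = 0) ∧
    (∀ m, m ≠ k → excess (-p) m = 0) ∧ ∀ a b, p a - p b ≤ excess p i + excess (-p) k := by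
  -- The coordinates are sorted: only the largest has an excess for `p` and only the smallest for
  -- `-p`. The two excesses are at least the two gaps, so their sum bounds every difference.
  have key : ∀ i j k : Fin 3, i ≠ j → i ≠ k → j ≠ k → p j ≤ p i → p k ≤ p j →
      ∃ i k, i ≠ k ∧ (∀ m, m ≠ i → excess p m = 0) ∧
      (∀ m, m ≠ k → excess (-p) m = 0) ∧ ∀ a b, p a - p b ≤ excess p i + excess (-p) k := by
    intro i j k hij hik hjk h1 h2
    have hcov : ∀ m, m = i ∨ m = j ∨ m = k := by
      clear h1 h2
      revert i j k
      decide
    have hnext : ∀ m n : Fin 3, m ≠ n → n = m + 1 ∨ n = m + 2 := by decide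
    have hnext' : ∀ m : Fin 3, m + 1 ≠ m ∧ m + 2 ≠ m := by decide
    have hle : ∀ (q : Fin 3 → ℝ) (m n : Fin 3), m ≠ n → q m ≤ q n → excess q m = 0 := by
      intro q m n hmn hq
      refine max_eq_left ?_
      rcases hnext m n hmn with rfl | rfl
      · exact (min_le_left _ _).trans (by linarith)
      · exact (min_le_right _ _).trans (by linarith)
    have hge : ∀ (q : Fin 3 → ℝ) (m : Fin 3) (c : ℝ), (∀ n, n ≠ m → c ≤ q m - q n) →
        c ≤ excess q m := fun q m c h =>
      le_max_of_le_right (le_min (h _ (hnext' m).1) (h _ (hnext' m).2))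
    refine ⟨i, k, hik, fun m hm => ?_, fun m hm => ?_, fun a b => ?_⟩
    · exact hle p m i hm (by rcases hcov m with rfl | rfl | rfl <;> linarith)
    · refine hle (-p) m k hm ?_
      simp only [Pi.neg_apply]
      rcases hcov m with rfl | rfl | rfl <;> linarith
    · have h3 : p i - p j ≤ excess p i := hge p i _ fun n hn => by
        rcases hcov n with rfl | rfl | rfl
        · exact absurd rfl hn
        · exact le_rfl
        · linarith
      have h4 : p j - p k ≤ excess (-p) k := hge (-p) k _ fun n hn => by
        simp only [Pi.neg_apply]
        rcases hcov n with rfl | rfl | rfl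
        · linarith
        · linarith
        · exact absurd rfl hn
      rcases hcov a with rfl | rfl | rfl <;> rcases hcov b with rfl | rfl | rfl <;> linarith
  rcases le_total (p 0) (p 1) with h1 | h1 <;> rcases le_total (p 1) (p 2) with h2 | h2 <;>
    rcases le_total (p 0) (p 2) with h3 | h3
  · exact key 2 1 0 (by decide) (by decide) (by decide) h2 h1
  · exact key 2 1 0 (by decide) (by decide) (by decide) h2 h1
  · exact key 1 2 0 (by decide) (by decide) (by decide) h2 h3
  · exact key 1 0 2 (by decide) (by decide) (by decide) h1 h3
  · exact key 2 0 1 (by decide) (by decide) (by decide) h3 h1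
  · exact key 0 2 1 (by decide) (by decide) (by decide) h3 h2
  · exact key 0 1 2 (by decide) (by decide) (by decide) h1 h2
  · exact key 0 1 2 (by decide) (by decide) (by decide) h1 h2

/-- A continuous map on the square which is constant on the side `r = 0` induces a continuous map
on the triangle obtained by collapsing this side. -/
theorem continuous_collapse {X W : Type*} [TopologicalSpace X] [NormedAddCommGroup W]
    {G : I × I → W} (hG : Continuous G) (h0 : ∀ s, G (s, 0) = 0) {α β : X → ℝ}
    (hα : Continuous α) (hβ : Continuous β) :
    Continuous fun x => G (Set.projIcc 0 1 zero_le_one (β x / (α x + β x)),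
      Set.projIcc 0 1 zero_le_one (α x + β x)) := by
  rw [continuous_iff_continuousAt]
  intro x
  have hP : Continuous (Set.projIcc (0 : ℝ) 1 zero_le_one) := continuous_projIcc
  have hr : Continuous fun x => Set.projIcc (0 : ℝ) 1 zero_le_one (α x + β x) :=
    hP.comp (hα.add hβ)
  by_cases hx : α x + β x = 0
  · have h1 : Set.projIcc (0 : ℝ) 1 zero_le_one (α x + β x) = 0 := by
      rw [hx]; exact Set.projIcc_left _
    rw [ContinuousAt, h1, h0, Metric.tendsto_nhds]
    intro ε hε
    -- The quotient β/(α + β) has no limit here; compactness makes `G` uniformly small near the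
    -- collapsed side for all values of it.
    have h2 : ∀ᶠ r in nhds (0 : I), ∀ s ∈ (Set.univ : Set I), dist (G (s, r)) 0 < ε := by
      refine isCompact_univ.eventually_forall_of_forall_eventually fun s _ => ?_
      have h3 : ContinuousAt (fun z : I × I => G (z.2, z.1)) (0, s) :=
        (hG.comp continuous_swap).continuousAt
      have h4 : dist (G (s, 0)) 0 < ε := by rwa [h0, dist_self]
      have h5 := h3.eventually (Metric.ball_mem_nhds _ (sub_pos.2 h4))
      filter_upwards [h5] with z hz
      have h6 : dist (G (z.2, z.1)) (G (s, 0)) < ε - dist (G (s, 0)) 0 := hz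
      have := dist_triangle (G (z.2, z.1)) (G (s, 0)) 0
      linarith
    have h3 : Filter.Tendsto (fun x => Set.projIcc (0 : ℝ) 1 zero_le_one (α x + β x)) (nhds x)
        (nhds 0) := by
      have := hr.tendsto x
      rwa [h1] at this
    filter_upwards [h3.eventually h2] with y hy
    exact hy _ (Set.mem_univ _)
  · refine hG.continuousAt.comp (f := fun x => (Set.projIcc (0 : ℝ) 1 zero_le_one (β x / (α x + β x)),
      Set.projIcc (0 : ℝ) 1 zero_le_one (α x + β x))) (ContinuousAt.prodMk ?_ hr.continuousAt)
    exact hP.continuousAt.comp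
      (hβ.continuousAt.div (hα.add hβ).continuousAt hx)

/-- Let the darts `a i` and `b j` be joined by paths in the link graph, such that disjoint edges
of the complete bipartite graph `K₃,₃` correspond to disjoint paths. Then the 2-complex does not
embed in 3-space. -/
theorem not_embedsIn3Space_of_linkConnected {Q : TwoComplex} [Subsingleton Q.Vertex]
    (V : Fin 3 → Fin 3 → Set Q.Dart) (a b : Fin 3 → Q.Dart)
    (hdisj : ∀ i j k l, i ≠ k → j ≠ l → Disjoint (V i j) (V k l))
    (hconn : ∀ i j, Q.LinkConnected (V i j) (a i) (b j)) : ¬ Q.EmbedsIn3Space := by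
  rintro ⟨φ, hφ⟩
  choose γ hγ using fun i j => (hconn i j).joinedIn_rays
  let c : Q.Vertex := (a 0).tail
  let G : Fin 3 → Fin 3 → I × I → EuclideanSpace ℝ (Fin 3) := fun i j z =>
    φ (γ i j z.1 z.2) - φ (vertexPoint c)
  have hGc : ∀ i j, Continuous (G i j) := by
    intro i j
    have h1 : Continuous fun z : I × I => γ i j z.1 z.2 :=
      ((γ i j).continuous.comp continuous_fst).eval continuous_snd
    exact (hφ.continuous.comp h1).sub continuous_const
  have hG0 : ∀ i j s, G i j (s, 0) = 0 := by
    intro i j s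
    simp only [G, (hγ i j s).1 c, sub_self]
  let P : ℝ → I := Set.projIcc 0 1 zero_le_one
  have hP0 : P 0 = 0 := Set.projIcc_left _
  have hP1 : ∀ x, 1 ≤ x → P x = 1 := fun x hx => Set.projIcc_of_right_le _ hx
  -- The map on the cone over the edge ij in coordinates: α + β is the distance from the apex, cut
  -- off at 1, and β/(α + β) the position on the edge. `A` and `B` are its restrictions to the two
  -- sides.
  let N : Fin 3 → Fin 3 → ℝ → ℝ → EuclideanSpace ℝ (Fin 3) := fun i j α β =>
    G i j (P (β / (α + β)), P (α + β))
  let A : Fin 3 → ℝ → EuclideanSpace ℝ (Fin 3) := fun i α => φ (ray (a i) (P α)) - φ (vertexPoint c)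
  let B : Fin 3 → ℝ → EuclideanSpace ℝ (Fin 3) := fun j β => φ (ray (b j) (P β)) - φ (vertexPoint c)
  have hPc : Continuous P := continuous_projIcc
  have hNA : ∀ i j α, N i j α 0 = A i α := by
    intro i j α
    simp only [N, G, A, zero_div, add_zero, hP0, Path.source]
  have hNB : ∀ i j β, N i j 0 β = B j β := by
    intro i j β
    by_cases hβ : β = 0
    · subst hβ
      simp only [N, B, add_zero, hP0, hG0, ray_zero _ c, sub_self]
    · simp only [N, G, B, zero_add, div_self hβ, hP1 1 le_rfl, Path.target]
  have hA0 : ∀ i, A i 0 = 0 := fun i => by simp only [A, hP0, ray_zero _ c, sub_self]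
  have hB0 : ∀ j, B j 0 = 0 := fun j => by simp only [B, hP0, ray_zero _ c, sub_self]
  -- Inclusion–exclusion extends the maps on the nine cones to one formula that is continuous in all
  -- coordinates. When `x` and `y` are each supported on one index, all corrections cancel.
  let g : (Fin 3 → ℝ) → (Fin 3 → ℝ) → EuclideanSpace ℝ (Fin 3) := fun x y =>
    ∑ i, ∑ j, (N i j (x i) (y j) - A i (x i) - B j (y j)) + (∑ i, A i (x i) + ∑ j, B j (y j))
  have hg : ∀ x y i j, (∀ m, m ≠ i → x m = 0) → (∀ m, m ≠ j → y m = 0) →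
      g x y = N i j (x i) (y j) := by
    intro x y i j hx hy
    have h1 : ∑ i, A i (x i) = A i (x i) :=
      Finset.sum_eq_single i (fun m _ hm => by rw [hx m hm, hA0]) (by simp)
    have h2 : ∑ j, B j (y j) = B j (y j) :=
      Finset.sum_eq_single j (fun m _ hm => by rw [hy m hm, hB0]) (by simp)
    have h3 : ∑ i, ∑ j, (N i j (x i) (y j) - A i (x i) - B j (y j))
        = N i j (x i) (y j) - A i (x i) - B j (y j) := by
      rw [Finset.sum_eq_single i, Finset.sum_eq_single j]
      · intro m _ hm
        rw [hy m hm, hNA, hB0, sub_self, sub_self]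
      · simp
      · intro m _ hm
        refine Finset.sum_eq_zero fun l _ => ?_
        rw [hx m hm, hNB, hA0, sub_zero, sub_self]
      · simp
    simp only [g, h1, h2, h3]
    abel
  -- The excesses of `p` and `-p` parametrise pairs of points of a tripod on different legs by a
  -- plane, which is the cone over the hexagon. Two such planes make up four-dimensional space.
  let p : (Fin 4 → ℝ) → Fin 3 → ℝ := fun v => ![v 0, v 1, 0]
  let q : (Fin 4 → ℝ) → Fin 3 → ℝ := fun v => ![v 2, v 3, 0]
  have hp : ∀ v, p (-v) = -p v := fun v => by
    ext i; fin_cases i <;> simp [p]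
  have hq : ∀ v, q (-v) = -q v := fun v => by
    ext i; fin_cases i <;> simp [q]
  have hpc : Continuous p := by
    refine continuous_pi fun i => ?_
    fin_cases i
    · exact continuous_apply 0
    · exact continuous_apply 1
    · exact continuous_const
  have hqc : Continuous q := by
    refine continuous_pi fun i => ?_
    fin_cases i
    · exact continuous_apply 2
    · exact continuous_apply 3
    · exact continuous_const
  let F₀ : (Fin 4 → ℝ) → EuclideanSpace ℝ (Fin 3) := fun v => g (excess (p v)) (excess (q v))
  have hF₀ : Continuous F₀ := by
    have h1 : ∀ i, Continuous fun v => excess (p v) i := fun i => (continuous_excess i).comp hpc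
    have h2 : ∀ i, Continuous fun v => excess (q v) i := fun i => (continuous_excess i).comp hqc
    have h3 : ∀ i, Continuous fun v => A i (excess (p v) i) := fun i =>
      (hφ.continuous.comp ((ray (a i)).continuous.comp (hPc.comp (h1 i)))).sub continuous_const
    have h4 : ∀ i, Continuous fun v => B i (excess (q v) i) := fun i =>
      (hφ.continuous.comp ((ray (b i)).continuous.comp (hPc.comp (h2 i)))).sub continuous_const
    have h5 : ∀ i j, Continuous fun v => N i j (excess (p v) i) (excess (q v) j) := fun i j =>
      continuous_collapse (hGc i j) (hG0 i j) (h1 i) (h2 j)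
    refine (continuous_finsetSum _ fun i _ => continuous_finsetSum _ fun j _ =>
      ((h5 i j).sub (h3 i)).sub (h4 j)).add ((continuous_finsetSum _ fun i _ => h3 i).add
      (continuous_finsetSum _ fun j _ => h4 j))
  let F : (Fin 4 → ℝ) → Fin 3 → ℝ := fun v i => (F₀ v - F₀ (-v)) i
  have hF : Continuous F := by
    have h1 : Continuous fun v => F₀ v - F₀ (-v) := hF₀.sub (hF₀.comp continuous_neg)
    exact (PiLp.continuous_ofLp 2 _).comp h1
  -- With ℓ¹-norm 4, twice the sum of the four excesses is at least 4, so one point of the pair has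
  -- distance at least 1 from the apex.
  obtain ⟨v, hv, hFv⟩ := BorsukUlam.exists_zero_of_odd hF
    (fun v => by ext i; simp [F]) (R := 4) (by norm_num)
  have heq : F₀ v = F₀ (-v) := by
    ext i
    have := congrFun hFv i
    simpa [F, sub_eq_zero] using this
  obtain ⟨i, k, hik, hi, hk, hpd⟩ := exists_excess (p v)
  obtain ⟨j, l, hjl, hj, hl, hqd⟩ := exists_excess (q v)
  have e1 : F₀ v = N i j (excess (p v) i) (excess (q v) j) := hg _ _ _ _ hi hj
  have e2 : F₀ (-v) = N k l (excess (-p v) k) (excess (-q v) l) := by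
    simp only [F₀, hp, hq]
    exact hg _ _ _ _ hk hl
  rw [e1, e2] at heq
  simp only [N, G, sub_left_inj] at heq
  have heq := hφ.injective heq
  have h1 := (hγ i j (P (excess (q v) j / (excess (p v) i + excess (q v) j))))
  have h2 := (hγ k l (P (excess (-q v) l / (excess (-p v) k + excess (-q v) l))))
  -- The two image points coincide, so their common support lies in two disjoint sets; yet it is
  -- nonempty at the end of a ray.
  have hempty : ∀ S : Set Q.Dart, S ⊆ V i j → S ⊆ V k l → ¬ S.Nonempty := by
    rintro S hS hS' ⟨d, hd⟩
    exact Set.disjoint_left.1 (hdisj i j k l hik hjl) (hS hd) (hS' hd)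
  have hlarge : 1 ≤ excess (p v) i + excess (q v) j ∨ 1 ≤ excess (-p v) k + excess (-q v) l := by
    rw [Fin.sum_univ_four] at hv
    have a1 := hpd 0 2
    have a2 := hpd 2 0
    have a3 := hpd 1 2
    have a4 := hpd 2 1
    have b1 := hqd 0 2
    have b2 := hqd 2 0
    have b3 := hqd 1 2
    have b4 := hqd 2 1
    simp only [p, q, Matrix.cons_val] at a1 a2 a3 a4 b1 b2 b3 b4
    have c1 : |v 0| ≤ excess (p v) i + excess (-p v) k := abs_le.2 ⟨by linarith, by linarith⟩
    have c2 : |v 1| ≤ excess (p v) i + excess (-p v) k := abs_le.2 ⟨by linarith, by linarith⟩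
    have c3 : |v 2| ≤ excess (q v) j + excess (-q v) l := abs_le.2 ⟨by linarith, by linarith⟩
    have c4 : |v 3| ≤ excess (q v) j + excess (-q v) l := abs_le.2 ⟨by linarith, by linarith⟩
    by_contra! h
    linarith [h.1, h.2]
  rcases hlarge with h | h
  · have h3 := h1.2.2
    have h4 := h1.2.1 1
    rw [hP1 _ h] at heq
    rw [heq] at h3 h4
    exact hempty _ h4 (h2.2.1 _) h3
  · have h3 := h2.2.2
    have h4 := h2.2.1 1
    rw [hP1 _ h] at heq
    rw [← heq] at h3 h4
    exact hempty _ (h1.2.1 _) h4 h3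

end TwoComplex


/-! ### Link graphs of contractions -/

namespace TwoComplex

variable {C : TwoComplex}

theorem isWalk_cons {C : TwoComplex} {u v : C.Vertex} {d : C.Dart} {l : List C.Dart} :
    IsWalk C.src C.tgt u (d :: l) v ↔ d.tail = u ∧ IsWalk C.src C.tgt d.head l v := by
  rcases d with ⟨e, _ | _⟩ <;> rfl

theorem isWalk_append {C : TwoComplex} {u v : C.Vertex} {l₁ l₂ : List C.Dart} :
    IsWalk C.src C.tgt u (l₁ ++ l₂) v ↔
      ∃ m, IsWalk C.src C.tgt u l₁ m ∧ IsWalk C.src C.tgt m l₂ v := by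
  induction l₁ generalizing u with
  | nil => exact ⟨fun h => ⟨u, rfl, h⟩, fun ⟨m, hm, h⟩ => by obtain rfl := hm; exact h⟩
  | cons d l₁ ih =>
    rw [List.cons_append, isWalk_cons, ih]
    simp only [isWalk_cons, and_assoc, exists_and_left]

/-- The walk traversed backwards. -/
def revWalk (l : List C.Dart) : List C.Dart := l.reverse.map Dart.rev

theorem revWalk_revWalk (l : List C.Dart) : revWalk (revWalk l) = l := by
  simp [revWalk, List.map_reverse, Function.comp_def]

theorem IsWalk.revWalk {u v : C.Vertex} {l : List C.Dart} (h : IsWalk C.src C.tgt u l v) :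
    IsWalk C.src C.tgt v (revWalk l) u := by
  induction l generalizing u with
  | nil => exact Eq.symm h
  | cons d l ih =>
    rw [isWalk_cons] at h
    rw [TwoComplex.revWalk, List.reverse_cons, List.map_append, isWalk_append]
    refine ⟨d.head, ih h.2, ?_⟩
    rw [List.map_singleton, isWalk_cons, Dart.tail_rev, Dart.head_rev]
    exact ⟨rfl, h.1⟩

/-- The boundary walks of the faces, with any starting point and orientation. -/
def IsFaceWalk (C : TwoComplex) (l : List C.Dart) : Prop :=
  ∃ f, l ~r C.bdry f ∨ l ~r revWalk (C.bdry f)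

theorem IsFaceWalk.of_isRotated {l l' : List C.Dart} (h : C.IsFaceWalk l) (hl : l' ~r l) :
    C.IsFaceWalk l' :=
  h.imp fun _ hf => hf.imp hl.trans hl.trans

theorem IsFaceWalk.revWalk {l : List C.Dart} (h : C.IsFaceWalk l) : C.IsFaceWalk (revWalk l) := by
  obtain ⟨f, hf | hf⟩ := h
  · exact ⟨f, .inr (hf.reverse.map _)⟩
  · refine ⟨f, .inl ?_⟩
    have := hf.reverse.map Dart.rev
    rwa [← TwoComplex.revWalk, ← TwoComplex.revWalk, revWalk_revWalk] at this

theorem IsFaceWalk.exists_isWalk {l : List C.Dart} (h : C.IsFaceWalk l) :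
    ∃ u, IsWalk C.src C.tgt u l u := by
  have key : ∀ {l l' : List C.Dart} {u}, IsWalk C.src C.tgt u l u → l' ~r l →
      ∃ u, IsWalk C.src C.tgt u l' u := by
    rintro l l' u hu ⟨n, rfl⟩
    have h1 := List.rotate_eq_drop_append_take_mod (l := l') (n := n)
    rw [h1, isWalk_append] at hu
    obtain ⟨m, h2, h3⟩ := hu
    refine ⟨m, ?_⟩
    have := isWalk_append.2 ⟨u, h3, h2⟩
    rwa [List.take_append_drop] at this
  obtain ⟨f, hf | hf⟩ := h
  · exact key (C.closed f) hf
  · exact key (IsWalk.revWalk (C.closed f)) hf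

open scoped Classical in
/-- The darts of a walk which do not lie in `S`. -/
noncomputable def keep (S : Set C.Edge) (l : List C.Dart) : List C.Dart :=
  l.filter fun d => d.1 ∉ S

theorem keep_cons_of_mem {S : Set C.Edge} {d : C.Dart} (hd : d.1 ∈ S) (l : List C.Dart) :
    keep S (d :: l) = keep S l := by
  simp [keep, hd]

theorem keep_cons_of_notMem {S : Set C.Edge} {d : C.Dart} (hd : d.1 ∉ S) (l : List C.Dart) :
    keep S (d :: l) = d :: keep S l := by
  simp [keep, hd]

theorem keep_append (S : Set C.Edge) (l l' : List C.Dart) :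
    keep S (l ++ l') = keep S l ++ keep S l' := by
  simp [keep]

theorem mem_keep {S : Set C.Edge} {l : List C.Dart} {d : C.Dart} :
    d ∈ keep S l ↔ d ∈ l ∧ d.1 ∉ S := by
  simp [keep]

theorem keep_revWalk (S : Set C.Edge) (l : List C.Dart) :
    keep S (revWalk l) = revWalk (keep S l) := by
  simp only [keep, revWalk, List.filter_map, List.filter_reverse]
  rfl

theorem keep_isRotated {S : Set C.Edge} {l l' : List C.Dart} (h : l ~r l') :
    keep S l ~r keep S l' := by
  obtain ⟨n, rfl⟩ := h
  rw [List.rotate_eq_drop_append_take_mod, keep_append]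
  conv_lhs => rw [← List.take_append_drop (n % l.length) l, keep_append]
  exact List.isRotated_append

/-- The first dart of a walk which does not lie in `S`. -/
noncomputable def first (S : Set C.Edge) (l : List C.Dart) : Option C.Dart := (keep S l).head?

theorem first_revWalk (S : Set C.Edge) (l : List C.Dart) :
    first S (revWalk l) = (keep S l).getLast?.map Dart.rev := by
  rw [first, keep_revWalk, revWalk, List.head?_map, List.head?_reverse]

/-- `h` and `h'` are joined by a path in the subgraph induced by `V` of the link graph of the
complex obtained by contracting `S`. -/
def ContractLinkConnected (C : TwoComplex) (S : Set C.Edge) (V : Set C.Dart) (h h' : C.Dart) :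
    Prop :=
  (h ∈ V ∧ h.1 ∉ S) ∧ Relation.ReflTransGen (fun d d' => d ∈ V ∧ d' ∈ V ∧
    ∃ l, C.IsFaceWalk l ∧ first S l = some d' ∧ first S (revWalk l) = some d) h h'

namespace ContractLinkConnected

variable {S : Set C.Edge} {V V' : Set C.Dart} {h h' h'' : C.Dart}

theorem refl (hh : h ∈ V) (hS : h.1 ∉ S) : C.ContractLinkConnected S V h h := ⟨⟨hh, hS⟩, .refl⟩

theorem trans (h1 : C.ContractLinkConnected S V h h') (h2 : C.ContractLinkConnected S V h' h'') :
    C.ContractLinkConnected S V h h'' :=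
  ⟨h1.1, h1.2.trans h2.2⟩

theorem first_notMem {l : List C.Dart} (hl : first S l = some h) : h.1 ∉ S :=
  (mem_keep.1 (List.mem_of_head? hl)).2

theorem right_mem (h1 : C.ContractLinkConnected S V h h') : h' ∈ V ∧ h'.1 ∉ S := by
  rcases h1.2.cases_tail with h | ⟨_, -, h2, h3, l, -, h4, -⟩
  · exact h ▸ h1.1
  · exact ⟨h3, first_notMem h4⟩

theorem symm (h1 : C.ContractLinkConnected S V h h') : C.ContractLinkConnected S V h' h := by
  refine ⟨h1.right_mem, Relation.ReflTransGen.mono ?_ _ _ h1.2.swap⟩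
  rintro a b ⟨h2, h3, l, h4, h5, h6⟩
  exact ⟨h3, h2, revWalk l, h4.revWalk, h6, by rwa [revWalk_revWalk]⟩

theorem mono (hV : V ⊆ V') (h1 : C.ContractLinkConnected S V h h') :
    C.ContractLinkConnected S V' h h' := by
  refine ⟨⟨hV h1.1.1, h1.1.2⟩, Relation.ReflTransGen.mono ?_ _ _ h1.2⟩
  exact fun _ _ hab => ⟨hV hab.1, hV hab.2.1, hab.2.2⟩

theorem of_faceWalk {l : List C.Dart} (hl : C.IsFaceWalk l) (hh : first S (revWalk l) = some h)
    (hh' : first S l = some h') (hV : h ∈ V) (hV' : h' ∈ V) : C.ContractLinkConnected S V h h' :=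
  ⟨⟨hV, first_notMem hh⟩, .single ⟨hV, hV', l, hl, hh', hh⟩⟩

end ContractLinkConnected

/-! #### Contracting a set of edges and one further edge -/

section TwoSteps

variable {T : Set C.Edge} {e : (C.contract T).Edge}

/-- The dart of `C` which gives rise to a dart of `C / T / e`. -/
def toDart (d : ((C.contract T).contract {e}).Dart) : C.Dart := (d.1.1.1, d.2)

theorem toDart_injective :
    Function.Injective (toDart : ((C.contract T).contract {e}).Dart → C.Dart) := by
  rintro ⟨⟨⟨x, hx⟩, hx'⟩, b⟩ ⟨⟨⟨y, hy⟩, hy'⟩, b'⟩ h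
  simp only [toDart, Prod.mk.injEq] at h
  obtain ⟨rfl, rfl⟩ := h
  rfl

theorem toDart_rev (d : ((C.contract T).contract {e}).Dart) : toDart d.rev = (toDart d).rev := rfl

theorem exists_toDart_eq {h : C.Dart} (hh : h.1 ∉ insert e.1 T) :
    ∃ d : ((C.contract T).contract {e}).Dart, toDart d = h := by
  have h1 : h.1 ∉ T := fun h2 => hh (Set.mem_insert_of_mem _ h2)
  refine ⟨(⟨⟨h.1, h1⟩, fun h2 => hh ?_⟩, h.2), rfl⟩
  have h3 : (⟨h.1, h1⟩ : (C.contract T).Edge) = e := h2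
  rw [← h3]
  exact Set.mem_insert _ _

theorem dropEdges_cons_of_mem {E : Type} {S : Set E} {d : E × Bool} (hd : d.1 ∈ S)
    (l : List (E × Bool)) : dropEdges S (d :: l) = dropEdges S l := by
  simp [dropEdges, hd]

theorem dropEdges_cons_of_notMem {E : Type} {S : Set E} {d : E × Bool} (hd : d.1 ∉ S)
    (l : List (E × Bool)) : dropEdges S (d :: l) = (⟨d.1, hd⟩, d.2) :: dropEdges S l := by
  simp [dropEdges, hd]

theorem map_toDart_bdry (f : C.Face) :
    (((C.contract T).contract {e}).bdry f).map toDart = keep (insert e.1 T) (C.bdry f) := by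
  change (dropEdges {e} (dropEdges T (C.bdry f))).map toDart = _
  induction C.bdry f with
  | nil => rfl
  | cons d l ih =>
    obtain ⟨x, b⟩ := d
    by_cases hx : x ∈ T
    · rw [keep_cons_of_mem (Set.mem_insert_of_mem _ hx), ← ih, dropEdges_cons_of_mem hx]
    · rw [dropEdges_cons_of_notMem hx]
      by_cases hxe : (⟨x, hx⟩ : (C.contract T).Edge) = e
      · rw [keep_cons_of_mem (by rw [← hxe]; exact Set.mem_insert _ _), ← ih]
        exact congrArg _ (dropEdges_cons_of_mem (S := {e})
          (d := ((⟨x, hx⟩ : (C.contract T).Edge), b)) hxe _)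
      · rw [keep_cons_of_notMem, ← ih]
        · exact congrArg (List.map toDart)
            (dropEdges_cons_of_notMem (S := {e}) (d := ((⟨x, hx⟩ : (C.contract T).Edge), b)) hxe _)
        · rintro (h | h)
          · exact hxe (Subtype.ext h)
          · exact hx h

theorem linkAdj_of_keep {f : C.Face} {l : List C.Dart} (hl : l ~r C.bdry f)
    {d d' : ((C.contract T).contract {e}).Dart}
    (h1 : (keep (insert e.1 T) l).head? = some (toDart d'))
    (h2 : (keep (insert e.1 T) l).getLast? = some (toDart d).rev) :
    ((C.contract T).contract {e}).LinkAdj d d' := by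
  have h3 := (keep_isRotated (S := insert e.1 T) hl).symm
  rw [← map_toDart_bdry] at h3
  obtain ⟨n, hn⟩ := h3
  rw [← List.map_rotate] at hn
  refine ⟨f, (((C.contract T).contract {e}).bdry f).rotate n, List.IsRotated.forall _ _, ?_, ?_⟩
  · rw [← hn, List.head?_map] at h1
    obtain ⟨x, hx, hx'⟩ := Option.map_eq_some_iff.1 h1
    rw [hx, toDart_injective hx']
  · rw [← hn, List.getLast?_map] at h2
    obtain ⟨x, hx, hx'⟩ := Option.map_eq_some_iff.1 h2
    rw [← toDart_rev] at hx'
    rw [hx, toDart_injective hx']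

/-- A corner of a face of the contracted complex corresponds to the start of a walk around the
original face: its two darts are the first ones outside the contracted set in the two senses.
Reversing the walk swaps them, whence the alternative. -/
theorem linkAdj_of_faceWalk {l : List C.Dart} (hl : C.IsFaceWalk l)
    {d d' : ((C.contract T).contract {e}).Dart} (h1 : first (insert e.1 T) l = some (toDart d'))
    (h2 : first (insert e.1 T) (revWalk l) = some (toDart d)) :
    ((C.contract T).contract {e}).LinkAdj d d' ∨ ((C.contract T).contract {e}).LinkAdj d' d := by
  have key : ∀ {l : List C.Dart} {h : C.Dart}, first (insert e.1 T) (revWalk l) = some h →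
      (keep (insert e.1 T) l).getLast? = some h.rev := by
    intro l h h2
    rw [first_revWalk] at h2
    obtain ⟨x, hx, rfl⟩ := Option.map_eq_some_iff.1 h2
    rw [hx, Dart.rev_rev]
  obtain ⟨f, hf | hf⟩ := hl
  · exact .inl (linkAdj_of_keep hf h1 (key h2))
  · right
    have h3 : revWalk l ~r C.bdry f := by
      have := hf.reverse.map Dart.rev
      rwa [← TwoComplex.revWalk, ← TwoComplex.revWalk, revWalk_revWalk] at this
    exact linkAdj_of_keep h3 h2 (key (by rwa [revWalk_revWalk]))

theorem ContractLinkConnected.linkConnected {V : Set C.Dart} {h h' : C.Dart}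
    (hc : C.ContractLinkConnected (insert e.1 T) V h h')
    {d d' : ((C.contract T).contract {e}).Dart} (hd : toDart d = h) (hd' : toDart d' = h') :
    ((C.contract T).contract {e}).LinkConnected (toDart ⁻¹' V) d d' := by
  obtain ⟨⟨h1, -⟩, h2⟩ := hc
  induction h2 generalizing d' with
  | refl =>
    obtain rfl := toDart_injective (hd.trans hd'.symm)
    exact LinkConnected.refl (by simpa [hd] using h1)
  | tail _ hstep ih =>
    obtain ⟨h3, h4, l, h5, h6, h7⟩ := hstep
    obtain ⟨d'', hd''⟩ := exists_toDart_eq (first_notMem h7)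
    refine (ih hd'').trans (LinkConnected.of_adj (by simpa [hd''] using h3)
      (by simpa [hd'] using h4) (linkAdj_of_faceWalk h5 ?_ ?_))
    · rw [h6, hd']
    · rw [h7, hd'']

theorem subsingleton_vertex (hT : (C.graph T).Connected) :
    Subsingleton ((C.contract T).contract {e}).Vertex := by
  refine ⟨fun x y => ?_⟩
  obtain ⟨x, rfl⟩ := Quot.exists_rep x
  obtain ⟨y, rfl⟩ := Quot.exists_rep y
  congr 1
  obtain ⟨x, rfl⟩ := Quot.exists_rep x
  obtain ⟨y, rfl⟩ := Quot.exists_rep y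
  obtain ⟨p⟩ := hT.preconnected x y
  induction p with
  | nil => rfl
  | cons hadj _ ih =>
    refine Eq.trans ?_ ih
    obtain ⟨-, a, ha, h⟩ := hadj
    rcases Sym2.eq_iff.1 h with ⟨h1, h2⟩ | ⟨h1, h2⟩
    · exact Quot.sound ⟨a, ha, h1, h2⟩
    · exact (Quot.sound ⟨a, ha, h1, h2⟩).symm

theorem not_embedsIn3Space_of_contractLinkConnected (hT : (C.graph T).Connected)
    (V : Fin 3 → Fin 3 → Set C.Dart) (a b : Fin 3 → C.Dart)
    (hdisj : ∀ i j k l, i ≠ k → j ≠ l → Disjoint (V i j) (V k l))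
    (hconn : ∀ i j, C.ContractLinkConnected (insert e.1 T) (V i j) (a i) (b j)) :
    ¬ ((C.contract T).contract {e}).EmbedsIn3Space := by
  have := subsingleton_vertex (e := e) hT
  choose a' ha' using fun i => exists_toDart_eq (hconn i 0).1.2
  choose b' hb' using fun j => exists_toDart_eq (hconn 0 j).right_mem.2
  exact not_embedsIn3Space_of_linkConnected (fun i j => toDart ⁻¹' V i j) a' b'
    (fun i j k l hik hjl => (hdisj i j k l hik hjl).preimage _)
    fun i j => (hconn i j).linkConnected (ha' i) (hb' j)

end TwoSteps

end TwoComplex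


/-! ### Flags of 2-complexes, and the local structure of subdivided cuboid complexes -/

namespace TwoComplex

/-- `l` is a boundary walk of a face which starts with a dart from `w` to `y` and ends with a dart
from `y'` to `w`. -/
def Flag (C : TwoComplex) (w y y' : C.Vertex) (l : List C.Dart) : Prop :=
  C.IsFaceWalk l ∧ (∃ d, l.head? = some d ∧ d.tail = w ∧ d.head = y) ∧
    ∃ d, l.getLast? = some d ∧ d.tail = y' ∧ d.head = w

variable {C : TwoComplex} {w y y' : C.Vertex} {l : List C.Dart}

theorem Flag.revWalk (h : C.Flag w y y' l) : C.Flag w y' y (revWalk l) := by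
  obtain ⟨h1, ⟨d, h2, h3, h4⟩, ⟨d', h5, h6, h7⟩⟩ := h
  refine ⟨h1.revWalk, ⟨d'.rev, ?_, by simpa, by simpa⟩, ⟨d.rev, ?_, by simpa, by simpa⟩⟩
  · simp [TwoComplex.revWalk, List.head?_reverse, h5]
  · simp [TwoComplex.revWalk, List.getLast?_reverse, h2]

/-- This moves the base point one step along the face. It is used to pass from the link of one
vertex to that of its neighbour across a contracted edge. -/
theorem Flag.rotate {d d' : C.Dart} (h : C.Flag w y y' (d :: d' :: l)) :
    C.Flag y d'.head w (d' :: l ++ [d]) ∧ d'.tail = y := by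
  obtain ⟨h1, ⟨_, h2, h3, h4⟩, -⟩ := h
  obtain rfl := Option.some.inj h2
  obtain ⟨u, hu⟩ := h1.exists_isWalk
  rw [isWalk_cons, isWalk_cons] at hu
  have h5 : d'.tail = y := by rw [hu.2.1, h4]
  refine ⟨⟨h1.of_isRotated ?_, ⟨d', rfl, h5, rfl⟩, ⟨d, List.getLast?_concat, h3, h4⟩⟩, h5⟩
  exact (List.isRotated_append (l := [d]) (l' := d' :: l)).symm

end TwoComplex

/-! ### Corners of faces at a grid vertex. -/

namespace Cuboid

open TwoComplex

variable {N : Fin 3 → ℕ} {D : Subdivision N}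

theorem step_apply (i k : Fin 3) : step i k = if k = i then 1 else 0 := by
  simp [step, Pi.single_apply]

/-- `w` and `y` are neighbours in the grid, in the direction of the axis `i`. -/
def GridAdj (i : Fin 3) (w y : Vertex N) : Prop :=
  (∀ k, k ≠ i → y.1 k = w.1 k) ∧ (y.1 i = w.1 i + 1 ∨ w.1 i = y.1 i + 1)

theorem vertex_le (w : Vertex N) (k : Fin 3) : w.1 k ≤ N k := w.2 k

theorem vertex_ext {v w : Vertex N} (h : ∀ k, v.1 k = w.1 k) : v = w := Subtype.ext (funext h)

/-- One neighbour in each direction is all that the connectivity argument needs, so vertices on the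
surface of the cuboid require no separate treatment. -/
theorem exists_gridAdj {i : Fin 3} (hi : 1 ≤ N i) (w : Vertex N) : ∃ y, GridAdj i w y := by
  have hw := vertex_le w
  by_cases h : w.1 i = 0
  · refine ⟨⟨fun k => if k = i then 1 else w.1 k, fun k => ?_⟩, fun k hk => by simp [hk], ?_⟩
    · by_cases hk : k = i
      · subst hk; simpa using hi
      · simpa [hk] using hw k
    · simp [h]
  · refine ⟨⟨fun k => if k = i then w.1 k - 1 else w.1 k, fun k => ?_⟩, fun k hk => by simp [hk], ?_⟩
    · have := hw k
      by_cases hk : k = i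
      · simp only [hk, if_true]
        subst hk
        omega
      · simpa [hk] using this
    · simp only [if_true]
      omega

theorem exists_gridAdj_add {w : Vertex N} (hw : IsInterior w) (i : Fin 3) :
    ∃ y : Vertex N, GridAdj i w y ∧ y.1 i = w.1 i + 1 := by
  have h : ∀ k, (if k = i then w.1 k + 1 else w.1 k) ≤ N k := fun k => by
    have := (hw k).2
    split_ifs <;> omega
  exact ⟨⟨fun k => if k = i then w.1 k + 1 else w.1 k, h⟩,
    ⟨fun k hk => by simp [hk], by simp⟩, by simp⟩

theorem exists_gridAdj_sub {w : Vertex N} (hw : IsInterior w) (i : Fin 3) :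
    ∃ y : Vertex N, GridAdj i w y ∧ w.1 i = y.1 i + 1 := by
  have h : ∀ k, (if k = i then w.1 k - 1 else w.1 k) ≤ N k := fun k => by
    have := (hw k).2
    split_ifs <;> omega
  have h1 := (hw i).1
  have h2 : w.1 i = w.1 i - 1 + 1 := by omega
  exact ⟨⟨fun k => if k = i then w.1 k - 1 else w.1 k, h⟩,
    ⟨fun k hk => by simp [hk], .inr (by simpa using h2)⟩, by simpa using h2⟩

/-- The corners of a square. -/
def corners (s : Square N) : List (Vertex N) := [s.c00, s.c10, s.c11, s.c01]

theorem corners_nodup (s : Square N) : (corners s).Nodup := by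
  have hij : s.1.2.1 ≠ s.1.2.2 := s.2.1.ne
  have h : ∀ {v w : Vertex N} (k : Fin 3), v.1 k ≠ w.1 k → v ≠ w := by
    rintro v w k hk rfl
    exact hk rfl
  have h1 : s.c00 ≠ s.c10 := h s.1.2.1 (by simp [Square.c00, Square.c10, step_apply])
  have h2 : s.c00 ≠ s.c11 := h s.1.2.1 (by simp [Square.c00, Square.c11, step_apply, hij])
  have h3 : s.c00 ≠ s.c01 := h s.1.2.2 (by simp [Square.c00, Square.c01, step_apply])
  have h4 : s.c10 ≠ s.c11 := h s.1.2.2 (by simp [Square.c10, Square.c11, step_apply])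
  have h5 : s.c10 ≠ s.c01 := h s.1.2.1 (by simp [Square.c10, Square.c01, step_apply, hij])
  have h6 : s.c11 ≠ s.c01 := h s.1.2.1 (by simp [Square.c11, Square.c01, step_apply, hij])
  simp [corners, h1, h2, h3, h4, h5, h6]

theorem corners_near {s : Square N} {v w : Vertex N} (hv : v ∈ corners s) (hw : w ∈ corners s)
    (k : Fin 3) : v.1 k ≤ w.1 k + 1 := by
  have hij : s.1.2.1 ≠ s.1.2.2 := s.2.1.ne
  have key : ∀ {v : Vertex N}, v ∈ corners s → s.1.1 k ≤ v.1 k ∧ v.1 k ≤ s.1.1 k + 1 := by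
    intro v hv
    simp only [corners, List.mem_cons, List.not_mem_nil, or_false] at hv
    by_cases h1 : k = s.1.2.1
    · have h2 : k ≠ s.1.2.2 := fun h2 => hij (h1.symm.trans h2)
      rcases hv with rfl | rfl | rfl | rfl <;>
        simp only [Square.c00, Square.c10, Square.c11, Square.c01, Pi.add_apply, step_apply,
          if_pos h1, if_neg h2] <;> omega
    · by_cases h2 : k = s.1.2.2
      · rcases hv with rfl | rfl | rfl | rfl <;>
          simp only [Square.c00, Square.c10, Square.c11, Square.c01, Pi.add_apply, step_apply,
            if_neg h1, if_pos h2] <;> omega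
      · rcases hv with rfl | rfl | rfl | rfl <;>
          simp only [Square.c00, Square.c10, Square.c11, Square.c01, Pi.add_apply, step_apply,
            if_neg h1, if_neg h2] <;> omega
  have h1 := key hv
  have h2 := key hw
  omega

/-- The vertices of the boundary walks of the faces. -/
theorem exists_face_corners (f : (subdivided N D).Face) : ∃ s : Square N,
    3 ≤ ((subdivided N D).bdry f).length ∧
    (((subdivided N D).bdry f).map Dart.tail).Sublist (corners s) ∧
    ((((subdivided N D).bdry f).map Dart.head).Perm
      (((subdivided N D).bdry f).map Dart.tail)) := by
  rcases f with s | ⟨⟨⟨s, b⟩, h⟩, b'⟩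
  · refine ⟨s.1, by simp [subdivided], ?_, ?_⟩
    · change List.Sublist [s.1.c00, s.1.c10, s.1.top.tgt, s.1.c01] _
      rw [s.1.tgt_top]
      exact List.Sublist.refl _
    · change List.Perm [s.1.c10, s.1.c11, s.1.c01, s.1.c00] [s.1.c00, s.1.c10, s.1.top.tgt, s.1.c01]
      rw [s.1.tgt_top]
      exact (List.perm_append_comm (l₁ := [s.1.c10, s.1.c11, s.1.c01]) (l₂ := [s.1.c00]))
  · refine ⟨s, by cases b <;> cases b' <;> simp [subdivided], ?_, ?_⟩
    · cases b <;> cases b'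
      · change List.Sublist [s.c10, s.top.tgt, s.c01] _
        rw [s.tgt_top]
        exact List.sublist_cons_self _ _
      · change List.Sublist [s.c00, s.c10, s.c01] _
        exact ((List.sublist_cons_self _ _).cons_cons _).cons_cons _
      · change List.Sublist [s.c00, s.top.tgt, s.c01] _
        rw [s.tgt_top]
        exact (List.sublist_cons_self _ _).cons_cons _
      · change List.Sublist [s.c00, s.c10, s.c11] _
        exact List.sublist_append_left [s.c00, s.c10, s.c11] [s.c01]
    · cases b <;> cases b'
      · change List.Perm [s.c11, s.c01, s.c10] [s.c10, s.top.tgt, s.c01]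
        rw [s.tgt_top]
        exact (List.perm_append_comm (l₁ := [s.c11, s.c01]) (l₂ := [s.c10]))
      · exact (List.perm_append_comm (l₁ := [s.c10, s.c01]) (l₂ := [s.c00]))
      · change List.Perm [s.c11, s.c01, s.c00] [s.c00, s.top.tgt, s.c01]
        rw [s.tgt_top]
        exact (List.perm_append_comm (l₁ := [s.c11, s.c01]) (l₂ := [s.c00]))
      · exact (List.perm_append_comm (l₁ := [s.c10, s.c11]) (l₂ := [s.c00]))

theorem isFaceWalk_corners {l : List (subdivided N D).Dart} (h : (subdivided N D).IsFaceWalk l) :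
    3 ≤ l.length ∧ (l.map Dart.tail).Nodup ∧
      ∃ s : Square N, ∀ d : (subdivided N D).Dart, d ∈ l →
        d.tail ∈ corners s ∧ d.head ∈ corners s := by
  obtain ⟨f, hf⟩ := h
  obtain ⟨s, h1, h2, h3⟩ := exists_face_corners f
  have hn := h2.nodup (corners_nodup s)
  have ht : ∀ d : (subdivided N D).Dart, d ∈ (subdivided N D).bdry f →
      d.tail ∈ corners s ∧ d.head ∈ corners s := fun d hd =>
    ⟨h2.subset (List.mem_map_of_mem hd), h2.subset (h3.subset (List.mem_map_of_mem hd))⟩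
  rcases hf with hf | hf
  · exact ⟨by rwa [hf.perm.length_eq], (hf.perm.map _).nodup_iff.2 hn, s,
      fun d hd => ht d (hf.mem_iff.1 hd)⟩
  · refine ⟨by rw [hf.perm.length_eq]; simpa [revWalk] using h1,
      (hf.perm.map _).nodup_iff.2 ?_, s, fun d hd => ?_⟩
    · have : (revWalk ((subdivided N D).bdry f)).map Dart.tail
          = (((subdivided N D).bdry f).map Dart.head).reverse := by
        simp [revWalk, List.map_reverse, Function.comp_def]
      rw [this, List.nodup_reverse]
      exact h3.nodup_iff.2 hn
    · have := hf.mem_iff.1 hd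
      simp only [revWalk, List.mem_map, List.mem_reverse] at this
      obtain ⟨d', hd', rfl⟩ := this
      rw [Dart.tail_rev, Dart.head_rev]
      exact (ht d' hd').symm

/-- Some face has consecutive vertices `y', w, y`. -/
def Corner (D : Subdivision N) (w y y' : Vertex N) : Prop :=
  ∃ l, (subdivided N D).Flag w y y' l

theorem Corner.symm {w y y' : Vertex N} (h : Corner D w y y') : Corner D w y' y :=
  h.imp' _ fun _ hl => hl.revWalk

theorem DiagAdj.symm {w x : Vertex N} (h : DiagAdj D w x) : DiagAdj D x w :=
  h.imp fun _ hd => hd.trans Sym2.eq_swap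

/-- The unit square with the vertices `w, y, x, y'` gives rise to a face with consecutive
vertices `y, w, y'`, or it is subdivided by the diagonal from `w` to `x`. -/
def Quad (D : Subdivision N) (w y x y' : Vertex N) : Prop :=
  Corner D w y y' ∨ DiagAdj D w x ∧ Corner D w y x ∧ Corner D w x y'

theorem Quad.symm {w y x y' : Vertex N} (h : Quad D w y x y') : Quad D w y' x y :=
  h.imp Corner.symm fun h => ⟨h.1, h.2.2.symm, h.2.1.symm⟩

theorem corner_of_rotate (f : (subdivided N D).Face) (k : ℕ) {w y y' : Vertex N}
    {d d' : (subdivided N D).Dart} (h1 : (((subdivided N D).bdry f).rotate k).head? = some d)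
    (h2 : d.tail = w) (h3 : d.head = y)
    (h4 : (((subdivided N D).bdry f).rotate k).getLast? = some d')
    (h5 : d'.tail = y') (h6 : d'.head = w) : Corner D w y y' :=
  ⟨_, ⟨⟨f, .inl (List.IsRotated.forall _ k)⟩, ⟨d, h1, h2, h3⟩, ⟨d', h4, h5, h6⟩⟩⟩

theorem corners_of_none {s : Square N} (h : D s = none) :
    Corner D s.c00 s.c10 s.c01 ∧ Corner D s.c10 s.c11 s.c00 ∧ Corner D s.c11 s.c01 s.c10 ∧
      Corner D s.c01 s.c00 s.c11 :=
  ⟨corner_of_rotate (.inl ⟨s, h⟩) 0 rfl rfl rfl rfl rfl rfl,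
    corner_of_rotate (.inl ⟨s, h⟩) 1 rfl rfl rfl rfl rfl rfl,
    corner_of_rotate (.inl ⟨s, h⟩) 2 rfl s.tgt_top rfl rfl rfl rfl,
    corner_of_rotate (.inl ⟨s, h⟩) 3 rfl rfl rfl rfl s.tgt_top rfl⟩

theorem corners_of_some_true {s : Square N} (h : D s = some true) :
    DiagAdj D s.c00 s.c11 ∧ Corner D s.c00 s.c10 s.c11 ∧ Corner D s.c10 s.c11 s.c00 ∧
      Corner D s.c11 s.c00 s.c10 ∧ Corner D s.c00 s.c11 s.c01 ∧ Corner D s.c11 s.c01 s.c00 ∧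
      Corner D s.c01 s.c00 s.c11 :=
  ⟨⟨⟨(s, true), h⟩, rfl⟩,
    corner_of_rotate (.inr (⟨(s, true), h⟩, true)) 0 rfl rfl rfl rfl rfl rfl,
    corner_of_rotate (.inr (⟨(s, true), h⟩, true)) 1 rfl rfl rfl rfl rfl rfl,
    corner_of_rotate (.inr (⟨(s, true), h⟩, true)) 2 rfl rfl rfl rfl rfl rfl,
    corner_of_rotate (.inr (⟨(s, true), h⟩, false)) 0 rfl rfl rfl rfl rfl rfl,
    corner_of_rotate (.inr (⟨(s, true), h⟩, false)) 1 rfl s.tgt_top rfl rfl rfl rfl,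
    corner_of_rotate (.inr (⟨(s, true), h⟩, false)) 2 rfl rfl rfl rfl s.tgt_top rfl⟩

theorem corners_of_some_false {s : Square N} (h : D s = some false) :
    DiagAdj D s.c10 s.c01 ∧ Corner D s.c00 s.c10 s.c01 ∧ Corner D s.c10 s.c01 s.c00 ∧
      Corner D s.c01 s.c00 s.c10 ∧ Corner D s.c10 s.c11 s.c01 ∧ Corner D s.c11 s.c01 s.c10 ∧
      Corner D s.c01 s.c10 s.c11 :=
  ⟨⟨⟨(s, false), h⟩, rfl⟩,
    corner_of_rotate (.inr (⟨(s, false), h⟩, true)) 0 rfl rfl rfl rfl rfl rfl,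
    corner_of_rotate (.inr (⟨(s, false), h⟩, true)) 1 rfl rfl rfl rfl rfl rfl,
    corner_of_rotate (.inr (⟨(s, false), h⟩, true)) 2 rfl rfl rfl rfl rfl rfl,
    corner_of_rotate (.inr (⟨(s, false), h⟩, false)) 0 rfl rfl rfl rfl rfl rfl,
    corner_of_rotate (.inr (⟨(s, false), h⟩, false)) 1 rfl s.tgt_top rfl rfl rfl rfl,
    corner_of_rotate (.inr (⟨(s, false), h⟩, false)) 2 rfl rfl rfl rfl s.tgt_top rfl⟩

/-- A diagonal cuts the corner at each of its ends in two and leaves the other two corners whole. -/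
theorem quads (D : Subdivision N) (s : Square N) :
    Quad D s.c00 s.c10 s.c11 s.c01 ∧ Quad D s.c10 s.c11 s.c01 s.c00 ∧
      Quad D s.c11 s.c01 s.c00 s.c10 ∧ Quad D s.c01 s.c00 s.c10 s.c11 := by
  rcases h : D s with _ | _ | _
  · obtain ⟨h1, h2, h3, h4⟩ := corners_of_none h
    exact ⟨.inl h1, .inl h2, .inl h3, .inl h4⟩
  · obtain ⟨h0, h1, h2, h3, h4, h5, h6⟩ := corners_of_some_false h
    exact ⟨.inl h1, .inr ⟨h0, h4, h2⟩, .inl h5, .inr ⟨h0.symm, h3, h6⟩⟩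
  · obtain ⟨h0, h1, h2, h3, h4, h5, h6⟩ := corners_of_some_true h
    exact ⟨.inr ⟨h0, h1, h4⟩, .inl h2, .inr ⟨h0.symm, h5, h3⟩, .inl h6⟩

/-- In the link of a grid vertex, neighbours in different directions are joined by an edge, possibly
subdivided by a diagonal: the link is an octahedron, or a part of one on the surface. -/
theorem exists_quad (D : Subdivision N) {i j : Fin 3} (hij : i ≠ j) {w y y' : Vertex N}
    (hy : GridAdj i w y) (hy' : GridAdj j w y') :
    ∃ x : Vertex N, (∀ k, x.1 k + w.1 k = y.1 k + y'.1 k) ∧ Quad D w y x y' := by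
  wlog hlt : i < j generalizing i j y y'
  · obtain ⟨x, h1, h2⟩ := this hij.symm hy' hy (lt_of_le_of_ne (not_lt.1 hlt) hij.symm)
    exact ⟨x, fun k => by rw [h1, add_comm], h2.symm⟩
  obtain ⟨hy1, hy2⟩ := hy
  obtain ⟨hy'1, hy'2⟩ := hy'
  -- The least corner of the square spanned by the two neighbours. The four sign cases at the end
  -- determine which corner is `w`.
  let p : Fin 3 → ℕ := fun k =>
    if k = i then min (w.1 k) (y.1 k) else if k = j then min (w.1 k) (y'.1 k) else w.1 k
  have hp : ∀ k, p k = if k = i then min (w.1 k) (y.1 k) else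
    if k = j then min (w.1 k) (y'.1 k) else w.1 k := fun _ => rfl
  have hle : p + step i + step j ≤ N := by
    intro k
    have h1 := vertex_le w k
    have h2 := vertex_le y k
    have h3 := vertex_le y' k
    simp only [Pi.add_apply, step_apply, hp]
    by_cases hki : k = i
    · subst hki
      simp only [if_true, if_neg hij]
      omega
    · by_cases hkj : k = j
      · subst hkj
        simp only [if_true, if_neg hki]
        omega
      · simp only [if_neg hki, if_neg hkj]
        omega
  let s : Square N := ⟨(p, i, j), hlt, hle⟩
  obtain ⟨q1, q2, q3, q4⟩ := quads D s
  have c00 : ∀ k, s.c00.1 k = p k := fun k => rfl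
  have c10 : ∀ k, s.c10.1 k = p k + if k = i then 1 else 0 := fun k => by rw [← step_apply]; rfl
  have c01 : ∀ k, s.c01.1 k = p k + if k = j then 1 else 0 := fun k => by rw [← step_apply]; rfl
  have c11 : ∀ k, s.c11.1 k = p k + (if k = i then 1 else 0) + if k = j then 1 else 0 :=
    fun k => by rw [← step_apply, ← step_apply]; rfl
  have hj1 := hy1 j hij.symm
  have hi1 := hy'1 i hij
  have key : ∀ {v v' : Vertex N}, v.1 i = v'.1 i → v.1 j = v'.1 j →
      (∀ k, k ≠ i → k ≠ j → v.1 k = v'.1 k) → v = v' := by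
    intro v v' h1 h2 h3
    refine vertex_ext fun k => ?_
    by_cases hki : k = i
    · rw [hki, h1]
    · by_cases hkj : k = j
      · rw [hkj, h2]
      · exact h3 k hki hkj
  have hpi : p i = min (w.1 i) (y.1 i) := by simp [hp]
  have hpj : p j = min (w.1 j) (y'.1 j) := by simp [hp, hij.symm]
  have hpk : ∀ k, k ≠ i → k ≠ j → p k = w.1 k := fun k h1 h2 => by simp [hp, h1, h2]
  have hsum : ∀ x : Vertex N, x.1 i = y.1 i → x.1 j = y'.1 j →
      (∀ k, k ≠ i → k ≠ j → x.1 k = w.1 k) → ∀ k, x.1 k + w.1 k = y.1 k + y'.1 k := by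
    intro x h1 h2 h3 k
    by_cases hki : k = i
    · rw [hki, h1, hi1]
    · by_cases hkj : k = j
      · rw [hkj, h2, hj1, add_comm]
      · rw [h3 k hki hkj, hy1 k hki, hy'1 k hkj]
  rcases hy2 with hy2 | hy2 <;> rcases hy'2 with hy'2 | hy'2
  · have e1 : s.c00 = w := key (by rw [c00]; omega) (by rw [c00]; omega)
      fun k h1 h2 => by rw [c00, hpk k h1 h2]
    have e2 : s.c10 = y := key (by rw [c10, if_pos rfl]; omega)
      (by rw [c10, if_neg hij.symm]; omega)
      fun k h1 h2 => by rw [c10, if_neg h1, hpk k h1 h2, hy1 k h1, add_zero]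
    have e3 : s.c01 = y' := key (by rw [c01, if_neg hij]; omega)
      (by rw [c01, if_pos rfl]; omega)
      fun k h1 h2 => by rw [c01, if_neg h2, hpk k h1 h2, hy'1 k h2, add_zero]
    refine ⟨s.c11, hsum _ ?_ ?_ ?_, by rwa [e1, e2, e3] at q1⟩
    · rw [c11, if_pos rfl, if_neg hij]; omega
    · rw [c11, if_pos rfl, if_neg hij.symm]; omega
    · intro k h1 h2; rw [c11, if_neg h1, if_neg h2, hpk k h1 h2, add_zero, add_zero]
  · have e1 : s.c01 = w := key (by rw [c01, if_neg hij]; omega) (by rw [c01, if_pos rfl]; omega)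
      fun k h1 h2 => by rw [c01, if_neg h2, hpk k h1 h2, add_zero]
    have e2 : s.c11 = y := key (by rw [c11, if_pos rfl, if_neg hij]; omega)
      (by rw [c11, if_neg hij.symm, if_pos rfl]; omega)
      fun k h1 h2 => by rw [c11, if_neg h1, if_neg h2, hpk k h1 h2, hy1 k h1, add_zero, add_zero]
    have e3 : s.c00 = y' := key (by rw [c00]; omega)
      (by rw [c00]; omega)
      fun k h1 h2 => by rw [c00, hpk k h1 h2, hy'1 k h2]
    refine ⟨s.c10, hsum _ ?_ ?_ ?_, by rw [e1, e2, e3] at q4; exact q4.symm⟩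
    · rw [c10, if_pos rfl]; omega
    · rw [c10, if_neg hij.symm]; omega
    · intro k h1 h2; rw [c10, if_neg h1, hpk k h1 h2, add_zero]
  · have e1 : s.c10 = w := key (by rw [c10, if_pos rfl]; omega)
      (by rw [c10, if_neg hij.symm]; omega)
      fun k h1 h2 => by rw [c10, if_neg h1, hpk k h1 h2, add_zero]
    have e2 : s.c00 = y := key (by rw [c00]; omega) (by rw [c00]; omega)
      fun k h1 h2 => by rw [c00, hpk k h1 h2, hy1 k h1]
    have e3 : s.c11 = y' := key (by rw [c11, if_pos rfl, if_neg hij]; omega)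
      (by rw [c11, if_neg hij.symm, if_pos rfl]; omega)
      fun k h1 h2 => by rw [c11, if_neg h1, if_neg h2, hpk k h1 h2, hy'1 k h2, add_zero, add_zero]
    refine ⟨s.c01, hsum _ ?_ ?_ ?_, by rw [e1, e2, e3] at q2; exact q2.symm⟩
    · rw [c01, if_neg hij]; omega
    · rw [c01, if_pos rfl]; omega
    · intro k h1 h2; rw [c01, if_neg h2, hpk k h1 h2, add_zero]
  · have e1 : s.c11 = w := key (by rw [c11, if_pos rfl, if_neg hij]; omega)
      (by rw [c11, if_neg hij.symm, if_pos rfl]; omega)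
      fun k h1 h2 => by rw [c11, if_neg h1, if_neg h2, hpk k h1 h2, add_zero, add_zero]
    have e2 : s.c01 = y := key (by rw [c01, if_neg hij]; omega) (by rw [c01, if_pos rfl]; omega)
      fun k h1 h2 => by rw [c01, if_neg h2, hpk k h1 h2, hy1 k h1, add_zero]
    have e3 : s.c10 = y' := key (by rw [c10, if_pos rfl]; omega)
      (by rw [c10, if_neg hij.symm]; omega)
      fun k h1 h2 => by rw [c10, if_neg h1, hpk k h1 h2, hy'1 k h2, add_zero]
    refine ⟨s.c00, hsum _ ?_ ?_ ?_, by rwa [e1, e2, e3] at q3⟩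
    · rw [c00]; omega
    · rw [c00]; omega
    · intro k h1 h2; rw [c00, hpk k h1 h2]

/-- In the link of `w`, a diagonal subdivides the octahedron edge between two grid neighbours. -/
theorem DiagAdj.exists_corners {w x : Vertex N} (h : DiagAdj D w x) :
    ∃ (i j : Fin 3) (y y' : Vertex N), i ≠ j ∧ GridAdj i w y ∧ GridAdj j w y' ∧
      (∀ k, x.1 k + w.1 k = y.1 k + y'.1 k) ∧ Corner D w y x ∧ Corner D w x y' := by
  obtain ⟨⟨⟨s, b⟩, hb⟩, hs⟩ := h
  have hij : s.1.2.1 ≠ s.1.2.2 := s.2.1.ne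
  have c00 : ∀ k, s.c00.1 k = s.1.1 k := fun k => rfl
  have c10 : ∀ k, s.c10.1 k = s.1.1 k + if k = s.1.2.1 then 1 else 0 := fun k => by
    rw [← step_apply]; rfl
  have c01 : ∀ k, s.c01.1 k = s.1.1 k + if k = s.1.2.2 then 1 else 0 := fun k => by
    rw [← step_apply]; rfl
  have c11 : ∀ k, s.c11.1 k = s.1.1 k + (if k = s.1.2.1 then 1 else 0) +
      if k = s.1.2.2 then 1 else 0 := fun k => by rw [← step_apply, ← step_apply]; rfl
  cases b
  · obtain ⟨h0, h1, h2, h3, h4, h5, h6⟩ := corners_of_some_false hb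
    rcases Sym2.eq_iff.1 (show s(s.c10, s.c01) = s(w, x) from hs) with ⟨rfl, rfl⟩ | ⟨rfl, rfl⟩
    · refine ⟨s.1.2.1, s.1.2.2, s.c00, s.c11, hij, ⟨fun k hk => ?_, ?_⟩, ⟨fun k hk => ?_, ?_⟩,
        fun k => ?_, h2.symm, h4.symm⟩
      · simp [c00, c10, hk]
      · simp [c00, c10]
      · simp [c11, c10, hk]
      · simp [c11, c10]
      · rw [c01, c10, c00, c11]; ring
    · refine ⟨s.1.2.1, s.1.2.2, s.c11, s.c00, hij, ⟨fun k hk => ?_, ?_⟩, ⟨fun k hk => ?_, ?_⟩,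
        fun k => ?_, h6.symm, h3.symm⟩
      · simp [c11, c01, hk]
      · simp [c11, c01, hij]
      · simp [c00, c01, hk]
      · simp [c00, c01]
      · rw [c01, c10, c00, c11]; ring
  · obtain ⟨h0, h1, h2, h3, h4, h5, h6⟩ := corners_of_some_true hb
    rcases Sym2.eq_iff.1 (show s(s.c00, s.c11) = s(w, x) from hs) with ⟨rfl, rfl⟩ | ⟨rfl, rfl⟩
    · refine ⟨s.1.2.1, s.1.2.2, s.c10, s.c01, hij, ⟨fun k hk => ?_, ?_⟩, ⟨fun k hk => ?_, ?_⟩,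
        fun k => ?_, h1, h4⟩
      · simp [c00, c10, hk]
      · simp [c00, c10]
      · simp [c00, c01, hk]
      · simp [c00, c01]
      · rw [c01, c10, c00, c11]; ring
    · refine ⟨s.1.2.1, s.1.2.2, s.c01, s.c10, hij, ⟨fun k hk => ?_, ?_⟩, ⟨fun k hk => ?_, ?_⟩,
        fun k => ?_, h5, h3⟩
      · simp [c11, c01, hk]
      · simp [c11, c01, hij]
      · simp [c11, c10, hk]
      · simp [c11, c10]
      · rw [c01, c10, c00, c11]; ring

theorem not_gridAdj_of_diagAdj {i : Fin 3} {w x : Vertex N} (h : DiagAdj D w x) :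
    ¬ GridAdj i w x := by
  rintro ⟨h1, -⟩
  obtain ⟨j, k, y, y', hjk, ⟨h2, h3⟩, ⟨h4, h5⟩, h6, -⟩ := h.exists_corners
  have key : ∀ m, m ≠ i → y.1 m + y'.1 m = w.1 m + w.1 m := fun m hm => by
    rw [← h6 m, h1 m hm]
  by_cases hj : j = i
  · have := key k (by rintro rfl; exact hjk hj)
    have := h2 k hjk.symm
    omega
  · have := key j hj
    have := h4 j hjk
    omega

theorem gridEdge_src_apply (g : GridEdge N) (k : Fin 3) : g.src.1 k = g.1.1 k := rfl

theorem gridEdge_tgt_apply (g : GridEdge N) (k : Fin 3) :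
    g.tgt.1 k = g.1.1 k + if k = g.1.2 then 1 else 0 := by
  rw [← step_apply]; rfl

theorem gridEdge_eq {g g' : GridEdge N} (h1 : g.src = g'.src) (h2 : g.tgt = g'.tgt) :
    g = g' := by
  have h3 : ∀ k, g.1.1 k = g'.1.1 k := fun k => congrArg (fun v : Vertex N => v.1 k) h1
  refine Subtype.ext (Prod.ext (funext h3) ?_)
  have h4 := congrArg (fun v : Vertex N => v.1 g.1.2) h2
  simp only [gridEdge_tgt_apply, h3, if_true] at h4
  by_contra h5
  rw [if_neg h5] at h4
  omega

theorem gridEdge_not_reversed {g g' : GridEdge N} (h1 : g.src = g'.tgt) (h2 : g.tgt = g'.src) :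
    False := by
  have h3 := congrArg (fun v : Vertex N => v.1 g.1.2) h1
  have h4 := congrArg (fun v : Vertex N => v.1 g.1.2) h2
  simp only [gridEdge_src_apply, gridEdge_tgt_apply, if_true] at h3 h4
  omega

theorem gridDart_eq {g g' : GridEdge N} {b b' : Bool}
    (ht : Dart.tail (Q := subdivided N D) (Sum.inl g, b)
      = Dart.tail (Q := subdivided N D) (Sum.inl g', b'))
    (hh : Dart.head (Q := subdivided N D) (Sum.inl g, b)
      = Dart.head (Q := subdivided N D) (Sum.inl g', b')) :
    g = g' ∧ b = b' := by
  cases b <;> cases b'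
  · exact ⟨gridEdge_eq hh ht, rfl⟩
  · exact (gridEdge_not_reversed (g := g) (g' := g') hh ht).elim
  · exact (gridEdge_not_reversed (g := g) (g' := g') ht hh).elim
  · exact ⟨gridEdge_eq ht hh, rfl⟩

/-- The type of a dart. -/
theorem dart_cases (d : (subdivided N D).Dart) :
    (∃ g i, d.1 = .inl g ∧ GridAdj (N := N) i d.tail d.head) ∨
      ∃ x, d.1 = .inr x ∧ DiagAdj D d.tail d.head := by
  obtain ⟨g | x, b⟩ := d
  · refine .inl ⟨g, g.1.2, rfl, ?_⟩
    cases b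
    · change GridAdj g.1.2 g.tgt g.src
      exact ⟨fun k hk => by simp [gridEdge_src_apply, gridEdge_tgt_apply, hk],
        by simp [gridEdge_src_apply, gridEdge_tgt_apply]⟩
    · change GridAdj g.1.2 g.src g.tgt
      exact ⟨fun k hk => by simp [gridEdge_src_apply, gridEdge_tgt_apply, hk],
        by simp [gridEdge_src_apply, gridEdge_tgt_apply]⟩
  · refine .inr ⟨x, rfl, ⟨x, ?_⟩⟩
    cases b
    · exact Sym2.eq_swap
    · rfl

/-- Two darts with the same endvertices agree, unless they are diagonal. -/
theorem dart_eq_or_diag {d d' : (subdivided N D).Dart} (ht : d.tail = d'.tail)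
    (hh : d.head = d'.head) : d = d' ∨ ∃ x x', d.1 = .inr x ∧ d'.1 = .inr x' := by
  rcases dart_cases d with ⟨g, i, h1, h2⟩ | ⟨x, h1, h2⟩ <;>
    rcases dart_cases d' with ⟨g', i', h3, h4⟩ | ⟨x', h3, h4⟩
  · left
    obtain ⟨e, b⟩ := d
    obtain ⟨e', b'⟩ := d'
    obtain rfl : e = .inl g := h1
    obtain rfl : e' = .inl g' := h3
    obtain ⟨rfl, rfl⟩ := gridDart_eq ht hh
    rfl
  · rw [ht, hh] at h2
    exact absurd h2 (not_gridAdj_of_diagAdj h4)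
  · rw [ht, hh] at h2
    exact absurd h4 (not_gridAdj_of_diagAdj h2)
  · exact .inr ⟨x, x', h1, h3⟩

/-- In a flag, the two neighbours of the vertex differ, and all the vertices are close. -/
theorem flag_ne {w y y' : Vertex N} {l : List (subdivided N D).Dart}
    (h : (subdivided N D).Flag w y y' l) : y ≠ y' := by
  obtain ⟨h1, h2, -⟩ := isFaceWalk_corners h.1
  obtain ⟨d, d', d'', l, rfl⟩ : ∃ (d d' d'' : (subdivided N D).Dart) (l₀ : _),
      l = d :: d' :: d'' :: l₀ := by
    rcases l with _ | ⟨d, _ | ⟨d', _ | ⟨d'', l⟩⟩⟩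
    · simp at h1
    · simp at h1
    · simp at h1
    · exact ⟨d, d', d'', l, rfl⟩
  have h3 : d'.tail = y := h.rotate.2
  obtain ⟨d₀, h4, h5, -⟩ := h.2.2
  have h6 : d₀ ∈ d'' :: l := by
    rw [List.getLast?_cons_cons, List.getLast?_cons_cons] at h4
    exact List.mem_of_getLast? h4
  have h7 : d₀.tail ∈ (d'' :: l).map Dart.tail := List.mem_map_of_mem h6
  rw [List.map_cons, List.map_cons, List.nodup_cons, List.nodup_cons] at h2
  intro hyy
  refine h2.2.1 ?_
  rw [h3, hyy, ← h5]
  exact h7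

/-- All vertices of a face are corners of one unit square. This is what prevents two vertices two
diagonal steps apart from lying on a common face. -/
theorem flag_near {w y y' : Vertex N} {l : List (subdivided N D).Dart}
    (h : (subdivided N D).Flag w y y' l) (k : Fin 3) : y.1 k ≤ y'.1 k + 1 ∧ y'.1 k ≤ y.1 k + 1 := by
  obtain ⟨-, -, s, hs⟩ := isFaceWalk_corners h.1
  obtain ⟨-, ⟨d, h1, -, rfl⟩, ⟨d', h2, rfl, -⟩⟩ := h
  have h3 := (hs d (List.mem_of_head? h1)).2
  have h4 := (hs d' (List.mem_of_getLast? h2)).1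
  exact ⟨corners_near h3 h4 k, corners_near h4 h3 k⟩

end Cuboid


/-! ### Trees with a root -/

namespace SimpleGraph

variable {V : Type*} {G : SimpleGraph V}

/-- A tree can be rooted at any vertex. -/
theorem IsTree.exists_parent (hG : G.IsTree) (b : V) : ∃ par : V → V,
    (∀ x, x ≠ b → G.Adj (par x) x ∧ G.dist b x = G.dist b (par x) + 1) ∧
    ∀ x y, G.Adj x y → (y ≠ b ∧ par y = x) ∨ (x ≠ b ∧ par x = y) := by
  have h1 : ∀ x, ∃ p : G.Walk b x, p.IsPath ∧ p.length = G.dist b x :=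
    hG.connected.exists_path_of_dist b
  choose p hp hlen using h1
  have hadj : ∀ x, x ≠ b → G.Adj (p x).penultimate x := fun x hx =>
    Walk.adj_penultimate (Walk.not_nil_of_ne hx.symm)
  have key : ∀ x y, G.Adj x y → G.dist b y = G.dist b x + 1 → (p y).penultimate = x := by
    intro x y hxy hd
    classical
    have h2 : y ∉ (p x).support := fun hy => by
      have h3 := G.dist_le ((p x).takeUntil y hy)
      have h4 := (p x).length_takeUntil_le_length hy
      have h5 := hlen x
      omega
    have h6 : (p y) = (p x).concat hxy := by
      have := (isAcyclic_iff_subsingleton_path.1 hG.isAcyclic b y).elim ⟨p y, hp y⟩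
        ⟨(p x).concat hxy, (hp x).concat h2 hxy⟩
      exact congrArg Subtype.val this
    rw [h6, Walk.penultimate_concat]
  have hne : ∀ x y, G.dist b y = G.dist b x + 1 → y ≠ b := by
    rintro x y h rfl
    simp at h
  refine ⟨fun x => (p x).penultimate, fun x hx => ⟨hadj x hx, ?_⟩, fun x y hxy => ?_⟩
  · rcases hG.dist_eq_dist_add_one_of_adj b (hadj x hx) with h | h
    -- If the penultimate vertex were farther from the root than `x`, the geodesic to `x` without
    -- its last edge would be too short to reach it.
    · exfalso
      have h2 := key _ _ (hadj x hx).symm h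
      have h3 : ((p x).dropLast).length + 1 = (p x).length := by
        have := congrArg Walk.length ((p x).concat_dropLast (hadj x hx))
        rwa [Walk.length_concat] at this
      have h4 := G.dist_le (p x).dropLast
      have h5 := hlen x
      omega
    · exact h
  · rcases hG.dist_eq_dist_add_one_of_adj b hxy with h | h
    · exact .inr ⟨hne _ _ h, key _ _ hxy.symm h⟩
    · exact .inl ⟨hne _ _ h, key _ _ hxy h⟩

/-- A path can step towards the root only before its first step away from it: after a descent the
parent has already been visited. Hence a path that never visits the parent of its start descends
throughout. -/
theorem isChain_par {par : V → V} {b : V}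
    (h : ∀ x y, G.Adj x y → (y ≠ b ∧ par y = x) ∨ (x ≠ b ∧ par x = y)) {L : List V} :
    ∀ {x : V}, (x :: L).IsChain G.Adj → (x :: L).Nodup → (x ≠ b → ∀ y ∈ L, y ≠ par x) →
      (x :: L).IsChain fun s t => t ≠ b ∧ par t = s := by
  induction L with
  | nil => intro x _ _ _; exact List.isChain_singleton _
  | cons y L ih =>
    intro x h1 h2 h3
    rw [List.isChain_cons_cons] at h1 ⊢
    rw [List.nodup_cons] at h2
    have h4 : y ≠ b ∧ par y = x := by
      rcases h x y h1.1 with h4 | h4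
      · exact h4
      · exact absurd h4.2.symm (h3 h4.1 y List.mem_cons_self)
    refine ⟨h4, ih h1.2 h2.2 ?_⟩
    rintro - z hz rfl
    rw [h4.2] at hz
    exact h2.1 (List.mem_cons_of_mem _ hz)

/-- If an edge `bc` of a path in a tree is replaced by an edge between the ends of the path, the
result is a tree again, which we root at `b`. -/
theorem IsTree.exists_exchange (hG : G.IsTree) {u v : V} {p : G.Walk u v} (hp : p.IsPath)
    {a b c d : V} (habcd : [a, b, c, d] <:+: p.support) : ∃ (ht : V → ℕ) (par : V → V), ht b = 0 ∧
    (∀ x, x ≠ b → (G.Adj (par x) x ∨ s(u, v) = s(par x, x)) ∧ ht x = ht (par x) + 1) ∧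
    (∀ x y, G.Adj x y ∨ s(u, v) = s(x, y) →
      s(x, y) = s(b, c) ∨ (y ≠ b ∧ par y = x) ∨ (x ≠ b ∧ par x = y)) ∧
    ∃ L : List V, (b :: a :: (L ++ [d, c])).IsChain fun s t => t ≠ b ∧ par t = s := by
  obtain ⟨l₁, l₂, hl⟩ := habcd
  have hnd : (l₁ ++ [a, b, c, d] ++ l₂).Nodup := hl ▸ hp.support_nodup
  have hch : (l₁ ++ [a, b, c, d] ++ l₂).IsChain G.Adj := hl ▸ p.isChain_adj_support
  have hne : s(b, c) ∈ G.edgeSet := by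
    have h1 : [a, b, c, d].IsChain G.Adj := hch.infix ⟨l₁, l₂, rfl⟩
    simp only [List.isChain_cons_cons] at h1
    exact h1.2.1
  -- Deleting bc separates the tree, with one end of the path on each side; the new edge between
  -- these ends joins the two sides again.
  set G' := G.deleteEdges {s(b, c)} with hG'
  have hbridge : ¬ G'.Reachable b c :=
    isAcyclic_iff_forall_adj_isBridge.1 hG.isAcyclic hne
  set L₁ := (l₁ ++ [a, b]) with hL₁
  set L₂ := (c :: d :: l₂) with hL₂
  have hsplit : l₁ ++ [a, b, c, d] ++ l₂ = L₁ ++ L₂ := by simp [hL₁, hL₂]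
  rw [hsplit] at hnd hch hl
  rw [List.isChain_append] at hch
  rw [List.nodup_append] at hnd
  obtain ⟨hnd1, hnd2, hnd12⟩ := hnd
  have hb1 : b ∈ L₁ := by simp [hL₁]
  have hc2 : c ∈ L₂ := by simp [hL₂]
  have hch1 : L₁.IsChain G'.Adj := by
    refine List.IsChain.imp_of_mem_imp ?_ hch.1
    intro x y hx hy hxy
    rw [deleteEdges_adj]
    refine ⟨hxy, fun h => ?_⟩
    have : c ∈ s(x, y) := by rw [h]; simp
    rcases Sym2.mem_iff.1 this with rfl | rfl
    · exact hnd12 _ hx _ hc2 rfl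
    · exact hnd12 _ hy _ hc2 rfl
  have hch2 : L₂.IsChain G'.Adj := by
    refine List.IsChain.imp_of_mem_imp ?_ hch.2.1
    intro x y hx hy hxy
    rw [deleteEdges_adj]
    refine ⟨hxy, fun h => ?_⟩
    have : b ∈ s(x, y) := by rw [h]; simp
    rcases Sym2.mem_iff.1 this with rfl | rfl
    · exact hnd12 _ hb1 _ hx rfl
    · exact hnd12 _ hb1 _ hy rfl
  have hne1 : L₁ ≠ [] := by simp [hL₁]
  have hne2 : L₂ ≠ [] := by simp [hL₂]
  have hhead : L₁.head? = some u := by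
    have h1 : p.support.head? = some u := by
      rw [List.head?_eq_some_head p.support_ne_nil, p.head_support]
    rw [← hl] at h1
    rwa [List.head?_append_of_ne_nil _ hne1] at h1
  have hlast : L₂.getLast? = some v := by
    have h1 : p.support.getLast? = some v := by
      rw [List.getLast?_eq_getLast_of_ne_nil p.support_ne_nil, p.getLast_support]
    rw [← hl] at h1
    rwa [List.getLast?_append_of_ne_nil _ hne2] at h1
  have hu : L₁.head hne1 = u := by
    rw [List.head?_eq_some_head hne1] at hhead
    exact Option.some.inj hhead
  have hv : L₂.getLast hne2 = v := by
    rw [List.getLast?_eq_getLast_of_ne_nil hne2] at hlast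
    exact Option.some.inj hlast
  have hub : G'.Reachable u b := by
    have h1 := (Walk.ofSupport L₁ hne1 hch1).reachable
    have h2 : L₁.getLast hne1 = b := by simp [hL₁]
    rwa [hu, h2] at h1
  have hcv : G'.Reachable c v := by
    have h1 := (Walk.ofSupport L₂ hne2 hch2).reachable
    rwa [hv] at h1
  have huv : ¬ G'.Reachable u v := fun h => hbridge (hub.symm.trans (h.trans hcv.symm))
  have huv' : u ≠ v := fun h => huv (h ▸ .rfl)
  set G₂ := G' ⊔ edge u v with hG₂
  have hG₂adj : ∀ x y, G₂.Adj x y ↔ G'.Adj x y ∨ s(u, v) = s(x, y) ∧ x ≠ y := by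
    intro x y
    rw [hG₂, sup_adj, edge_adj, Sym2.eq_iff]
    constructor
    · rintro (h | ⟨⟨rfl, rfl⟩ | ⟨rfl, rfl⟩, h⟩)
      · exact .inl h
      · exact .inr ⟨.inl ⟨rfl, rfl⟩, h⟩
      · exact .inr ⟨.inr ⟨rfl, rfl⟩, h⟩
    · rintro (h | ⟨⟨rfl, rfl⟩ | ⟨rfl, rfl⟩, h⟩)
      · exact .inl h
      · exact .inr ⟨.inl ⟨rfl, rfl⟩, h⟩
      · exact .inr ⟨.inr ⟨rfl, rfl⟩, h⟩
  have huvadj : G₂.Adj u v := (hG₂adj u v).2 (.inr ⟨rfl, huv'⟩)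
  have htree : G₂.IsTree := by
    refine ⟨@Connected.mk _ _ (fun x y => ?_) hG.connected.nonempty,
      (hG.isAcyclic.anti (deleteEdges_le _)).sup_edge_of_not_reachable huv⟩
    obtain ⟨q⟩ := hG.connected x y
    have hbc : G₂.Reachable b c :=
      (hub.symm.mono le_sup_left).trans (huvadj.reachable.trans (hcv.symm.mono le_sup_left))
    induction q with
    | nil => exact .rfl
    | @cons x y z hxy _ ih =>
      refine Reachable.trans ?_ ih
      by_cases h : s(x, y) = s(b, c)
      · rcases Sym2.eq_iff.1 h with ⟨rfl, rfl⟩ | ⟨rfl, rfl⟩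
        · exact hbc
        · exact hbc.symm
      · exact Adj.reachable
          ((hG₂adj x y).2 (.inl (deleteEdges_adj.2 ⟨hxy, h⟩)))
  obtain ⟨par, hpar, hpar'⟩ := htree.exists_parent b
  obtain ⟨par, hpar, hpar'⟩ := htree.exists_parent b
  -- The cycle without bc: back from b via a to `u`, across the new edge to `v`, then back via d to
  -- c.
  have hLch : (L₁.reverse ++ L₂.reverse).IsChain G₂.Adj := by
    rw [List.isChain_append, List.isChain_reverse, List.isChain_reverse]
    refine ⟨hch1.imp fun x y h => .inl h.symm, hch2.imp fun x y h => .inl h.symm, ?_⟩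
    intro x hx y hy
    rw [List.getLast?_reverse, hhead] at hx
    rw [List.head?_reverse, hlast] at hy
    rw [← Option.some.inj hx, ← Option.some.inj hy]
    exact huvadj
  have hLnd : (L₁.reverse ++ L₂.reverse).Nodup := by
    rw [List.nodup_append, List.nodup_reverse, List.nodup_reverse]
    exact ⟨hnd1, hnd2, fun x hx y hy =>
      hnd12 x (List.mem_reverse.1 hx) y (List.mem_reverse.1 hy)⟩
  have hLeq : L₁.reverse ++ L₂.reverse = b :: a :: ((l₁.reverse ++ l₂.reverse) ++ [d, c]) := by
    simp [hL₁, hL₂]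
  rw [hLeq] at hLch hLnd
  refine ⟨G₂.dist b, par, dist_self, fun x hx => ⟨?_, (hpar x hx).2⟩, fun x y hxy => ?_,
    _, isChain_par hpar' hLch hLnd fun h => absurd rfl h⟩
  · rcases (hG₂adj _ _).1 (hpar x hx).1 with h | h
    · exact .inl (deleteEdges_adj.1 h).1
    · exact .inr h.1
  · by_cases h : s(x, y) = s(b, c)
    · exact .inl h
    · refine .inr (hpar' x y ((hG₂adj x y).2 ?_))
      rcases hxy with h1 | h1
      · exact .inl (deleteEdges_adj.2 ⟨h1, h⟩)
      · refine .inr ⟨h1, ?_⟩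
        rintro rfl
        rcases Sym2.eq_iff.1 h1 with ⟨h2, h3⟩ | ⟨h2, h3⟩
        · exact huv' (h2.trans h3.symm)
        · exact huv' (h2.trans h3.symm)

end SimpleGraph

/-! ### Spanning trees with one further edge, rooted on the cycle. -/

namespace TwoComplex

/-- The graph with edge set `S` consists of a tree, with root `b`, and one further edge `bc`
(possibly several parallel copies of each edge). The parent of a vertex `x` other than `b` is
`par x`, and `ht x` is the distance of `x` from the root. -/
structure Rooted (C : TwoComplex) (S : Set C.Edge) (b c : C.Vertex) where
  ht : C.Vertex → ℕ
  par : C.Vertex → C.Vertex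
  ht_root : ht b = 0
  ht_eq : ∀ x, x ≠ b → ht x = ht (par x) + 1
  exists_dart : ∀ x, x ≠ b → ∃ d : C.Dart, d.1 ∈ S ∧ d.tail = par x ∧ d.head = x
  dart_cases : ∀ d : C.Dart, d.1 ∈ S → (d.tail = b ∧ d.head = c) ∨ (d.tail = c ∧ d.head = b) ∨
    (d.tail ≠ b ∧ d.head = par d.tail) ∨ (d.head ≠ b ∧ d.tail = par d.head)

namespace Rooted

variable {C : TwoComplex} {S : Set C.Edge} {b c : C.Vertex} (R : C.Rooted S b c)

/-- The child of the root whose branch contains `x`. -/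
def root (x : C.Vertex) : C.Vertex := R.par^[R.ht x - 1] x

theorem root_of_par_eq {x : C.Vertex} (hx : x ≠ b) (h : R.par x = b) : R.root x = x := by
  have := R.ht_eq x hx
  rw [h, R.ht_root] at this
  rw [root, this]
  rfl

theorem root_par {x : C.Vertex} (hx : x ≠ b) (h : R.par x ≠ b) : R.root (R.par x) = R.root x := by
  have h1 := R.ht_eq x hx
  have h2 := R.ht_eq _ h
  have h3 : R.ht x - 1 = (R.ht (R.par x) - 1) + 1 := by omega
  rw [root, root, h3, Function.iterate_succ_apply]

end Rooted

variable {C : TwoComplex}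

theorem Dart.sym2_eq (d : C.Dart) : s(C.src d.1, C.tgt d.1) = s(d.tail, d.head) := by
  obtain ⟨e, _ | _⟩ := d
  · exact Sym2.eq_swap
  · rfl

theorem exists_dart_of_sym2_eq {e : C.Edge} {x y : C.Vertex} (h : s(C.src e, C.tgt e) = s(x, y)) :
    ∃ d : C.Dart, d.1 = e ∧ d.tail = x ∧ d.head = y := by
  rcases Sym2.eq_iff.1 h with ⟨h1, h2⟩ | ⟨h1, h2⟩
  · exact ⟨(e, true), rfl, h1, h2⟩
  · exact ⟨(e, false), rfl, h2, h1⟩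

theorem Rooted.root_eq_of_isChain {S : Set C.Edge} {b c : C.Vertex} (R : C.Rooted S b c)
    {L : List C.Vertex} : ∀ {x y : C.Vertex}, x ≠ b →
      (x :: (L ++ [y])).IsChain (fun s t => t ≠ b ∧ R.par t = s) → R.root y = R.root x := by
  induction L with
  | nil =>
    intro x y hx h
    rw [List.nil_append, List.isChain_pair] at h
    obtain ⟨h1, rfl⟩ := h
    exact (R.root_par h1 hx).symm
  | cons z L ih =>
    intro x y hx h
    rw [List.cons_append, List.isChain_cons_cons] at h
    obtain ⟨⟨h1, rfl⟩, h2⟩ := h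
    exact (ih h1 h2).trans (R.root_par h1 hx).symm

/-- The exchanged tree is read in the 2-complex. The descending path from b through a to d and c
shows that d is the parent of c and that c lies in the branch of a. -/
theorem exists_rooted {T : Set C.Edge} (hT : (C.graph T).IsTree)
    (hloop : ∀ e' ∈ T, C.src e' ≠ C.tgt e') {e : C.Edge}
    {p : (C.graph T).Walk (C.src e) (C.tgt e)} (hp : p.IsPath) {a b c d : C.Vertex}
    (habcd : [a, b, c, d] <:+: p.support) :
    ∃ R : C.Rooted (insert e T) b c, R.par c = d ∧ R.par a = b ∧ R.root c = a ∧ a ≠ b ∧ c ≠ b := by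
  obtain ⟨ht, par, h0, h1, h2, L, hL⟩ := hT.exists_exchange hp habcd
  rw [List.isChain_cons_cons] at hL
  obtain ⟨⟨hab, hpa⟩, hL⟩ := hL
  let R : C.Rooted (insert e T) b c :=
    { ht := ht
      par := par
      ht_root := h0
      ht_eq := fun x hx => (h1 x hx).2
      exists_dart := fun x hx => by
        rcases (h1 x hx).1 with ⟨-, e', he', h⟩ | h
        · obtain ⟨d, rfl, h1, h2⟩ := exists_dart_of_sym2_eq h
          exact ⟨d, Set.mem_insert_of_mem _ he', h1, h2⟩
        · obtain ⟨d, h0, h1, h2⟩ := exists_dart_of_sym2_eq h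
          exact ⟨d, h0 ▸ Set.mem_insert _ _, h1, h2⟩
      dart_cases := fun d hd => by
        have h3 : (C.graph T).Adj d.tail d.head ∨ s(C.src e, C.tgt e) = s(d.tail, d.head) := by
          rw [← Dart.sym2_eq]
          rcases hd with hd | hd
          · exact .inr (by rw [hd])
          · refine .inl ⟨fun h => hloop _ hd ?_, _, hd, Dart.sym2_eq d⟩
            rcases Sym2.eq_iff.1 (Dart.sym2_eq d) with ⟨h4, h5⟩ | ⟨h4, h5⟩
            · rw [h4, h5, h]
            · rw [h4, h5, h]
        rcases h2 _ _ h3 with h4 | h4 | h4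
        · rcases Sym2.eq_iff.1 h4 with h4 | h4
          · exact .inl h4
          · exact .inr (.inl h4)
        · exact .inr (.inr (.inr ⟨h4.1, h4.2.symm⟩))
        · exact .inr (.inr (.inl ⟨h4.1, h4.2.symm⟩)) }
  have h3 : [d, c].IsChain fun s t => t ≠ b ∧ par t = s := hL.infix ⟨a :: L, [], by simp⟩
  rw [List.isChain_pair] at h3
  refine ⟨R, h3.2, hpa, ?_, hab, h3.1⟩
  rw [← R.root_of_par_eq hab hpa]
  exact R.root_eq_of_isChain hab (L := L ++ [d]) (by simpa using hL)

end TwoComplex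


/-! ### The links of the contractions of cuboid complexes -/

namespace TwoComplex

variable {C : TwoComplex}

theorem isWalk_head_getLast {l : List C.Dart} {u v : C.Vertex} {d : C.Dart}
    (h : IsWalk C.src C.tgt u l v) (hd : l.getLast? = some d) : d.head = v := by
  obtain ⟨l, rfl⟩ := List.getLast?_eq_some_iff.1 hd
  obtain ⟨m, -, h2⟩ := isWalk_append.1 h
  rw [isWalk_cons] at h2
  exact h2.2

theorem IsFaceWalk.exists_flag {l : List C.Dart} {d : C.Dart} (h : C.IsFaceWalk (d :: l)) :
    ∃ d' ∈ d :: l, d'.head = d.tail ∧ C.Flag d.tail d.head d'.tail (d :: l) := by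
  obtain ⟨u, hu⟩ := h.exists_isWalk
  obtain ⟨d', hd'⟩ : ∃ d', (d :: l).getLast? = some d' :=
    ⟨_, List.getLast?_eq_getLast_of_ne_nil (List.cons_ne_nil d l)⟩
  have h1 : d'.head = d.tail := by
    rw [isWalk_head_getLast hu hd', (isWalk_cons.1 hu).1]
  exact ⟨d', List.mem_of_getLast? hd', h1, h, ⟨d, rfl, rfl, rfl⟩, ⟨d', hd', rfl, h1⟩⟩

theorem IsFaceWalk.exists_next {l : List C.Dart} {d : C.Dart} (h : C.IsFaceWalk (d :: l)) :
    ∃ d' ∈ d :: l, d'.tail = d.head := by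
  obtain ⟨u, hu⟩ := h.exists_isWalk
  rw [isWalk_cons] at hu
  rcases l with _ | ⟨d', l⟩
  · exact ⟨d, List.mem_cons_self, by rw [hu.1]; exact hu.2.symm⟩
  · exact ⟨d', by simp, (isWalk_cons.1 hu.2).1⟩

theorem exists_isRotated_cons {α : Type*} {l : List α} {a : α} (h : a ∈ l) :
    ∃ l', a :: l' ~r l := by
  obtain ⟨s, t, rfl⟩ := List.append_of_mem h
  exact ⟨t ++ s, (List.isRotated_append (l := s) (l' := a :: t)).symm⟩

end TwoComplex

/-! ### Branches as connected pieces of the contracted link, and the K₃,₃ at the root. -/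

namespace Cuboid

open TwoComplex

variable {N : Fin 3 → ℕ} {D : Subdivision N} {S : Set (subdivided N D).Edge} {b c : Vertex N}

theorem GridAdj.symm {i : Fin 3} {w y : Vertex N} (h : GridAdj i w y) : GridAdj i y w :=
  ⟨fun k hk => (h.1 k hk).symm, h.2.symm⟩

theorem GridAdj.ne_apply {i : Fin 3} {w y : Vertex N} (h : GridAdj i w y) : y.1 i ≠ w.1 i := by
  have := h.2
  omega

/-- The edges in `S` form a graph with exactly one cycle. This cycle contains the edge `bc`, and
the next edge is diagonal and points in the same direction. -/
structure Branches (N : Fin 3 → ℕ) (D : Subdivision N) (S : Set (subdivided N D).Edge)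
    (b c : Vertex N) extends (subdivided N D).Rooted S b c where
  one_le : ∀ i, 1 ≤ N i
  diag_mem : ∀ x : DiagEdge D, Sum.inr x ∈ S
  diagAdj : DiagAdj D b c
  ne_root : c ≠ b
  line : ∀ k, (par c).1 k + b.1 k = c.1 k + c.1 k

namespace Branches

variable (R : Branches N D S b c)

/-- The vertex `y` is neither the parent of `w`, nor is `wy` the edge `cb`. -/
def Away (w y : Vertex N) : Prop := y ≠ R.par w ∧ ¬ (w = c ∧ y = b)

/-- By collinearity the parent of c is displaced from b by twice the vector from b to c, so some
coordinate differs by 2. -/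
theorem not_near {y : Vertex N} (hy : y = R.par c) (hne : y ≠ b)
    (h : ∀ k, y.1 k ≤ b.1 k + 1 ∧ b.1 k ≤ y.1 k + 1) : False := by
  subst hy
  refine hne (vertex_ext fun k => ?_)
  have h1 := R.line k
  have h2 := h k
  omega

theorem par_eq_of_away {d : (subdivided N D).Dart} (hd : d.1 ∈ S) (hb : d.tail ≠ b)
    (ha : R.Away d.tail d.head) : d.head ≠ b ∧ R.par d.head = d.tail := by
  rcases R.dart_cases d hd with h | h | h | h
  · exact absurd h.1 hb
  · exact absurd h ha.2
  · exact absurd h.2 ha.1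
  · exact ⟨h.1, h.2.symm⟩

theorem par_eq_of_tail_eq {d : (subdivided N D).Dart} (hd : d.1 ∈ S) (hb : d.tail = b)
    (hc : d.head ≠ c) : d.head ≠ b ∧ R.par d.head = b := by
  rcases R.dart_cases d hd with h | h | h | h
  · exact absurd h.2 hc
  · exact absurd (h.1.symm.trans hb) R.ne_root
  · exact absurd hb h.1
  · exact ⟨h.1, h.2.symm.trans hb⟩

theorem ht_lt {w : Vertex N} (hw : w ≠ b) : R.ht (R.par w) < R.ht w := by
  have := R.ht_eq w hw
  omega

/-- No face has all its edges in `S`. -/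
theorem exists_notMem (R : Branches N D S b c) {l : List (subdivided N D).Dart}
    (hl : (subdivided N D).IsFaceWalk l) :
    ∃ d ∈ l, d.1 ∉ S := by
  by_contra! hS
  obtain ⟨hlen, -⟩ := isFaceWalk_corners hl
  have hne : l ≠ [] := by
    rintro rfl
    simp at hlen
  -- At a vertex of greatest height on such a face, each neighbour along the face is the parent, or
  -- is b if the vertex is c. The two neighbours differ, so they would be b and the parent of c,
  -- which are too far apart.
  obtain ⟨d, hd, hmax⟩ : ∃ d ∈ l, ∀ d' ∈ l, R.ht d'.tail ≤ R.ht d.tail :=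
    Set.exists_max_image {x | x ∈ l} (fun d => R.ht d.tail) (List.finite_toSet l)
      (List.exists_mem_of_ne_nil l hne)
  obtain ⟨l', hl'⟩ := exists_isRotated_cons hd
  have hw := hl.of_isRotated hl'
  obtain ⟨d₁, hd₁, h1, hF⟩ := hw.exists_flag
  obtain ⟨d₂, hd₂, h2⟩ := hw.exists_next
  have h3 := hmax d₁ (hl'.mem_iff.1 hd₁)
  have h4 := hmax d₂ (hl'.mem_iff.1 hd₂)
  rw [h2] at h4
  have key : ∀ d' : (subdivided N D).Dart, d'.1 ∈ S → d'.tail = d.tail →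
      R.ht d'.head ≤ R.ht d.tail → (d.tail = c ∧ d'.head = b) ∨ d'.head = R.par d.tail := by
    intro d' hd' h5 h6
    rcases R.dart_cases d' hd' with h | h | h | h
    · rw [← h5, h.1, h.2, R.ht_root] at h6
      have := R.ht_lt R.ne_root
      omega
    · exact .inl ⟨h5.symm.trans h.1, h.2⟩
    · exact .inr (by rw [h.2, h5])
    · have := R.ht_lt h.1
      rw [← h.2, h5] at this
      omega
  have h5 := key d (hS d hd) rfl h4
  have h6 := key d₁.rev (hS d₁ (hl'.mem_iff.1 hd₁)) (by simpa using h1) (by simpa using h3)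
  rw [Dart.head_rev] at h6
  have h7 := flag_ne hF
  have h8 := flag_near hF
  rcases h5 with ⟨h5, h5'⟩ | h5 <;> rcases h6 with ⟨h6, h6'⟩ | h6
  · exact h7 (h5'.trans h6'.symm)
  · rw [h5] at h6
    rw [h5'] at h7
    exact R.not_near h6 h7.symm fun k => h5' ▸ (h8 k).symm
  · rw [h6] at h5
    rw [h6'] at h7
    exact R.not_near h5 h7 fun k => h6' ▸ h8 k
  · exact h7 (h5.trans h6.symm)

theorem exists_first (R : Branches N D S b c) {l : List (subdivided N D).Dart}
    (hl : (subdivided N D).IsFaceWalk l) :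
    ∃ h, first S l = some h := by
  obtain ⟨d, hd, hS⟩ := R.exists_notMem hl
  exact ⟨_, List.head?_eq_some_head (List.ne_nil_of_mem (mem_keep.2 ⟨hd, hS⟩))⟩

theorem mem_of_diagAdj (R : Branches N D S b c) {d : (subdivided N D).Dart}
    (h : DiagAdj D d.tail d.head) : d.1 ∈ S := by
  rcases dart_cases d with ⟨g, i, -, h2⟩ | ⟨x, h1, -⟩
  · exact absurd h2 (not_gridAdj_of_diagAdj h)
  · rw [h1]
    exact R.diag_mem x

/-- Parallel diagonals need not be excluded, since all diagonals are contracted. -/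
theorem dart_eq_or_mem (R : Branches N D S b c) {d d' : (subdivided N D).Dart}
    (ht : d.tail = d'.tail) (hh : d.head = d'.head) : d = d' ∨ d.1 ∈ S ∧ d'.1 ∈ S := by
  rcases dart_eq_or_diag ht hh with h | ⟨x, x', h1, h2⟩
  · exact .inl h
  · rw [h1, h2]
    exact .inr ⟨R.diag_mem x, R.diag_mem x'⟩

/-- The first dart outside `S` of a face walk, if the first dart lies in `S`. -/
theorem first_rotate {w y y' : Vertex N} {d : (subdivided N D).Dart}
    {l : List (subdivided N D).Dart} (h : (subdivided N D).Flag w y y' (d :: l)) (hd : d.1 ∈ S) :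
    ∃ z l', (subdivided N D).Flag y z w l' ∧ first S l' = first S (d :: l) := by
  obtain ⟨hlen, -⟩ := isFaceWalk_corners h.1
  rcases l with _ | ⟨d', l⟩
  · simp at hlen
  refine ⟨d'.head, _, h.rotate.1, ?_⟩
  rw [first, first, keep_cons_of_mem hd, keep_append, keep_cons_of_mem hd]
  simp [keep]

open scoped Classical in
/-- The branch to which a dart belongs. -/
noncomputable def colour (d : (subdivided N D).Dart) : Vertex N :=
  if d.tail = b then d.head else R.root d.tail

/-- In the link graph of the complex obtained by contracting `S`, the face walks which start with
a dart from `w` to `y` are joined inside `V` to those which start with a dart from `w` to `y'`. -/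
def Linked (S : Set (subdivided N D).Edge) (V : Set (subdivided N D).Dart) (w y y' : Vertex N) :
    Prop :=
  ∀ z l h z' l' h', (subdivided N D).Flag w y z l → first S l = some h →
    (subdivided N D).Flag w y' z' l' → first S l' = some h' →
    (subdivided N D).ContractLinkConnected S V h h'

section Linked

variable {V V' : Set (subdivided N D).Dart} {w y y' y'' : Vertex N}

theorem Linked.mono (hV : V ⊆ V') (h : Linked S V w y y') : Linked S V' w y y' :=
  fun z l f z' l' f' h1 h2 h3 h4 => (h z l f z' l' f' h1 h2 h3 h4).mono hV

theorem Linked.symm (h : Linked S V w y y') : Linked S V w y' y :=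
  fun z l f z' l' f' h1 h2 h3 h4 => (h z' l' f' z l f h3 h4 h1 h2).symm

/-- `Linked` holds vacuously if no face walk starts towards the vertex, so transitivity needs a face
at the middle one. -/
theorem Linked.trans (R : Branches N D S b c) (h : Linked S V w y y') (h' : Linked S V w y' y'')
    (hy' : ∃ z, Corner D w y' z) : Linked S V w y y'' := by
  intro z l f z' l' f' h1 h2 h3 h4
  obtain ⟨z'', l'', hl''⟩ := hy'
  obtain ⟨f'', hf''⟩ := R.exists_first hl''.1
  exact (h _ _ _ _ _ _ h1 h2 hl'' hf'').trans (h' _ _ _ _ _ _ hl'' hf'' h3 h4)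

/-- The face walk at this corner and its reverse start towards `y` and `y'`, and their first
uncontracted darts are adjacent in the contracted link. The self-links place these darts in `V`. -/
theorem linked_of_corner (R : Branches N D S b c) (h : Corner D w y y') (hy : Linked S V w y y)
    (hy' : Linked S V w y' y') : Linked S V w y y' := by
  intro z l f z' l' f' h1 h2 h3 h4
  obtain ⟨l'', hl''⟩ := h
  obtain ⟨g, hg⟩ := R.exists_first hl''.1
  obtain ⟨g', hg'⟩ := R.exists_first hl''.revWalk.1
  have h5 := hy _ _ _ _ _ _ h1 h2 hl'' hg
  have h6 := hy' _ _ _ _ _ _ hl''.revWalk hg' h3 h4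
  exact h5.trans ((ContractLinkConnected.of_faceWalk hl''.1 hg' hg h6.1.1 h5.right_mem.1).symm.trans
    h6)

end Linked

theorem exists_axis_ne : ∀ i j : Fin 3, ∃ k, k ≠ i ∧ k ≠ j := by decide

theorem exists_corner_of_gridAdj (R : Branches N D S b c) {i : Fin 3} {w y : Vertex N}
    (h : GridAdj i w y) : ∃ z, Corner D w y z := by
  obtain ⟨j, hj, -⟩ := exists_axis_ne i i
  obtain ⟨y', hy'⟩ := exists_gridAdj (R.one_le j) w
  obtain ⟨x, -, h1 | h1⟩ := exists_quad D hj.symm h hy'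
  · exact ⟨_, h1⟩
  · exact ⟨_, h1.2.1⟩

theorem exists_corner_of_diagAdj {w x : Vertex N} (h : DiagAdj D w x) : ∃ z, Corner D w x z := by
  obtain ⟨i, j, y, y', -, -, -, -, h1, -⟩ := h.exists_corners
  exact ⟨y, h1.symm⟩

/-- Of the neighbours of a vertex, all those in two of the directions are away from the root. -/
theorem exists_axes (R : Branches N D S b c) {w : Vertex N} (hw : w ≠ b) :
    ∃ i j, i ≠ j ∧ (∀ y, GridAdj i w y ∨ GridAdj j w y → R.Away w y) ∧
      ∀ x, DiagAdj D w x → x.1 i ≠ w.1 i → R.Away w x := by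
  have hcb : ∀ {i}, ¬ GridAdj i c b := fun h => not_gridAdj_of_diagAdj R.diagAdj h.symm
  obtain ⟨d, hd, hd1, hd2⟩ := R.exists_dart w hw
  rcases Cuboid.dart_cases d with ⟨-, i₀, -, h⟩ | ⟨-, -, h⟩
  · rw [hd1, hd2] at h
    -- The parent is a grid neighbour, so the other two axes serve. Here `w` is not c: by
    -- collinearity the diagonal edge cb would otherwise be a grid edge.
    obtain ⟨i, hi, -⟩ := exists_axis_ne i₀ i₀
    obtain ⟨j, hj, hji⟩ := exists_axis_ne i₀ i
    have hgrid : ∀ {k} {y : Vertex N}, k ≠ i₀ → GridAdj k w y → R.Away w y := by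
      intro k y hk hy
      refine ⟨?_, ?_⟩
      · rintro rfl
        exact hy.ne_apply (h.1 k hk).symm
      · rintro ⟨rfl, rfl⟩
        exact hcb hy
    refine ⟨i, j, hji.symm, fun y hy => hy.elim (hgrid hi) (hgrid hj), fun x hx _ => ⟨?_, ?_⟩⟩
    · rintro rfl
      exact not_gridAdj_of_diagAdj hx h.symm
    · rintro ⟨rfl, rfl⟩
      refine hcb (i := i₀) ⟨fun k hk => ?_, ?_⟩
      · have h1 := R.line k
        have h2 := h.1 k hk
        omega
      · have h1 := R.line i₀
        have h2 := h.2
        omega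
  · rw [hd1, hd2] at h
    obtain ⟨i₁, j₁, y₁, y₁', hij, h1, h2, h3, -⟩ := h.symm.exists_corners
    -- The parent is a diagonal neighbour, so every grid neighbour leads away. The first axis is
    -- taken perpendicular to the plane of the diagonal; when `w` is c, that plane also contains b.
    obtain ⟨i, hi, hj⟩ := exists_axis_ne i₁ j₁
    have hpar : (R.par w).1 i = w.1 i := by
      have h4 := h3 i
      rw [h1.1 i hi, h2.1 i hj] at h4
      omega
    have hgrid : ∀ {k} {y : Vertex N}, GridAdj k w y → R.Away w y := by
      intro k y hy
      refine ⟨?_, ?_⟩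
      · rintro rfl
        exact not_gridAdj_of_diagAdj h.symm hy
      · rintro ⟨rfl, rfl⟩
        exact hcb hy
    refine ⟨i, i₁, hi, fun y hy => hy.elim hgrid hgrid, fun x _ hx => ⟨?_, ?_⟩⟩
    · rintro rfl
      exact hx hpar
    · rintro ⟨rfl, rfl⟩
      have h1 := R.line i
      omega

theorem colour_of_ne {d : (subdivided N D).Dart} (h : d.tail ≠ b) : R.colour d = R.root d.tail :=
  if_neg h

theorem colour_of_eq {d : (subdivided N D).Dart} (h : d.tail = b) : R.colour d = d.head :=
  if_pos h

/-- The darts of the branch of `r`. -/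
def branch (r : Vertex N) : Set (subdivided N D).Dart := {d | R.colour d = r}

/-- All face walks at `w` which start with a dart that leads away from the root are joined in the
link graph. -/
def Joined (w : Vertex N) : Prop :=
  ∀ y y', R.Away w y → R.Away w y' → Linked S (R.branch (R.root w)) w y y'

theorem flag_cons {w y y' : Vertex N} {l : List (subdivided N D).Dart}
    (h : (subdivided N D).Flag w y y' l) : ∃ d l', l = d :: l' ∧ d.tail = w ∧ d.head = y := by
  obtain ⟨-, ⟨d, h1, h2, h3⟩, -⟩ := h
  obtain ⟨l', rfl⟩ := List.head?_eq_some_iff.1 h1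
  exact ⟨d, l', rfl, h2, h3⟩

/-- Face walks which start with a dart from `w` to `y` are joined if the dart lies in `S` and the
claim holds at `y`, or the dart does not lie in `S`. -/
theorem linked_self (R : Branches N D S b c) {V : Set (subdivided N D).Dart} {w y : Vertex N}
    (hmem : ∀ d : (subdivided N D).Dart, d.tail = w → d.head = y → d.1 ∈ S → R.Joined y ∧
      R.branch (R.root y) ⊆ V ∧ ∀ z l, (subdivided N D).Flag y z w l → R.Away y z)
    (hnot : ∀ d : (subdivided N D).Dart, d.tail = w → d.head = y → d.1 ∉ S → d ∈ V) :
    Linked S V w y y := by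
  intro z l h z' l' h' hl hh hl' hh'
  obtain ⟨d, l, rfl, h1, h2⟩ := flag_cons hl
  obtain ⟨d', l', rfl, h1', h2'⟩ := flag_cons hl'
  by_cases hd : d.1 ∈ S
  · have hd' : d'.1 ∈ S := by
      rcases R.dart_eq_or_mem (h1.trans h1'.symm) (h2.trans h2'.symm) with h | h
      · exact h ▸ hd
      · exact h.2
    obtain ⟨hy, hV, ha⟩ := hmem d h1 h2 hd
    obtain ⟨u, m, hm, hm'⟩ := first_rotate hl hd
    obtain ⟨u', m', hn, hn'⟩ := first_rotate hl' hd'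
    exact (hy u u' (ha _ _ hm) (ha _ _ hn) _ _ _ _ _ _ hm (hm'.trans hh) hn
      (hn'.trans hh')).mono hV
  · obtain rfl : d = d' := by
      rcases R.dart_eq_or_mem (h1.trans h1'.symm) (h2.trans h2'.symm) with h | h
      · exact h
      · exact absurd h.1 hd
    have key : ∀ {l h}, first S (d :: l) = some h → h = d := fun hh => by
      rw [first, keep_cons_of_notMem hd] at hh
      exact (Option.some.inj hh).symm
    rw [key hh, key hh']
    exact .refl (hnot d h1 h2 hd) hd

/-- The face gives `y` different neighbours `z` and `w`, so `z` is not the parent. Nor is it b when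
`y` is c, since b and the parent of c share no face. -/
theorem away_of_flag {w y z : Vertex N} {l : List (subdivided N D).Dart}
    (h : (subdivided N D).Flag y z w l) (hw : R.par y = w) : R.Away y z := by
  refine ⟨fun h1 => flag_ne h (h1.trans hw), ?_⟩
  rintro ⟨rfl, rfl⟩
  refine R.not_near hw.symm (fun h1 => flag_ne h h1.symm) fun k => (flag_near h k).symm

/-- A contracted edge to a child replaces a link vertex by the piece already joined at the child;
other edges remain single link vertices. It remains to connect the link of `w` without the
directions that are not away from the root. -/
theorem joined_of_children (R : Branches N D S b c) {w : Vertex N} (hw : w ≠ b)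
    (ih : ∀ y, y ≠ b → R.par y = w → R.Joined y) : R.Joined w := by
  set V := R.branch (R.root w)
  have hself : ∀ y, R.Away w y → Linked S V w y y := by
    intro y hy
    refine R.linked_self (fun d h1 h2 hd => ?_) fun d h1 h2 hd => ?_
    · obtain ⟨h3, h4⟩ := R.par_eq_of_away hd (h1 ▸ hw) (by rwa [h1, h2])
      rw [h2] at h3 h4
      rw [h1] at h4
      refine ⟨ih y h3 h4, ?_, fun z l hl => R.away_of_flag hl h4⟩
      rw [← R.root_par h3 (h4 ▸ hw), h4]
    · exact (R.colour_of_ne (h1 ▸ hw)).trans (by rw [h1])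
  obtain ⟨i, j, hij, hax, hdiag⟩ := R.exists_axes hw
  obtain ⟨q, hq⟩ := exists_gridAdj (R.one_le i) w
  obtain ⟨p, hp⟩ := exists_gridAdj (R.one_le j) w
  have hqa := hax q (.inl hq)
  have hpa := hax p (.inr hp)
  -- Neighbours on axis `i` are joined to those on other axes through a square; a diagonal in
  -- between changes coordinate `i` and hence leads away too. Neighbours on axis `i` are joined to
  -- each other through `p`.
  have hgrid : ∀ {m y q}, m ≠ i → GridAdj m w y → R.Away w y → GridAdj i w q →
      Linked S V w y q := by
    intro m y q hm hy hya hq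
    have hqa := hax q (.inl hq)
    obtain ⟨x, hx, h | ⟨h1, h2, h3⟩⟩ := exists_quad D hm hy hq
    · exact linked_of_corner R h (hself y hya) (hself q hqa)
    · have hxa : R.Away w x := hdiag x h1 fun h => by
        have h4 := hx i
        rw [hy.1 i hm.symm] at h4
        have := hq.ne_apply
        omega
      exact (linked_of_corner R h2 (hself y hya) (hself x hxa)).trans R
        (linked_of_corner R h3 (hself x hxa) (hself q hqa)) ⟨_, h3⟩
  have hgrid' : ∀ {m y}, GridAdj m w y → R.Away w y → Linked S V w y q := by
    intro m y hy hya
    by_cases hm : m = i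
    · subst hm
      exact (hgrid hij.symm hp hpa hy).symm.trans R (hgrid hij.symm hp hpa hq)
        (R.exists_corner_of_gridAdj hp)
    · exact hgrid hm hy hya hq
  have hall : ∀ {y z l}, (subdivided N D).Flag w y z l → R.Away w y → Linked S V w y q := by
    intro y z l hl hya
    obtain ⟨d, l, rfl, rfl, rfl⟩ := flag_cons hl
    rcases Cuboid.dart_cases d with ⟨-, m, -, h⟩ | ⟨-, -, h⟩
    · exact hgrid' h hya
    · obtain ⟨i₁, j₁, y₁, y₁', hij₁, h1, h2, -, h3, h4⟩ := h.exists_corners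
      have hb : ∀ {m y}, GridAdj m d.tail y → y ≠ R.par d.tail → R.Away d.tail y := by
        intro m y hy hne
        refine ⟨hne, fun h => ?_⟩
        rw [h.1, h.2] at hy
        exact not_gridAdj_of_diagAdj R.diagAdj hy.symm
      -- A diagonal has two grid neighbours beside it in the link, and at most one of them is the
      -- parent.
      by_cases h5 : y₁ = R.par d.tail
      · have h6 : y₁' ≠ R.par d.tail := by
          rintro h6
          rw [← h6] at h5
          subst h5
          exact h1.ne_apply (h2.1 _ hij₁)
        have h7 := hb h2 h6
        exact (linked_of_corner R h4 (hself _ hya) (hself _ h7)).trans R (hgrid' h2 h7)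
          (R.exists_corner_of_gridAdj h2)
      · have h7 := hb h1 h5
        exact (linked_of_corner R h3.symm (hself _ hya) (hself _ h7)).trans R (hgrid' h1 h7)
          (R.exists_corner_of_gridAdj h1)
  intro y y' hy hy' z l h z' l' h' hl hh hl' hh'
  exact (hall hl hy).trans R (hall hl' hy').symm (R.exists_corner_of_gridAdj hq) z l h z' l' h'
    hl hh hl' hh'

/-- Induction from the greatest height downwards, which is well-founded as there are finitely many
vertices. -/
theorem joined {w : Vertex N} (hw : w ≠ b) : R.Joined w := by
  have hfin : Finite (Vertex N) := Set.Finite.to_subtype (Set.finite_Iic N)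
  have hwf : WellFounded fun x y : Vertex N => R.ht y < R.ht x :=
    @Finite.wellFounded_of_trans_of_irrefl _ hfin _ ⟨fun x y z h1 h2 => h2.trans h1⟩
      ⟨fun x => lt_irrefl _⟩
  induction w using hwf.induction with
  | _ w ih =>
    refine R.joined_of_children hw fun y hy hyw => ih y ?_ hy
    rw [← hyw]
    exact R.ht_lt hy

/-- The first darts outside `S` of the face walks at `w` which lead away from the root. -/
def IsFirst (w : Vertex N) (h : (subdivided N D).Dart) : Prop :=
  ∃ y z l, R.Away w y ∧ (subdivided N D).Flag w y z l ∧ first S l = some h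

/-- Rotating a face walk that starts with the contracted edge from the parent to `w` does not change
its first uncontracted dart, so the pieces at both vertices share it. -/
theorem exists_isFirst_par {w : Vertex N} (hw : w ≠ b) (hp : R.par w ≠ b) :
    ∃ h, R.IsFirst w h ∧ R.IsFirst (R.par w) h := by
  obtain ⟨d, hd, hd1, hd2⟩ := R.exists_dart w hw
  obtain ⟨z, l, hl⟩ : ∃ z, Corner D (R.par w) w z := by
    rcases Cuboid.dart_cases d with ⟨-, m, -, h⟩ | ⟨-, -, h⟩
    · rw [hd1, hd2] at h
      exact R.exists_corner_of_gridAdj h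
    · rw [hd1, hd2] at h
      exact exists_corner_of_diagAdj h
  obtain ⟨h, hh⟩ := R.exists_first hl.1
  obtain ⟨d', l, rfl, h1, h2⟩ := flag_cons hl
  have hd' : d'.1 ∈ S := by
    rcases R.dart_eq_or_mem (hd1.trans h1.symm) (hd2.trans h2.symm) with h | h
    · exact h ▸ hd
    · exact h.2
  obtain ⟨u, m, hm, hm'⟩ := first_rotate hl hd'
  refine ⟨h, ⟨u, _, m, R.away_of_flag hm rfl, hm, hm'.trans hh⟩, w, z, _,
    ⟨fun h => ?_, fun h => hw h.2⟩, hl, hh⟩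
  have h3 := R.ht_lt hw
  have h4 := R.ht_lt hp
  rw [← h] at h4
  omega

/-- The joined pieces at successive ancestors overlap, so the way up to the child of the root stays
connected and within the branch. -/
theorem connected_of_isFirst {w : Vertex N} (hw : w ≠ b) {h h' : (subdivided N D).Dart}
    (hh : R.IsFirst w h) (hh' : R.IsFirst (R.root w) h') :
    (subdivided N D).ContractLinkConnected S (R.branch (R.root w)) h h' := by
  induction hn : R.ht w generalizing w h with
  | zero =>
    have := R.ht_lt hw
    omega
  | succ n ih =>
    obtain ⟨y, z, l, hy, hl, hf⟩ := hh
    by_cases hp : R.par w = b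
    · rw [R.root_of_par_eq hw hp] at hh'
      obtain ⟨y', z', l', hy', hl', hf'⟩ := hh'
      exact R.joined hw y y' hy hy' _ _ _ _ _ _ hl hf hl' hf'
    · obtain ⟨g, ⟨y', z', l', hy', hl', hf'⟩, hg⟩ := R.exists_isFirst_par hw hp
      refine (R.joined hw y y' hy hy' _ _ _ _ _ _ hl hf hl' hf').trans ?_
      rw [← R.root_par hw hp]
      refine ih hp hg (by rwa [R.root_par hw hp]) ?_
      have := R.ht_eq w hw
      omega

theorem linked_self_root (R : Branches N D S b c) {y : Vertex N} (hy : y ≠ c) :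
    Linked S (R.branch y) b y y := by
  refine R.linked_self (fun d h1 h2 hd => ?_) fun d h1 h2 hd => ?_
  · obtain ⟨h3, h4⟩ := R.par_eq_of_tail_eq hd h1 (h2 ▸ hy)
    rw [h2] at h3 h4
    refine ⟨R.joined h3, ?_, fun z l hl => R.away_of_flag hl h4⟩
    rw [R.root_of_par_eq h3 h4]
  · exact (R.colour_of_eq h1).trans h2

theorem isFirst_of_flag (R : Branches N D S b c) {y z : Vertex N}
    {l : List (subdivided N D).Dart} {h : (subdivided N D).Dart} (hy : DiagAdj D b y)
    (hl : (subdivided N D).Flag b y z l) (hh : first S l = some h)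
    (ha : ∀ u m, (subdivided N D).Flag y u b m → R.Away y u) : R.IsFirst y h := by
  obtain ⟨d, l, rfl, h1, h2⟩ := flag_cons hl
  obtain ⟨u, m, hm, hm'⟩ := first_rotate hl (R.mem_of_diagAdj (by rwa [h1, h2]))
  exact ⟨u, b, m, ha _ _ hm, hm, hm'.trans hh⟩

/-- The edge bc is contracted but is not a tree edge. A face containing it continues at c neither
back to b nor to the parent of c, by collinearity. -/
theorem isFirst_of_flag_cycle (R : Branches N D S b c) {z : Vertex N}
    {l : List (subdivided N D).Dart} {h : (subdivided N D).Dart}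
    (hl : (subdivided N D).Flag b c z l) (hh : first S l = some h) : R.IsFirst c h := by
  refine R.isFirst_of_flag R.diagAdj hl hh fun u m hm => ⟨fun h => ?_, fun h => ?_⟩
  · exact R.not_near h (flag_ne hm) (flag_near hm)
  · exact flag_ne hm h.2

/-- This is the effect of contracting the cycle: as c lies in the branch of a, the opposite points a
and c of the link at b are joined inside that branch. -/
theorem linked_root (R : Branches N D S b c) {a : Vertex N} (hba : DiagAdj D b a)
    (hpa : R.par a = b) (hca : R.root c = a) :
    Linked S (R.branch a) b c a ∧ Linked S (R.branch a) b c c := by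
  have h1 : Linked S (R.branch a) b c a := by
    intro z l h z' l' h' hl hh hl' hh'
    have h1 := R.isFirst_of_flag hba hl' hh' fun u m hm => R.away_of_flag hm hpa
    rw [← hca] at h1 ⊢
    exact R.connected_of_isFirst R.ne_root (R.isFirst_of_flag_cycle hl hh) h1
  exact ⟨h1, h1.trans R h1.symm (exists_corner_of_diagAdj hba)⟩

/-- A branch is contained in the union of any set of branches to which it belongs. -/
theorem branch_subset {r : Vertex N} {P : Set (Vertex N)} (h : r ∈ P) :
    R.branch r ⊆ {d | R.colour d ∈ P} := by
  intro d hd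
  rwa [Set.mem_ofPred_eq, show R.colour d = r from hd]

/-- The link graph of the complex obtained by contracting `S` has a minor `K₃,₃`. -/
theorem exists_linked (R : Branches N D S b c) {a : Vertex N} (hb : IsInterior b)
    (hba : DiagAdj D b a) (hline : ∀ k, a.1 k + c.1 k = b.1 k + b.1 k)
    (hpa : R.par a = b) (hca : R.root c = a) :
    ∃ (P : Fin 3 → Set (Vertex N)) (A B : Fin 3 → Vertex N), B.Injective ∧
      (∀ i i', i ≠ i' → Disjoint (P i) (P i')) ∧ (∀ i j, B j ∉ P i) ∧
      (∀ i, ∃ z, Corner D b (A i) z) ∧ (∀ j, ∃ z, Corner D b (B j) z) ∧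
      ∀ i j, Linked S {d | R.colour d ∈ insert (B j) (P i)} b (A i) (B j) := by
  -- In the octahedron at b, the vertex a lies on the edge between `y` and `u`, the vertex c on the
  -- opposite edge, which ends at `v`, and `p`, `q` are the poles on the remaining axis `k`.
  obtain ⟨i, j, y, u, hij, hy, hu, hsum, hcy, hcu⟩ := hba.exists_corners
  obtain ⟨m, m', v, v', hmm, hv, hv', hsum', hcv, -⟩ := R.diagAdj.exists_corners
  obtain ⟨k, hki, hkj⟩ := exists_axis_ne i j
  obtain ⟨p, hp, hp'⟩ := exists_gridAdj_add hb k
  obtain ⟨q, hq, hq'⟩ := exists_gridAdj_sub hb k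
  have hyk := hy.1 k hki
  have huk := hu.1 k hkj
  have hak : a.1 k = b.1 k := by have := hsum k; omega
  have hck : c.1 k = b.1 k := by have := hline k; omega
  have hmk : k ≠ m := by
    rintro rfl
    have h1 := hsum' k
    rw [hv'.1 k hmm] at h1
    have := hv.ne_apply
    omega
  have hvk := hv.1 k hmk
  have hyu : y ≠ u := fun h => hy.ne_apply (h ▸ hu.1 i hij)
  have hyv : y ≠ v := by
    rintro rfl
    have him : i = m := by
      by_contra him
      exact hy.ne_apply (hv.1 i him)
    subst him
    have h1 := hsum i
    have h2 := hsum' i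
    rw [hu.1 i hij] at h1
    rw [hv'.1 i hmm] at h2
    have h3 := hline i
    have := hy.ne_apply
    omega
  have huv : u ≠ v := by
    rintro rfl
    have hjm : j = m := by
      by_contra hjm
      exact hu.ne_apply (hv.1 j hjm)
    subst hjm
    have h1 := hsum j
    have h2 := hsum' j
    rw [hy.1 j hij.symm] at h1
    rw [hv'.1 j hmm] at h2
    have h3 := hline j
    have := hu.ne_apply
    omega
  have hself : ∀ {z : Vertex N} {Q : Set (Vertex N)}, z ≠ c → z ∈ Q →
      Linked S {d | R.colour d ∈ Q} b z z :=
    fun hz hQ => (R.linked_self_root hz).mono (R.branch_subset hQ)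
  have hgrid : ∀ {n : Fin 3} {z : Vertex N}, GridAdj n b z → z ≠ c ∧ z ≠ a := by
    refine fun hz => ⟨?_, ?_⟩
    · rintro rfl
      exact not_gridAdj_of_diagAdj R.diagAdj hz
    · rintro rfl
      exact not_gridAdj_of_diagAdj hba hz
  have hacne : a ≠ c := by
    rintro rfl
    refine R.ne_root (vertex_ext fun n => ?_)
    have := hline n
    omega
  -- A pole is joined to an equatorial grid neighbour through a square. Any diagonal in between has
  -- the same coordinate `k` as the pole, so it belongs to the class of that pole.
  have hopp : ∀ {n : Fin 3} {z w : Vertex N} {Q : Set (Vertex N)}, k ≠ n → GridAdj k b z →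
      GridAdj n b w → (∀ x : Vertex N, x.1 k = z.1 k → x ∈ Q) → w ∈ Q →
      Linked S {d | R.colour d ∈ Q} b z w := by
    intro n z w Q hn hz hw hQ hwQ
    have h1 := hself (hgrid hz).1 (hQ z rfl)
    have h2 := hself (hgrid hw).1 hwQ
    obtain ⟨x, hx, h | ⟨-, h3, h4⟩⟩ := exists_quad D hn hz hw
    · exact linked_of_corner R h h1 h2
    · have hxk : x.1 k = z.1 k := by
        have := hx k
        rw [hw.1 k hn] at this
        omega
      have h5 := hself (Q := Q) (z := x) (by
        rintro rfl
        exact hz.ne_apply (hxk.symm.trans hck)) (hQ x hxk)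
      exact (linked_of_corner R h3 h1 h5).trans R (linked_of_corner R h4 h5 h2) ⟨_, h4⟩
  obtain ⟨hlca, hlcc⟩ := R.linked_root hba hpa hca
  -- The first side consists of the two poles, each with all colours at its level, and of the branch
  -- of a. That branch meets `y` and `u` at a, and `v` at c.
  refine ⟨![{x | x.1 k = b.1 k + 1}, {x | x.1 k + 1 = b.1 k}, {a}], ![p, q, a], ![y, u, v],
    ?_, ?_, ?_, ?_, ?_, ?_⟩
  · intro n n' h
    fin_cases n <;> fin_cases n' <;> first | rfl | skip
    · exact absurd h hyu
    · exact absurd h hyv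
    · exact absurd h.symm hyu
    · exact absurd h huv
    · exact absurd h.symm hyv
    · exact absurd h.symm huv
  · have h1 : Disjoint {x : Vertex N | x.1 k = b.1 k + 1} {x : Vertex N | x.1 k + 1 = b.1 k} := by
      refine Set.disjoint_left.2 fun x (h1 : _ = _) (h2 : _ = _) => ?_
      omega
    have h2 : Disjoint {x : Vertex N | x.1 k = b.1 k + 1} {a} := by
      refine Set.disjoint_singleton_right.2 fun (h1 : _ = _) => ?_
      omega
    have h3 : Disjoint {x : Vertex N | x.1 k + 1 = b.1 k} {a} := by
      refine Set.disjoint_singleton_right.2 fun (h1 : _ = _) => ?_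
      omega
    intro n n' h
    fin_cases n <;> fin_cases n' <;> first | exact absurd rfl h | skip
    · exact h1
    · exact h2
    · exact h1.symm
    · exact h3
    · exact h2.symm
    · exact h3.symm
  · have h1 : ∀ z : Vertex N, z.1 k = b.1 k → z ≠ a → ∀ n, z ∉
        (![{x | x.1 k = b.1 k + 1}, {x | x.1 k + 1 = b.1 k}, {a}] : Fin 3 → Set (Vertex N)) n := by
      intro z hz hza n
      fin_cases n
      · exact fun (h : _ = _) => by omega
      · exact fun (h : _ = _) => by omega
      · exact hza
    intro n n'
    fin_cases n'
    · exact h1 _ hyk (hgrid hy).2 n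
    · exact h1 _ huk (hgrid hu).2 n
    · exact h1 _ hvk (hgrid hv).2 n
  · intro n
    fin_cases n
    · exact R.exists_corner_of_gridAdj hp
    · exact R.exists_corner_of_gridAdj hq
    · exact exists_corner_of_diagAdj hba
  · intro n
    fin_cases n
    · exact R.exists_corner_of_gridAdj hy
    · exact R.exists_corner_of_gridAdj hu
    · exact R.exists_corner_of_gridAdj hv
  · have h1 : ∀ {n : Fin 3} {w : Vertex N}, k ≠ n → GridAdj n b w →
        Linked S {d | R.colour d ∈ insert w {x : Vertex N | x.1 k = b.1 k + 1}} b p w :=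
      fun hn hw => hopp hn hp hw (fun x hx => .inr (hx.trans hp')) (.inl rfl)
    have h2 : ∀ {n : Fin 3} {w : Vertex N}, k ≠ n → GridAdj n b w →
        Linked S {d | R.colour d ∈ insert w {x : Vertex N | x.1 k + 1 = b.1 k}} b q w :=
      fun hn hw => hopp hn hq hw
        (fun x hx => .inr ((congrArg (· + 1) hx).trans hq'.symm)) (.inl rfl)
    have ha : ∀ w : Vertex N, Linked S {d | R.colour d ∈ insert w ({a} : Set (Vertex N))} b a a :=
      fun w => hself hacne (.inr rfl)
    have hw : ∀ {n : Fin 3} {w : Vertex N}, GridAdj n b w →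
        Linked S {d | R.colour d ∈ insert w ({a} : Set (Vertex N))} b w w :=
      fun hw => hself (hgrid hw).1 (.inl rfl)
    have hsub : R.branch a ⊆ {d | R.colour d ∈ insert v ({a} : Set (Vertex N))} :=
      R.branch_subset (.inr rfl)
    intro n n'
    fin_cases n <;> fin_cases n'
    · exact h1 hki hy
    · exact h1 hkj hu
    · exact h1 hmk hv
    · exact h2 hki hy
    · exact h2 hkj hu
    · exact h2 hmk hv
    · exact linked_of_corner R hcy.symm (ha y) (hw hy)
    · exact linked_of_corner R hcu (ha u) (hw hu)
    · exact (hlca.mono hsub).symm.trans R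
        (linked_of_corner R hcv.symm (hlcc.mono hsub) (hw hv)) ⟨_, hcv.symm⟩

/-- Each edge of K₃,₃ is assigned the darts coloured by its two ends; as the colour classes are
disjoint, so are the sets of disjoint edges. -/
theorem not_embedsIn3Space {T : Set (subdivided N D).Edge}
    {e : ((subdivided N D).contract T).Edge} (R : Branches N D (insert e.1 T) b c)
    (hT : ((subdivided N D).graph T).Connected) {a : Vertex N} (hb : IsInterior b)
    (hba : DiagAdj D b a) (hline : ∀ k, a.1 k + c.1 k = b.1 k + b.1 k)
    (hpa : R.par a = b) (hca : R.root c = a) :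
    ¬ (((subdivided N D).contract T).contract {e}).EmbedsIn3Space := by
  obtain ⟨P, A, B, hB, hP, hBP, hA', hB', hlink⟩ := R.exists_linked hb hba hline hpa hca
  have hf : ∀ {y}, (∃ z, Corner D b y z) → ∃ z l h, (subdivided N D).Flag b y z l ∧
      first (insert e.1 T) l = some h := by
    rintro y ⟨z, l, hl⟩
    obtain ⟨h, hh⟩ := R.exists_first hl.1
    exact ⟨z, l, h, hl, hh⟩
  choose z l h hl hh using fun i => hf (hA' i)
  choose z' l' h' hl' hh' using fun i => hf (hB' i)
  refine not_embedsIn3Space_of_contractLinkConnected hT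
    (fun i j => {d | R.colour d ∈ insert (B j) (P i)}) h h' (fun i j i' j' hi hj => ?_)
    fun i j => hlink i j _ _ _ _ _ _ (hl i) (hh i) (hl' j) (hh' j)
  rw [Set.disjoint_left]
  rintro d (hd | hd) (hd' | hd')
  · exact hj (hB (hd.symm.trans hd'))
  · rw [hd] at hd'
    exact hBP _ _ hd'
  · rw [hd'] at hd
    exact hBP _ _ hd
  · exact Set.disjoint_left.1 (hP i i' hi) hd hd'

end Branches

theorem not_embedsIn3Space_contract_contract (hN : ∀ i, 1 ≤ N i)
    {T : Set (subdivided N D).Edge} (hT : (subdivided N D).IsSpanningTree T)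
    (hdiag : ∀ d : DiagEdge D, Sum.inr d ∈ T) (hcyc : FundamentalCyclesContainStraightTriple D T)
    (e : ((subdivided N D).contract T).Edge) :
    ¬ (((subdivided N D).contract T).contract {e}).EmbedsIn3Space := by
  obtain ⟨p, hp, a, b, c, d, ⟨hab, hbc, hcd, hline, hb, -⟩, hsub⟩ := hcyc e.1 e.2
  -- The three diagonals lie on the tree path, so bc can be exchanged for the contracted edge `e`,
  -- with b as root.
  obtain ⟨R, hRc, hRa, hroot, -, hne'⟩ := exists_rooted hT.2.2 hT.1 hp hsub
  let R' : Branches N D (insert e.1 T) b c :=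
    { R with
      one_le := hN
      diag_mem := fun x => Set.mem_insert_of_mem _ (hdiag x)
      diagAdj := hbc
      ne_root := hne'
      line := fun k => by
        rw [hRc]
        have := hline k
        omega }
  refine R'.not_embedsIn3Space hT.2.2.connected hb hab.symm (fun k => ?_) hRa hroot
  have := hline k
  omega

end Cuboid

theorem mainTheorem4 (n : ℕ) (hn : 20 ≤ n)
    (D : Cuboid.Subdivision ![2 * n + 1, n, n])
    (T : Set (Cuboid.subdivided ![2 * n + 1, n, n] D).Edge)
    (hT : (Cuboid.subdivided ![2 * n + 1, n, n] D).IsSpanningTree T)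
    (hdiag : ∀ d : Cuboid.DiagEdge D, Sum.inr d ∈ T)
    (hcyc : Cuboid.FundamentalCyclesContainStraightTriple D T)
    (e : ((Cuboid.subdivided ![2 * n + 1, n, n] D).contract T).Edge) :
    ¬ (((Cuboid.subdivided ![2 * n + 1, n, n] D).contract T).contract {e}).EmbedsIn3Space := by
  refine Cuboid.not_embedsIn3Space_contract_contract (fun i => ?_) hT hdiag hcyc e
  fin_cases i <;> simp <;> omega
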